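/- Let $d\ge 2$ and let $M$ be a complete $d$-dimensional smooth Riemannian manifold without boundary, all of whose sectional curvatures are $\ge -c_2$ for a constant $c_2>0$. Let $\varphi:\mathbb R\to M$ be a geodesic parametrized by arc length. Identify the unit vectors of $T_{\varphi(0)}M$ orthogonal to $\dot\varphi(0)$ with the unit sphere $S^{d-2}$ of $\mathbb R^{d-1}$ through a linear isometry, let $P_u:T_{\varphi(0)}M\to T_{\varphi(u)}M$ be parallel transport along $\varphi$, and let $$\Phi(u,h,\theta)=\exp_{\varphi(u)}\bigl(P_u(h\theta)\bigr),\qquad (u,h,\theta)\in\mathbb R\times\mathbb R_+\times S^{d-2},$$ be the point of $M$ with Fermi coordinates $(u,h,\theta)$ around $\varphi$. Write $dV_{S^{d-2}}$ for the surface measure of $S^{d-2}$ (the counting measure on two points if $d=2$) and $\mathrm{vol}$ for the Riemannian volume measure (extended to all subsets of $M$ as an outer measure). Then, in Fermi coordinates, $\mathrm{vol}$ is bounded from above by $$c_2^{-(d-2)/2}\sinh^{d-2}(\sqrt{c_2}\,h)\cosh(\sqrt{c_2}\,h)\,dh\,du\,dV_{S^{d-2}}(\theta),$$ which means that $$\mathrm{vol}(\Phi(S))\le\int_S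 c_2^{-(d-2)/2}\sinh^{d-2}(\sqrt{c_2}\,h)\cosh(\sqrt{c_2}\,h)\,dh\,du\,dV_{S^{d-2}}(\theta)$$ in the following two situations. (i) For every measurable $S\subseteq\mathbb R\times\mathbb R_+\times S^{d-2}$ such that for every $(u,h,\theta)\in S$ there is no focal point of $\varphi$ strictly before $h$ on the normal geodesic $s\mapsto\Phi(u,s,\theta)$; that is, for $0<s<h$ the differential at $(u,s\theta)$ of the normal exponential map $(u,w)\mapsto\exp_{\varphi(u)}(P_uw)$, $(u,w)\in\mathbb R\times\mathbb R^{d-1}$, is injective. (ii) For every measurable $S\subseteq\mathbb R\times\mathbb R_+\times S^{d-2}$, if moreover all sectional curvatures of $M$ are $\le 0$ (in particular if $M$ is a Cartan-Hadamard manifold). -/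

import Mathlib

open Bundle Manifold MeasureTheory Set
open scoped ContDiff ENNReal

noncomputable section

namespace Fermi

variable {d : ℕ} {M : Type*} [TopologicalSpace M] [ChartedSpace (EuclideanSpace ℝ (Fin d)) M]

/-! ### Curves and tangent vectors in charts -/

/-- The components, in the chart centred at `x`, of a vector `v` tangent to `M` at `p`
(meaningful when `p` lies in the domain of that chart). -/
def chartVec (x : M) {p : M} (v : TangentSpace (𝓡 d) p) : EuclideanSpace ℝ (Fin d) :=
  mfderiv (𝓡 d) 𝓘(ℝ, EuclideanSpace ℝ (Fin d)) (extChartAt (𝓡 d) x) p v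

/-- The coordinate vector field of the chart centred at `x` with constant components `v`,
at the point of `M` with coordinates `y`. -/
def coordVec (x : M) (y v : EuclideanSpace ℝ (Fin d)) :
    TangentSpace (𝓡 d) ((extChartAt (𝓡 d) x).symm y) :=
  mfderiv 𝓘(ℝ, EuclideanSpace ℝ (Fin d)) (𝓡 d) (extChartAt (𝓡 d) x).symm y v

/-- The velocity `γ'(t)` of a curve in `M`. -/
def velocity (γ : ℝ → M) (t : ℝ) : TangentSpace (𝓡 d) (γ t) :=
  mfderiv 𝓘(ℝ, ℝ) (𝓡 d) γ t (1 : ℝ)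

variable [RiemannianBundle (fun p : M ↦ TangentSpace (𝓡 d) p)]

/-! ### Metric, Levi-Civita connection and curvature in charts -/

/-- The metric tensor `g_y(v, w)` in the coordinates `y` of the chart centred at `x`. -/
def metric (x : M) (y v w : EuclideanSpace ℝ (Fin d)) : ℝ :=
  inner ℝ (coordVec x y v) (coordVec x y w)

/-- The matrix `(g_{ij}(y))` of the metric in the chart centred at `x`. -/
def gram (x : M) (y : EuclideanSpace ℝ (Fin d)) : Matrix (Fin d) (Fin d) ℝ :=
  Matrix.of fun i j ↦ metric x y (EuclideanSpace.single i 1) (EuclideanSpace.single j 1)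

/-- The Christoffel symbols of the Levi-Civita connection, as the map
`(v, w) ↦ (∑_{i,j} Γ^k_{ij}(y) v^i w^j)_k`, where
`Γ^k_{ij} = ½ ∑_l g^{kl} (∂_i g_{jl} + ∂_j g_{il} - ∂_l g_{ij})`. -/
def christoffel (x : M) (y v w : EuclideanSpace ℝ (Fin d)) : EuclideanSpace ℝ (Fin d) :=
  WithLp.toLp 2 fun k ↦ (1 / 2 : ℝ) * ∑ l, (gram x y)⁻¹ k l *
    (fderiv ℝ (fun z ↦ metric x z w (EuclideanSpace.single l 1)) y v
      + fderiv ℝ (fun z ↦ metric x z v (EuclideanSpace.single l 1)) y w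
      - fderiv ℝ (fun z ↦ metric x z v w) y (EuclideanSpace.single l 1))

/-- The curvature tensor `R(v, w)z = ∇_v ∇_w z - ∇_w ∇_v z` in the coordinates of the chart centred
at `x`, for coordinate vector fields `v, w, z` with constant components. -/
def curvature (x : M) (y v w z : EuclideanSpace ℝ (Fin d)) : EuclideanSpace ℝ (Fin d) :=
  fderiv ℝ (fun y' ↦ christoffel x y' w z) y v - fderiv ℝ (fun y' ↦ christoffel x y' v z) y w
    + christoffel x y v (christoffel x y w z) - christoffel x y w (christoffel x y v z)

/-- The sectional curvature `⟨R(v, w)w, v⟩ / (|v|²|w|² - ⟨v, w⟩²)` of the plane spanned by two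
linearly independent tangent vectors at `p`. -/
def sectionalCurvature (p : M) (v w : TangentSpace (𝓡 d) p) : ℝ :=
  metric p (extChartAt (𝓡 d) p p)
      (curvature p (extChartAt (𝓡 d) p p) (chartVec p v) (chartVec p w) (chartVec p w))
      (chartVec p v)
    / (‖v‖ ^ 2 * ‖w‖ ^ 2 - inner ℝ v w ^ 2)

/-! ### Parallel transport, geodesics, exponential map -/

/-- The vector field `V` along the curve `γ` is parallel: in every chart,
`(V^k)' + ∑_{i,j} Γ^k_{ij}(γ) (γ^i)' V^j = 0`. -/
def IsParallel (γ : ℝ → M) (V : ∀ t, TangentSpace (𝓡 d) (γ t)) : Prop :=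
  ∀ (x : M) (t : ℝ), γ t ∈ (extChartAt (𝓡 d) x).source →
    HasDerivAt (fun s ↦ chartVec x (V s))
      (-christoffel x (extChartAt (𝓡 d) x (γ t)) (chartVec x (velocity γ t)) (chartVec x (V t))) t

variable (d) in
/-- A geodesic defined on the whole real line (constant curves are allowed). -/
def IsGeodesic (γ : ℝ → M) : Prop :=
  ContMDiff 𝓘(ℝ, ℝ) (𝓡 d) ∞ γ ∧ IsParallel γ (velocity (d := d) γ)

open Classical in
/-- Parallel transport along `γ` from time `0` to time `u`. -/
def parallelTransport (γ : ℝ → M) (u : ℝ) (v : TangentSpace (𝓡 d) (γ 0)) :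
    TangentSpace (𝓡 d) (γ u) :=
  if h : ∃ V : ∀ t, TangentSpace (𝓡 d) (γ t), IsParallel γ V ∧ V 0 = v then h.choose u else 0

open Classical in
/-- The exponential map: `exp_p(v) = γ(1)`, where `γ` is the geodesic with `γ(0) = p` and
`γ'(0) = v` (on a complete manifold such a geodesic exists and is unique). -/
def expMap (p : M) (v : TangentSpace (𝓡 d) p) : M :=
  if h : ∃ γ : ℝ → M, IsGeodesic d γ ∧
      (⟨γ 0, velocity γ 0⟩ : TangentBundle (𝓡 d) M) = ⟨p, v⟩ then h.choose 1 else p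

/-! ### Fermi coordinates

The unit vectors at `φ 0` normal to `φ` are identified with the unit sphere of `ℝ^(d-1)`
by means of a linear isometry `L`. -/

/-- The normal exponential map `(u, w) ↦ exp_{φ(u)}(P_u (L w))` of the curve `φ`, where `P_u` is
the parallel transport along `φ` from `φ 0` to `φ u`. -/
def normalExp (φ : ℝ → M) (L : EuclideanSpace ℝ (Fin (d - 1)) →ₗᵢ[ℝ] TangentSpace (𝓡 d) (φ 0))
    (q : ℝ × EuclideanSpace ℝ (Fin (d - 1))) : M :=
  expMap (φ q.1) (parallelTransport φ q.1 (L q.2))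

/-- The point `Φ(u, h, θ) = exp_{φ(u)}(P_u (hθ))` with Fermi coordinates `(u, h, θ)`. -/
def fermiMap (φ : ℝ → M) (L : EuclideanSpace ℝ (Fin (d - 1)) →ₗᵢ[ℝ] TangentSpace (𝓡 d) (φ 0))
    (q : ℝ × ℝ × Metric.sphere (0 : EuclideanSpace ℝ (Fin (d - 1))) 1) : M :=
  normalExp φ L (q.1, q.2.1 • (q.2.2 : EuclideanSpace ℝ (Fin (d - 1))))

/-- There is no focal point of `φ` strictly before the parameter `h` on the normal geodesic
`s ↦ Φ(u, s, θ)`: the normal exponential map has an injective differential at `(u, sθ)`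
for `0 < s < h`. -/
def NoFocalPointBefore (φ : ℝ → M)
    (L : EuclideanSpace ℝ (Fin (d - 1)) →ₗᵢ[ℝ] TangentSpace (𝓡 d) (φ 0))
    (q : ℝ × ℝ × Metric.sphere (0 : EuclideanSpace ℝ (Fin (d - 1))) 1) : Prop :=
  ∀ s ∈ Ioo 0 q.2.1, Function.Injective
    (mfderiv 𝓘(ℝ, ℝ × EuclideanSpace ℝ (Fin (d - 1))) (𝓡 d) (normalExp φ L)
      (q.1, s • (q.2.2 : EuclideanSpace ℝ (Fin (d - 1)))))

/-! ### Volume -/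

variable (d) in
/-- The Riemannian volume of the domain of the chart centred at `x`: the measure `√(det g) dy`
on the image of the chart, transported to `M`. -/
def chartVolume [MeasurableSpace M] (x : M) : Measure M :=
  ((volume.restrict (extChartAt (𝓡 d) x).target).withDensity
    fun y ↦ ENNReal.ofReal (√(gram x y).det)).map (extChartAt (𝓡 d) x).symm

variable (d M) in
/-- The Riemannian volume measure of `M`, i.e. the measure that restricts to `chartVolume d x` on
the domain of each chart. As those measures agree on overlaps, it is their supremum. -/
def riemannianVolume [MeasurableSpace M] : Measure M :=
  ⨆ x : M, chartVolume d x

/-- The measure `c^{-(d-2)/2} sinh^{d-2}(√c h) cosh(√c h) du dh dV(θ)` on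
`ℝ × ℝ × S^{d-2}`, where `V` is the surface measure of the sphere (counting measure if `d = 2`). -/
def modelVolume (d : ℕ) (c : ℝ) :
    Measure (ℝ × ℝ × Metric.sphere (0 : EuclideanSpace ℝ (Fin (d - 1))) 1) :=
  ((volume : Measure ℝ).prod ((volume : Measure ℝ).prod
    (volume : Measure (EuclideanSpace ℝ (Fin (d - 1)))).toSphere)).withDensity fun q ↦
      ENNReal.ofReal (c ^ (-((d : ℝ) - 2) / 2) * Real.sinh (√c * q.2.1) ^ (d - 2)
        * Real.cosh (√c * q.2.1))

end Fermi

end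

/-! The theorem is a Heintze-Karcher type estimate. Under `normalExp`, volume is multiplied by at
most the Jacobian `normalJacobian`, so a pointwise bound for this Jacobian suffices. The area
formula is used only as an inequality, so `normalExp` need not be injective.

Fix a unit normal direction θ at φ(u) and the geodesic s ↦ Φ(u,s,θ). Varying u or the initial vector
gives Jacobi fields along it. Their components in a parallel orthonormal frame form a matrix A(s)
with A'' = -RA, where R is the symmetric curvature operator X ↦ R(X,T)T. The variation in u starts
with value φ' and zero covariant derivative; a variation in a normal direction starts with value
zero and derivative that direction. Thus A(0) and A'(0) are diagonal. In constant curvature -c₂ the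
solution is diagonal, with entries cosh(√c₂ s) along φ, s in the direction θ, and sinh(√c₂ s)/√c₂ in
the remaining d-2 directions.

The lower curvature bound makes det A divided by the product of these entries nonincreasing as long
as det A does not vanish, and the quotient tends to 1 at s = 0 (`JacobiComparison.riccati_le`,
`JacobiComparison.abs_det_le`). Nonvanishing before h is the absence of focal points in (i). In (ii)
it follows from convexity of |Av|² for nonpositive curvature
(`JacobiComparison.det_ne_zero_of_nonpos`). Since |det A(s)| is s^(d-1) times the Jacobian at
(u,sθ), cancelling one radial factor gives `normalJacobian_le`. Polar coordinates in the normal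
space turn this into the volume bound (`riemannianVolume_fermiMap_image_le`).

The rest is foundation: smooth dependence of flows on initial data, by the implicit function theorem
in a space of curves; the Levi-Civita connection and its curvature in charts; the geodesic flow and
parallel transport as global flows; and the volume as a supremum of chart measures. -/

noncomputable section
namespace Fermi
open Filter Topology unitInterval

/-! ### Smooth dependence of flows on initial conditions -/

section Superposition

set_option synthInstance.maxHeartbeats 200000

universe u
variable {E : Type u} [NormedAddCommGroup E] [NormedSpace ℝ E]

variable {E' G : Type u} [NormedAddCommGroup E'] [NormedSpace ℝ E']
  [NormedAddCommGroup G] [NormedSpace ℝ G]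

/-- Pointwise application of a continuous bilinear map to continuous families of vectors. -/
def pointwiseApply (B : G →L[ℝ] E →L[ℝ] E') : C(I, G) →L[ℝ] C(I, E) →L[ℝ] C(I, E') :=
  LinearMap.mkContinuous₂
    (LinearMap.mk₂ ℝ (fun (A : C(I, G)) (h : C(I, E)) ↦
        (⟨fun s ↦ B (A s) (h s), by fun_prop⟩ : C(I, E')))
      (by intros; ext; simp) (by intros; ext; simp) (by intros; ext; simp) (by intros; ext; simp))
    ‖B‖ (by
      intro A h
      rw [ContinuousMap.norm_le _ (by positivity)]
      intro s
      refine (B.le_opNorm₂ _ _).trans ?_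
      gcongr
      · exact A.norm_coe_le_norm s
      · exact h.norm_coe_le_norm s)

@[simp] lemma pointwiseApply_apply (B : G →L[ℝ] E →L[ℝ] E') (A : C(I, G)) (h : C(I, E)) (s : I) :
    pointwiseApply B A h s = B (A s) (h s) := rfl

/-- At each parameter the remainder is estimated by the mean value inequality. Uniformity in the
parameter comes from continuity of postcomposition with `F'` in the sup norm. -/
lemma hasFDerivAt_comp_continuousMap (B : G →L[ℝ] E →L[ℝ] E') (F : C(E, E')) (F' : C(E, G))
    (hF : ∀ x, HasFDerivAt F (B (F' x)) x) (γ : C(I, E)) :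
    HasFDerivAt (fun g : C(I, E) ↦ F.comp g) (pointwiseApply B (F'.comp γ)) γ := by
  rw [hasFDerivAt_iff_isLittleO, Asymptotics.isLittleO_iff]
  intro ε hε
  have hc : ContinuousAt (fun g : C(I, E) ↦ F'.comp g) γ :=
    (ContinuousMap.continuous_postcomp F').continuousAt
  obtain ⟨δ, hδ, H⟩ := Metric.continuousAt_iff.1 hc (ε / (‖B‖ + 1)) (by positivity)
  filter_upwards [Metric.ball_mem_nhds γ hδ] with g hg
  rw [ContinuousMap.norm_le _ (by positivity)]
  intro s
  -- The curve γ translated by y - γ(s) stays in the δ-ball around γ and passes through y at s, so δ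
  -- serves all s at once.
  have key : ∀ y ∈ Metric.ball (γ s) δ, ‖B (F' y) - B (F' (γ s))‖ ≤ ε := by
    intro y hy
    have h1 : dist (γ + ContinuousMap.const I (y - γ s)) γ < δ := by
      rw [dist_eq_norm, add_sub_cancel_left]
      refine lt_of_le_of_lt ((ContinuousMap.norm_le _ (norm_nonneg (y - γ s))).2 fun _ ↦ le_rfl) ?_
      rwa [← dist_eq_norm]
    have h2 := (ContinuousMap.dist_apply_le_dist s).trans_lt (H h1)
    rw [dist_eq_norm] at h2
    have h3 : ‖F' y - F' (γ s)‖ < ε / (‖B‖ + 1) := by simpa using h2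
    rw [lt_div_iff₀ (by positivity)] at h3
    rw [← map_sub]
    refine (B.le_opNorm _).trans ?_
    nlinarith [norm_nonneg (F' y - F' (γ s))]
  have hgs : g s ∈ Metric.ball (γ s) δ := (ContinuousMap.dist_apply_le_dist s).trans_lt hg
  have := (convex_ball (γ s) δ).norm_image_sub_le_of_norm_hasFDerivWithin_le' (f := F)
    (fun y _ ↦ (hF y).hasFDerivWithinAt) key (Metric.mem_ball_self hδ) hgs
  refine le_trans (le_of_eq ?_) (this.trans ?_)
  · simp
  · gcongr
    exact (g - γ).norm_coe_le_norm s

/-- The derivative is written as `B (F' x)` with `F'` valued in a new space in the same universe, so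
that an induction on the order can be applied to `F'`. -/
lemma exists_continuousMap_fderiv {n : ℕ} (F : C(E, E')) (hF : ContDiff ℝ (n + 1) F) :
    ∃ (G : Type u) (_ : NormedAddCommGroup G) (_ : NormedSpace ℝ G) (B : G →L[ℝ] E →L[ℝ] E')
      (F' : C(E, G)), ContDiff ℝ n F' ∧ ∀ x, HasFDerivAt F (B (F' x)) x := by
  rw [contDiff_succ_iff_fderiv] at hF
  exact ⟨E →L[ℝ] E', inferInstance, inferInstance, .id ℝ _, ⟨fderiv ℝ F, hF.2.2.continuous⟩, hF.2.2,
    fun x ↦ (hF.1 x).hasFDerivAt⟩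

/-- Induction on the order: the derivative of the superposition operator is a continuous linear
function of the superposition operator of `F'`, which has one order less. -/
lemma contDiff_comp_continuousMap (n : ℕ) (F : C(E, E')) (hF : ContDiff ℝ n F) :
    ContDiff ℝ n (fun g : C(I, E) ↦ F.comp g) := by
  induction n generalizing E' with
  | zero => exact contDiff_zero.2 (ContinuousMap.continuous_postcomp F)
  | succ n ih =>
    rw [Nat.cast_add, Nat.cast_one] at hF
    obtain ⟨G, _, _, B, F', hF', hB⟩ := exists_continuousMap_fderiv F hF
    rw [Nat.cast_add, Nat.cast_one, contDiff_succ_iff_hasFDerivAt]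
    refine ⟨fun g ↦ pointwiseApply B (F'.comp g), ?_, fun g ↦ ?_⟩
    · exact (ContinuousLinearMap.contDiff (E := C(I, G)) (F := C(I, E) →L[ℝ] C(I, E'))
        (pointwiseApply B)).comp (ih F' hF')
    · exact hasFDerivAt_comp_continuousMap B F F' hB g

/-- The primitive vanishing at `0`. -/
def primitive (E : Type u) [NormedAddCommGroup E] [NormedSpace ℝ E] : C(I, E) →L[ℝ] C(I, E) :=
  LinearMap.mkContinuous
    { toFun := fun g ↦ ⟨fun s ↦ ∫ t in (0 : ℝ)..s, g (projIcc 0 1 zero_le_one t), by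
        have : Continuous fun t : ℝ ↦ g (projIcc 0 1 zero_le_one t) :=
          g.continuous.comp continuous_projIcc
        exact (intervalIntegral.continuous_primitive
          (fun a b ↦ this.intervalIntegrable a b) 0).comp continuous_subtype_val⟩
      map_add' := fun f g ↦ by
        ext s
        have hf : Continuous fun t : ℝ ↦ f (projIcc 0 1 zero_le_one t) :=
          f.continuous.comp continuous_projIcc
        have hg : Continuous fun t : ℝ ↦ g (projIcc 0 1 zero_le_one t) :=
          g.continuous.comp continuous_projIcc
        exact intervalIntegral.integral_add (hf.intervalIntegrable _ _) (hg.intervalIntegrable _ _)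
      map_smul' := fun c g ↦ by
        ext s
        exact intervalIntegral.integral_smul _ _ }
    1 (by
      intro g
      rw [ContinuousMap.norm_le _ (by positivity), one_mul]
      intro s
      refine (intervalIntegral.norm_integral_le_of_norm_le_const (C := ‖g‖)
        fun t _ ↦ g.norm_coe_le_norm _).trans ?_
      have hs := s.2
      rw [sub_zero, abs_of_nonneg hs.1]
      exact mul_le_of_le_one_right (norm_nonneg _) hs.2)

lemma primitive_apply (g : C(I, E)) (s : I) :
    primitive E g s = ∫ t in (0 : ℝ)..s, g (projIcc 0 1 zero_le_one t) := rfl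

/-- The integral equation for integral curves of `F` with starting point `q.1.2`, run on `[0, 1]`
at speed `q.1.1`. -/
def flowEquation (F : C(E, E)) (q : (ℝ × E) × C(I, E)) : C(I, E) :=
  q.2 - ContinuousLinearMap.const ℝ I q.1.2 - q.1.1 • primitive E (F.comp q.2)

lemma contDiff_flowEquation {n : ℕ} (F : C(E, E)) (hF : ContDiff ℝ n F) :
    ContDiff ℝ n (flowEquation F) := by
  have h1 : ContDiff ℝ n fun q : (ℝ × E) × C(I, E) ↦ F.comp q.2 :=
    (contDiff_comp_continuousMap n F hF).comp contDiff_snd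
  have h2 := (primitive E).contDiff.comp h1
  have h3 : ContDiff ℝ n fun q : (ℝ × E) × C(I, E) ↦ ContinuousLinearMap.const ℝ I q.1.2 :=
    (ContinuousLinearMap.contDiff _).comp (contDiff_snd.comp contDiff_fst)
  exact (contDiff_snd.sub h3).sub ((contDiff_fst.comp contDiff_fst).smul h2)

/-- At speed 0 the equation says that the curve equals its starting point, so the partial derivative
in the curve is the identity and the implicit function theorem applies. The second clause is its
uniqueness part, which later identifies `ψ` with actual integral curves. -/
lemma exists_contDiffAt_solution [CompleteSpace E] {n : ℕ} (hn : n ≠ 0)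
    (F : C(E, E)) (hF : ContDiff ℝ n F) (z₀ : E) :
    ∃ ψ : ℝ × E → C(I, E), ContDiffAt ℝ n ψ (0, z₀) ∧
      ∀ᶠ v in 𝓝 (((0, z₀), ContinuousMap.const I z₀) : (ℝ × E) × C(I, E)),
        flowEquation F v = 0 → ψ v.1 = v.2 := by
  set w : (ℝ × E) × C(I, E) := ((0, z₀), ContinuousMap.const I z₀) with hw
  have hc : ContDiffAt ℝ n (flowEquation F) w := (contDiff_flowEquation F hF).contDiffAt
  have hn' : (n : ℕ∞ω) ≠ 0 := by exact_mod_cast hn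
  have h0 : flowEquation F w = 0 := by
    ext s; simp [flowEquation, hw]
  have hinv : fderiv ℝ (flowEquation F) w ∘L .inr ℝ (ℝ × E) C(I, E) = .id ℝ _ := by
    have h1 : HasFDerivAt (flowEquation F) (fderiv ℝ (flowEquation F) w) w :=
      (hc.differentiableAt hn').hasFDerivAt
    have h2 : HasFDerivAt (fun g : C(I, E) ↦ (((0, z₀), g) : (ℝ × E) × C(I, E)))
        (.inr ℝ (ℝ × E) C(I, E)) w.2 := hasFDerivAt_prodMk_right _ _
    have h3 := HasFDerivAt.comp (g := flowEquation F)
      (f := fun g : C(I, E) ↦ (((0, z₀), g) : (ℝ × E) × C(I, E))) w.2 h1 h2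
    refine h3.unique ?_
    have h4 : flowEquation F ∘ (fun g : C(I, E) ↦ (((0, z₀), g) : (ℝ × E) × C(I, E)))
        = fun g ↦ g - ContinuousLinearMap.const ℝ I z₀ := by
      ext g s; simp [flowEquation]
    rw [h4]
    exact (hasFDerivAt_id _).sub_const _
  have hI : (fderiv ℝ (flowEquation F) w ∘L .inr ℝ (ℝ × E) C(I, E)).IsInvertible := by
    rw [hinv]; exact ⟨ContinuousLinearEquiv.refl ℝ _, rfl⟩
  refine ⟨hc.implicitFunction hn' hI, hc.contDiffAt_implicitFunction hn' hI, ?_⟩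
  filter_upwards [hc.eventually_apply_eq_iff_implicitFunction hn' hI] with v hv h
  exact hv.1 (h.trans h0.symm)

end Superposition

/-- Local flows of `C^n` vector fields are `C^n` in time and initial condition. -/
theorem exists_contDiffAt_localFlow {E : Type*} [NormedAddCommGroup E] [NormedSpace ℝ E]
    [FiniteDimensional ℝ E] {n : ℕ} (hn : n ≠ 0) {F : E → E} {z₀ : E}
    (hF : ContDiffAt ℝ n F z₀) {U : Set E} (hU : U ∈ 𝓝 z₀) :
    ∃ δ > 0, ∃ Ψ : ℝ × E → E, ∀ τ z, |τ| < δ → dist z z₀ < δ →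
      ContDiffAt ℝ n Ψ (τ, z) ∧ Ψ (0, z) = z ∧
        HasDerivAt (fun s ↦ Ψ (s, z)) (F (Ψ (τ, z))) τ ∧ Ψ (τ, z) ∈ U := by
  have : CompleteSpace E := FiniteDimensional.complete ℝ E
  have hn' : (n : ℕ∞ω) ≠ 0 := by exact_mod_cast hn
  -- A cutoff makes the field globally smooth, as the superposition operator requires, without
  -- changing it near `z₀`.
  obtain ⟨F', hF', hFF'⟩ : ∃ F' : E → E, ContDiff ℝ n F' ∧ ∀ᶠ z in 𝓝 z₀, F' z = F z := by
    obtain ⟨ρ, hρ, hρ'⟩ := Metric.eventually_nhds_iff_ball.1 (hF.eventually (by simp))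
    let χ : ContDiffBump z₀ := ⟨ρ / 4, ρ / 2, by positivity, by linarith⟩
    refine ⟨fun z ↦ χ z • F z, contDiff_iff_contDiffAt.2 fun z ↦ ?_, ?_⟩
    · by_cases hz : z ∈ Metric.ball z₀ ρ
      · exact χ.contDiffAt.smul (hρ' z hz)
      · have : ∀ᶠ y in 𝓝 z, χ y • F y = 0 := by
          have hz' : z ∈ (tsupport χ)ᶜ := by
            rw [χ.tsupport_eq]
            intro h
            exact hz (Metric.closedBall_subset_ball (by change ρ / 2 < ρ; linarith) h)
          filter_upwards [(isClosed_tsupport χ).isOpen_compl.mem_nhds hz'] with y hy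
          rw [image_eq_zero_of_notMem_tsupport hy, zero_smul]
        exact contDiffAt_const.congr_of_eventuallyEq this
    · filter_upwards [χ.eventuallyEq_one] with z hz
      simp [hz]
  obtain ⟨ψ, hψ, hψ'⟩ := exists_contDiffAt_solution hn ⟨F', hF'.continuous⟩ hF' z₀
  -- Picard-Lindelöf supplies existence and joint continuity; smoothness is then obtained by
  -- comparison with `ψ`.
  obtain ⟨ε, hε, a, r, L, K, hr, hpl⟩ := IsPicardLindelof.of_contDiffAt_one
    ((hF'.contDiffAt (x := z₀)).of_le (n := n) (by exact_mod_cast Nat.one_le_iff_ne_zero.2 hn))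
  obtain ⟨α, hα, hαc⟩ := (hpl 0).exists_forall_mem_closedBall_eq_hasDerivWithinAt_continuousOn
  simp only [zero_sub, zero_add] at hα hαc
  have hα0 : ContinuousAt α (z₀, 0) := hαc.continuousAt
    (prod_mem_nhds (Metric.closedBall_mem_nhds _ (by exact_mod_cast hr))
      (Icc_mem_nhds (by linarith) hε))
  have hαz : α (z₀, 0) = z₀ := (hα z₀ (by simp)).1
  have hψe : ∀ᶠ p in 𝓝 ((0, z₀) : ℝ × E), ContDiffAt ℝ n ψ p := hψ.eventually (by simp)
  obtain ⟨ρ₁, hρ₁, h1⟩ := Metric.eventually_nhds_iff.1 hψe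
  obtain ⟨ρ₂, hρ₂, h2⟩ := Metric.eventually_nhds_iff.1 hψ'
  -- The radius is halved because the sup distance of curves will only be bounded by a non-strict
  -- inequality.
  have hN : ∀ᶠ p in 𝓝 ((z₀, 0) : E × ℝ), dist (α p) z₀ < ρ₂ / 2 ∧ α p ∈ U ∧ F' (α p) = F (α p) := by
    have hα0' : Tendsto α (𝓝 (z₀, 0)) (𝓝 z₀) := by simpa [ContinuousAt, hαz] using hα0
    exact (hα0'.eventually (Metric.ball_mem_nhds z₀ (half_pos hρ₂))).and
      ((hα0'.eventually hU).and (hα0'.eventually hFF'))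
  obtain ⟨ρ₃, hρ₃, h3⟩ := Metric.eventually_nhds_iff.1 hN
  obtain ⟨δ, hδ, hd1, hd2, hd3, hd4, hd5⟩ : ∃ δ > 0, δ ≤ ρ₁ ∧ δ ≤ ρ₂ ∧ δ ≤ ρ₃ ∧ δ ≤ ε ∧ δ ≤ r := by
    refine ⟨min ρ₁ (min ρ₂ (min ρ₃ (min ε r))), by positivity, ?_⟩
    simp
  have hdom : ∀ τ z, |τ| < δ → dist z z₀ < δ → z ∈ Metric.closedBall z₀ (r : ℝ) ∧
      HasDerivAt (fun s ↦ α (z, s)) (F' (α (z, τ))) τ ∧ dist (α (z, τ)) z₀ < ρ₂ / 2 ∧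
      α (z, τ) ∈ U ∧ F' (α (z, τ)) = F (α (z, τ)) := by
    intro τ z hτ hz
    have hz' : z ∈ Metric.closedBall z₀ (r : ℝ) := (hz.trans_le hd5).le
    have hτ' := abs_lt.1 (hτ.trans_le hd4)
    refine ⟨hz', ((hα z hz').2 τ ⟨hτ'.1.le, hτ'.2.le⟩).hasDerivAt (Icc_mem_nhds hτ'.1 hτ'.2),
      h3 ?_⟩
    rw [Prod.dist_eq]
    exact max_lt (hz.trans_le hd3) (by simpa [Real.dist_eq] using hτ.trans_le hd3)
  -- The rescaled curve s ↦ α(z,sτ) on [0,1] solves the integral equation with speed τ and stays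
  -- near the constant curve. It is therefore ψ(τ,z), and evaluation at 1 recovers α(z,τ).
  have hsol : ∀ τ z, |τ| < δ → dist z z₀ < δ → ψ (τ, z) 1 = α (z, τ) := by
    intro τ z hτ hz
    have hsτ : ∀ s : ℝ, s ∈ Icc (0 : ℝ) 1 → |s * τ| < δ := fun s hs ↦ by
      rw [abs_mul, abs_of_nonneg hs.1]
      exact (mul_le_of_le_one_left (abs_nonneg _) hs.2).trans_lt hτ
    have hd : ∀ s ∈ Icc (0 : ℝ) 1,
        HasDerivAt (fun s ↦ α (z, s * τ)) (τ • F' (α (z, s * τ))) s := fun s hs ↦ by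
      have : HasDerivAt (fun s ↦ α (z, s * τ)) ((1 * τ) • F' (α (z, s * τ))) s :=
        HasDerivAt.scomp (g₁ := fun s ↦ α (z, s)) s (hdom (s * τ) z (hsτ s hs) hz).2.1
          ((hasDerivAt_id s).mul_const τ)
      simpa only [one_mul] using this
    have hc : ContinuousOn (fun s : ℝ ↦ α (z, s * τ)) (Icc 0 1) :=
      fun s hs ↦ (hd s hs).continuousAt.continuousWithinAt
    let g : C(I, E) := ⟨fun s ↦ α (z, (s : ℝ) * τ), hc.domRestrict⟩
    have hgs : ∀ s : I, g s = α (z, (s : ℝ) * τ) := fun _ ↦ rfl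
    have hg : flowEquation ⟨F', hF'.continuous⟩ ((τ, z), g) = 0 := by
      ext s
      have hint : ∫ t in (0 : ℝ)..s, τ • F' (α (z, t * τ)) = α (z, s * τ) - z := by
        rw [intervalIntegral.integral_eq_sub_of_hasDerivAt (f := fun s ↦ α (z, s * τ))]
        · simp [(hα z (hdom τ z hτ hz).1).1]
        · intro t ht
          rw [uIcc_of_le s.2.1] at ht
          exact hd t ⟨ht.1, ht.2.trans s.2.2⟩
        · apply ContinuousOn.intervalIntegrable
          rw [uIcc_of_le s.2.1]
          exact (continuousOn_const.smul (hF'.continuous.comp_continuousOn hc)).mono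
            (Icc_subset_Icc_right s.2.2)
      have hpr : (primitive E) ((⟨F', hF'.continuous⟩ : C(E, E)).comp g) s
          = ∫ t in (0 : ℝ)..s, F' (α (z, t * τ)) := by
        rw [primitive_apply]
        refine intervalIntegral.integral_congr fun t ht ↦ ?_
        rw [uIcc_of_le s.2.1] at ht
        simp [hgs, projIcc_of_mem zero_le_one (⟨ht.1, ht.2.trans s.2.2⟩ : t ∈ Icc (0 : ℝ) 1)]
      rw [intervalIntegral.integral_smul] at hint
      simp only [flowEquation, ContinuousMap.sub_apply, ContinuousMap.smul_apply, hpr, hint]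
      simp [hgs]
    have := h2 (y := ((τ, z), g)) ?_ hg
    · simp only at this
      rw [this]; simp [hgs]
    · rw [Prod.dist_eq, Prod.dist_eq]
      refine max_lt (max_lt ?_ (hz.trans_le hd2)) ?_
      · simpa [Real.dist_eq] using hτ.trans_le hd2
      · refine lt_of_le_of_lt ?_ (half_lt_self hρ₂)
        rw [ContinuousMap.dist_le (half_pos hρ₂).le]
        intro s
        exact (hdom _ z (hsτ s s.2) hz).2.2.1.le
  refine ⟨δ, hδ, fun p ↦ α (p.2, p.1), fun τ z hτ hz ↦ ?_⟩
  obtain ⟨k1, k2, k3, k4, k5⟩ := hdom τ z hτ hz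
  refine ⟨?_, (hα z k1).1, k5 ▸ k2, k4⟩
  have hev : ∀ᶠ p in 𝓝 (τ, z), α (p.2, p.1) = ψ p 1 := by
    have ho := (isOpen_lt (by fun_prop : Continuous fun p : ℝ × E ↦ |p.1|)
      (continuous_const (y := δ))).inter
      (isOpen_lt (by fun_prop : Continuous fun p : ℝ × E ↦ dist p.2 z₀) (continuous_const (y := δ)))
    filter_upwards [ho.mem_nhds ⟨hτ, hz⟩] with p hp
    exact (hsol p.1 p.2 hp.1 hp.2).symm
  refine ContDiffAt.congr_of_eventuallyEq ?_ hev
  have hh : ContDiffAt ℝ n ψ (τ, z) := by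
    apply h1
    rw [Prod.dist_eq]
    exact max_lt (by simpa [Real.dist_eq] using hτ.trans_le hd1) (hz.trans_le hd1)
  exact (ContinuousMap.evalCLM ℝ (1 : I)).contDiff.contDiffAt.comp _ hh

end Fermi
end

noncomputable section
namespace Fermi
open Filter Topology Matrix

/-! ### Comparison of matrix Jacobi equations -/

section MatrixComparison

variable {ι : Type*} [Fintype ι] [DecidableEq ι]

/-- Jacobi's formula: differentiating the Leibniz expansion replaces one column at a time by its
derivative, and Cramer's rule evaluates the resulting determinants. -/
lemma hasDerivAt_det {A : ℝ → Matrix ι ι ℝ} {A' : Matrix ι ι ℝ} {s : ℝ}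
    (hA : ∀ i j, HasDerivAt (fun t ↦ A t i j) (A' i j) s) :
    HasDerivAt (fun t ↦ (A t).det) (((A s).adjugate * A').trace) s := by
  have h1 : HasDerivAt (fun t ↦ (A t).det) (∑ σ : Equiv.Perm ι, ((Equiv.Perm.sign σ : ℤ) : ℝ) *
      ∑ i, (∏ j ∈ Finset.univ.erase i, A s (σ j) j) * A' (σ i) i) s := by
    simp only [Matrix.det_apply']
    refine HasDerivAt.fun_sum fun σ _ ↦ HasDerivAt.const_mul _ ?_
    simpa using HasDerivAt.fun_finsetProd (u := Finset.univ) fun i _ ↦ hA (σ i) i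
  convert h1 using 1
  simp_rw [Finset.mul_sum]
  rw [Finset.sum_comm, Matrix.trace]
  refine Finset.sum_congr rfl fun i _ ↦ ?_
  have h2 : ((A s).adjugate * A') i i = ((A s).updateCol i (fun k ↦ A' k i)).det := by
    rw [← Matrix.cramer_apply, Matrix.cramer_eq_adjugate_mulVec]
    rfl
  rw [Matrix.diag_apply, h2, Matrix.det_apply']
  refine Finset.sum_congr rfl fun σ _ ↦ ?_
  rw [← Finset.prod_erase_mul _ _ (Finset.mem_univ i)]
  congr 2
  · refine Finset.prod_congr rfl fun j hj ↦ ?_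
    rw [Matrix.updateCol_ne (Finset.ne_of_mem_erase hj)]
  · simp

lemma differentiableAt_det {A : ℝ → Matrix ι ι ℝ} {s : ℝ}
    (hA : ∀ i j, DifferentiableAt ℝ (fun t ↦ A t i j) s) :
    DifferentiableAt ℝ (fun t ↦ (A t).det) s :=
  (hasDerivAt_det (A' := fun i j ↦ deriv (fun t ↦ A t i j) s)
    fun i j ↦ (hA i j).hasDerivAt).differentiableAt

lemma differentiableAt_adjugate {A : ℝ → Matrix ι ι ℝ} {s : ℝ}
    (hA : ∀ i j, DifferentiableAt ℝ (fun t ↦ A t i j) s) (i j : ι) :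
    DifferentiableAt ℝ (fun t ↦ (A t).adjugate i j) s := by
  simp only [Matrix.adjugate_apply]
  refine differentiableAt_det fun k l ↦ ?_
  by_cases hk : k = j
  · subst hk; simp
  · simpa [Matrix.updateRow_ne hk] using hA k l

/-- Data of a matrix Jacobi equation `A'' = -R A`, together with a diagonal comparison equation
`f'' = κ f` with the same initial data. -/
structure JacobiComparison (A A' R : ℝ → Matrix ι ι ℝ) (f f' : ι → ℝ → ℝ) (κ : ι → ℝ) : Prop where
  hA : ∀ s i j, HasDerivAt (fun t ↦ A t i j) (A' s i j) s
  hA' : ∀ s i j, HasDerivAt (fun t ↦ A' t i j) (-(R s * A s) i j) s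
  hR : ∀ s, (R s).IsSymm
  hRκ : ∀ s x, -∑ i, κ i * x i ^ 2 ≤ x ⬝ᵥ (R s *ᵥ x)
  hf : ∀ s i, HasDerivAt (f i) (f' i s) s
  hf' : ∀ s i, HasDerivAt (f' i) (κ i * f i s) s
  hA0 : A 0 = Matrix.diagonal fun i ↦ f i 0
  hA'0 : A' 0 = Matrix.diagonal fun i ↦ f' i 0
  -- Together with `hne`: exactly one of the initial value and the initial derivative vanishes. This
  -- covers both the cosh direction along φ and the directions that start at zero.
  hff' : ∀ i, f i 0 * f' i 0 = 0
  hne : ∀ i, f i 0 ≠ 0 ∨ f' i 0 ≠ 0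

namespace JacobiComparison

variable {A A' R : ℝ → Matrix ι ι ℝ} {f f' : ι → ℝ → ℝ} {κ : ι → ℝ}

/-- The difference AᵀA' - A'ᵀA is constant because R is symmetric, and it vanishes at 0 because both
initial matrices are diagonal. -/
lemma wronskian_symm (h : JacobiComparison A A' R f f' κ) (s : ℝ) :
    ((A' s)ᵀ * A s).IsSymm := by
  have key : ∀ i j s, (A s)ᵀ.mulVec (fun k ↦ A' s k j) i
      - (A' s)ᵀ.mulVec (fun k ↦ A s k j) i = 0 := by
    intro i j
    have hd : ∀ s, HasDerivAt (fun s ↦ (A s)ᵀ.mulVec (fun k ↦ A' s k j) i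
        - (A' s)ᵀ.mulVec (fun k ↦ A s k j) i) 0 s := by
      intro s
      simp only [Matrix.mulVec, dotProduct, Matrix.transpose_apply]
      have h1 := (HasDerivAt.fun_sum (u := Finset.univ) fun k _ ↦
        ((h.hA s k i).mul (h.hA' s k j))).sub
        (HasDerivAt.fun_sum (u := Finset.univ) fun k _ ↦ ((h.hA' s k i).mul (h.hA s k j)))
      refine h1.congr_deriv ?_
      have h2 : ∀ i j, ∑ k, (R s * A s) k i * A s k j = ((A s)ᵀ * R s * A s) i j := by
        intro i j
        have : ((A s)ᵀ * R s * A s) = (R s * A s)ᵀ * A s := by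
          rw [Matrix.transpose_mul, (h.hR s).eq]
        rw [this]; rfl
      have h3 : ∑ k, (R s * A s) k j * A s k i = ∑ k, (R s * A s) k i * A s k j := by
        rw [h2, h2]
        have : ((A s)ᵀ * R s * A s)ᵀ = (A s)ᵀ * R s * A s := by
          simp [Matrix.transpose_mul, (h.hR s).eq, Matrix.mul_assoc]
        exact congrFun (congrFun this i) j
      simp only [Finset.sum_add_distrib, neg_mul, mul_neg, Finset.sum_neg_distrib]
      have h4 : ∑ k, A s k i * (R s * A s) k j = ∑ k, (R s * A s) k j * A s k i :=
        Finset.sum_congr rfl fun _ _ ↦ mul_comm _ _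
      rw [h4, h3]; ring
    intro s
    rw [is_const_of_deriv_eq_zero (fun s ↦ (hd s).differentiableAt) (fun s ↦ (hd s).deriv) s 0]
    simp only [h.hA0, h.hA'0, Matrix.mulVec, dotProduct, Matrix.transpose_apply,
      Matrix.diagonal_apply]
    by_cases hij : i = j
    · subst hij; simp [mul_comm]
    · have : ∀ k, k = i → k ≠ j := fun k hk hj ↦ hij (hk ▸ hj)
      rw [Finset.sum_eq_zero, Finset.sum_eq_zero, sub_zero]
      all_goals
        intro k _
        by_cases hk : k = i
        · simp [this k hk]
        · simp [hk]
  ext i j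
  have := key i j s
  rw [sub_eq_zero] at this
  rw [Matrix.transpose_mul, Matrix.transpose_transpose]
  exact this

/-- If the comparison function is nonzero at 0, the quotient is continuous there. Otherwise
numerator and denominator both vanish, and the limit is the quotient of their derivatives. -/
lemma tendsto_entry (h : JacobiComparison A A' R f f' κ) (i j : ι) :
    Tendsto (fun s ↦ A s i j / f i s) (𝓝[>] 0) (𝓝 ((1 : Matrix ι ι ℝ) i j)) := by
  have hAc : Tendsto (fun s ↦ A s i j) (𝓝[>] 0) (𝓝 (A 0 i j)) :=
    (h.hA 0 i j).continuousAt.tendsto.mono_left nhdsWithin_le_nhds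
  have hfc : Tendsto (f i) (𝓝[>] 0) (𝓝 (f i 0)) :=
    (h.hf 0 i).continuousAt.tendsto.mono_left nhdsWithin_le_nhds
  by_cases hf0 : f i 0 = 0
  · have hf'0 : f' i 0 ≠ 0 := (h.hne i).resolve_left (by simp [hf0])
    have hA0 : A 0 i j = 0 := by
      rw [h.hA0, Matrix.diagonal_apply]; split_ifs <;> simp [hf0]
    have h1 := (hasDerivAt_iff_tendsto_slope_zero.1 (h.hA 0 i j)).mono_left
      (nhdsWithin_mono (0 : ℝ) (fun x (hx : 0 < x) ↦ hx.ne'))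
    have h2 := (hasDerivAt_iff_tendsto_slope_zero.1 (h.hf 0 i)).mono_left
      (nhdsWithin_mono (0 : ℝ) (fun x (hx : 0 < x) ↦ hx.ne'))
    have h3 := h1.div h2 hf'0
    have h4 : A' 0 i j / f' i 0 = (1 : Matrix ι ι ℝ) i j := by
      rw [h.hA'0, Matrix.diagonal_apply, Matrix.one_apply]
      split_ifs <;> simp [hf'0]
    rw [h4] at h3
    refine h3.congr' ?_
    filter_upwards [self_mem_nhdsWithin] with s (hs : 0 < s)
    simp only [zero_add, hA0, hf0, sub_zero, smul_eq_mul, Pi.div_apply]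
    rw [mul_div_mul_left _ _ (inv_ne_zero hs.ne')]
  · have h4 : A 0 i j / f i 0 = (1 : Matrix ι ι ℝ) i j := by
      rw [h.hA0, Matrix.diagonal_apply, Matrix.one_apply]
      split_ifs <;> simp [hf0]
    rw [← h4]
    exact hAc.div hfc hf0

/-- The Jacobi matrix with rows normalized by the comparison functions. -/
def normalized (A : ℝ → Matrix ι ι ℝ) (f : ι → ℝ → ℝ) (s : ℝ) : Matrix ι ι ℝ :=
  fun i j ↦ A s i j / f i s

lemma det_normalized (s : ℝ) : (normalized A f s).det = (A s).det / ∏ i, f i s := by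
  have : normalized A f s = Matrix.diagonal (fun i ↦ (f i s)⁻¹) * A s := by
    ext i j; simp [normalized, div_eq_inv_mul]
  rw [this, Matrix.det_mul, Matrix.det_diagonal, Finset.prod_inv_distrib, div_eq_inv_mul]

lemma tendsto_normalized (h : JacobiComparison A A' R f f' κ) :
    Tendsto (normalized A f) (𝓝[>] 0) (𝓝 1) :=
  tendsto_pi_nhds.2 fun i ↦ tendsto_pi_nhds.2 fun j ↦ h.tendsto_entry i j

variable {H : ℝ}

/-- The Riccati comparison, tested on the vector `(c i * f i t)`. -/
lemma riccati_le (h : JacobiComparison A A' R f f' κ) (hf0 : ∀ s ∈ Ioo 0 H, ∀ i, 0 < f i s)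
    (hdet : ∀ s ∈ Ioo 0 H, (A s).det ≠ 0) {t : ℝ} (ht : t ∈ Ioo 0 H) (c y : ι → ℝ)
    (hy : A t *ᵥ y = fun i ↦ c i * f i t) :
    (A' t *ᵥ y) ⬝ᵥ (A t *ᵥ y) ≤ ∑ i, f i t * f' i t * c i ^ 2 := by
  let C := normalized A f
  have hC : ∀ s ∈ Ioo 0 H, (C s).det ≠ 0 := fun s hs ↦ by
    rw [det_normalized]
    exact div_ne_zero (hdet s hs) (Finset.prod_ne_zero_iff.2 fun i _ ↦ (hf0 s hs i).ne')
  -- The vector at time t is extended to a family with A(s)Y(s) = (cᵢfᵢ(s)). Cramer's formula makes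
  -- its differentiability visible.
  let Y : ℝ → ι → ℝ := fun s ↦ ((C s).det)⁻¹ • ((C s).adjugate *ᵥ c)
  have hCY : ∀ s ∈ Ioo 0 H, A s *ᵥ Y s = fun i ↦ c i * f i s := by
    intro s hs
    have h1 : C s *ᵥ Y s = c := by
      simp only [Y, Matrix.mulVec_smul, Matrix.mulVec_mulVec, Matrix.mul_adjugate]
      rw [Matrix.smul_mulVec, smul_smul, inv_mul_cancel₀ (hC s hs), one_smul, Matrix.one_mulVec]
    ext i
    have h2 := congrFun h1 i
    simp only [Matrix.mulVec, dotProduct, C, normalized] at h2 ⊢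
    rw [← h2, Finset.sum_mul]
    refine Finset.sum_congr rfl fun j _ ↦ ?_
    field_simp [(hf0 s hs i).ne']
  have hYd : ∀ s ∈ Ioo 0 H, ∀ i, DifferentiableAt ℝ (fun s ↦ Y s i) s := by
    intro s hs i
    have hCd : ∀ i j, DifferentiableAt ℝ (fun t ↦ C t i j) s := fun i j ↦
      (h.hA s i j).differentiableAt.div (h.hf s i).differentiableAt (hf0 s hs i).ne'
    simp only [Y, Pi.smul_apply, smul_eq_mul, Matrix.mulVec, dotProduct]
    exact ((differentiableAt_det hCd).inv (hC s hs)).mul (DifferentiableAt.fun_sum fun j _ ↦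
      (differentiableAt_adjugate hCd i j).mul_const _)
  have hYlim : Tendsto Y (𝓝[>] 0) (𝓝 c) := by
    have hc : ContinuousAt (fun C : Matrix ι ι ℝ ↦ (C.det)⁻¹ • (C.adjugate *ᵥ c)) 1 := by
      refine ContinuousAt.smul (ContinuousAt.inv₀ (f := fun C : Matrix ι ι ℝ ↦ C.det)
        (continuous_id.matrix_det).continuousAt (by simp)) ?_
      · exact ((continuous_id.matrix_adjugate).matrix_mulVec continuous_const).continuousAt
    have h1 : Tendsto Y (𝓝[>] 0)
        (𝓝 (((1 : Matrix ι ι ℝ).det)⁻¹ • ((1 : Matrix ι ι ℝ).adjugate *ᵥ c))) :=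
      hc.tendsto.comp h.tendsto_normalized
    have h2 : ((1 : Matrix ι ι ℝ).det)⁻¹ • ((1 : Matrix ι ι ℝ).adjugate *ᵥ c) = c := by simp
    rwa [h2] at h1
  -- With Z = (cᵢfᵢ) and P = A'Y, the derivative of G is |Z' - P|² + Σκᵢ Zᵢ² + ⟨RZ,Z⟩, which is
  -- nonnegative by the curvature bound. As G tends to 0 at time 0, it is nonnegative at t, which is
  -- the claim.
  let G : ℝ → ℝ := fun s ↦ ∑ i, f i s * f' i s * c i ^ 2 - ∑ i, (A' s *ᵥ Y s) i * (c i * f i s)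
  have hGd : ∀ s ∈ Ioo 0 H, ∃ g, 0 ≤ g ∧ HasDerivAt G g s := by
    intro s hs
    let Y' : ι → ℝ := fun i ↦ deriv (fun s ↦ Y s i) s
    have hY' : ∀ i, HasDerivAt (fun s ↦ Y s i) (Y' i) s := fun i ↦ (hYd s hs i).hasDerivAt
    have hAY : ∀ i, (A' s *ᵥ Y s) i + (A s *ᵥ Y') i = c i * f' i s := by
      intro i
      have h1 : HasDerivAt (fun s ↦ (A s *ᵥ Y s) i) ((A' s *ᵥ Y s) i + (A s *ᵥ Y') i) s := by
        simp only [Matrix.mulVec, dotProduct, ← Finset.sum_add_distrib]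
        exact HasDerivAt.fun_sum fun j _ ↦ (h.hA s i j).mul (hY' j)
      have h2 : HasDerivAt (fun s ↦ (A s *ᵥ Y s) i) (c i * f' i s) s := by
        refine ((h.hf s i).const_mul (c i)).congr_of_eventuallyEq ?_
        filter_upwards [Ioo_mem_nhds hs.1 hs.2] with r hr
        rw [hCY r hr]
      exact h1.unique h2
    have hA'Y : ∀ i, HasDerivAt (fun s ↦ (A' s *ᵥ Y s) i)
        (-((R s * A s) *ᵥ Y s) i + (A' s *ᵥ Y') i) s := by
      intro i
      simp only [Matrix.mulVec, dotProduct, ← Finset.sum_neg_distrib, ← Finset.sum_add_distrib,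
        ← neg_mul]
      exact HasDerivAt.fun_sum fun j _ ↦ (h.hA' s i j).mul (hY' j)
    have hG := (HasDerivAt.fun_sum (u := Finset.univ) fun i _ ↦
      (((h.hf s i).mul (h.hf' s i)).mul_const (c i ^ 2))).sub
      (HasDerivAt.fun_sum (u := Finset.univ) fun i _ ↦ (hA'Y i).mul ((h.hf s i).const_mul (c i)))
    refine ⟨_, ?_, hG⟩
    set Z : ι → ℝ := fun i ↦ c i * f i s with hZ
    set Z' : ι → ℝ := fun i ↦ c i * f' i s with hZ'
    set P : ι → ℝ := A' s *ᵥ Y s with hP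
    have e1 : ((R s * A s) *ᵥ Y s) = R s *ᵥ Z := by
      rw [← Matrix.mulVec_mulVec, hCY s hs]
    -- Symmetry of A'ᵀA moves the derivative from Y' to Y, so that no second unknown remains.
    have e2 : (A' s *ᵥ Y') ⬝ᵥ Z = P ⬝ᵥ (Z' - P) := by
      have hsym := h.wronskian_symm s
      have e3 : A s *ᵥ Y' = Z' - P := by
        ext i; simp only [Pi.sub_apply]; linarith [hAY i]
      rw [← e3, show Z = A s *ᵥ Y s from (hCY s hs).symm, hP]
      have e4 : ∀ u v : ι → ℝ, (A' s *ᵥ u) ⬝ᵥ (A s *ᵥ v) = u ⬝ᵥ (((A' s)ᵀ * A s) *ᵥ v) := by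
        intro u v
        rw [← Matrix.mulVec_mulVec, Matrix.dotProduct_mulVec u, Matrix.vecMul_transpose]
      rw [e4, e4]
      conv_lhs => rw [← hsym.eq]
      rw [dotProduct_comm, Matrix.mulVec_transpose, ← Matrix.dotProduct_mulVec]
    have e5 := h.hRκ s Z
    have e6 : Z ⬝ᵥ (R s *ᵥ Z) = ∑ i, (R s *ᵥ Z) i * Z i := by
      rw [dotProduct_comm]; rfl
    have e2' : ∑ i, (A' s *ᵥ Y') i * Z i = ∑ i, P i * (Z' i - P i) := e2
    have e7 : (0 : ℝ) ≤ ∑ i, (Z' i - P i) ^ 2 := Finset.sum_nonneg fun i _ ↦ sq_nonneg _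
    rw [e1]
    have e8 : (∑ x, ((f' x s * f' x s + f x s * (κ x * f x s)) * c x ^ 2) -
        ∑ x, ((-(R s *ᵥ Z) x + (A' s *ᵥ Y') x) * (c x * f x s) + P x * (c x * f' x s)))
        = ∑ i, (Z' i - P i) ^ 2 + (∑ i, κ i * Z i ^ 2 + ∑ i, (R s *ᵥ Z) i * Z i) := by
      have e9 : ∑ x, ((-(R s *ᵥ Z) x + (A' s *ᵥ Y') x) * (c x * f x s) + P x * (c x * f' x s))
          = -∑ i, (R s *ᵥ Z) i * Z i + ∑ i, P i * (Z' i - P i) + ∑ i, P i * Z' i := by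
        rw [← e2', ← Finset.sum_neg_distrib, ← Finset.sum_add_distrib, ← Finset.sum_add_distrib]
        exact Finset.sum_congr rfl fun i _ ↦ by simp only [hZ, hZ']; ring
      rw [e9, sub_eq_iff_eq_add, ← sub_eq_zero]
      simp only [← Finset.sum_add_distrib, ← Finset.sum_neg_distrib, ← Finset.sum_sub_distrib]
      exact Finset.sum_eq_zero fun i _ ↦ by simp only [hZ, hZ']; ring
    rw [e8]
    rw [e6] at e5
    linarith
  have hGmono : MonotoneOn G (Ioo 0 H) := by
    refine monotoneOn_of_deriv_nonneg (convex_Ioo 0 H) (fun s hs ↦ ?_) ?_ ?_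
    · obtain ⟨g, -, hg⟩ := hGd s hs; exact hg.continuousAt.continuousWithinAt
    · rw [interior_Ioo]
      intro s hs; obtain ⟨g, -, hg⟩ := hGd s hs; exact hg.differentiableAt.differentiableWithinAt
    · rw [interior_Ioo]
      intro s hs; obtain ⟨g, hg0, hg⟩ := hGd s hs; rwa [hg.deriv]
  -- The first sum vanishes at 0 because fᵢ(0)fᵢ'(0) = 0, the second because in addition A'(0) is
  -- diagonal and Y tends to c.
  have hG0 : Tendsto G (𝓝[>] 0) (𝓝 0) := by
    have hfc : ∀ i, Tendsto (f i) (𝓝[>] 0) (𝓝 (f i 0)) := fun i ↦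
      (h.hf 0 i).continuousAt.tendsto.mono_left nhdsWithin_le_nhds
    have hfc' : ∀ i, Tendsto (f' i) (𝓝[>] 0) (𝓝 (f' i 0)) := fun i ↦
      (h.hf' 0 i).continuousAt.tendsto.mono_left nhdsWithin_le_nhds
    have hAc : ∀ i j, Tendsto (fun s ↦ A' s i j) (𝓝[>] 0) (𝓝 (A' 0 i j)) := fun i j ↦
      (h.hA' 0 i j).continuousAt.tendsto.mono_left nhdsWithin_le_nhds
    have h1 := (tendsto_finsetSum Finset.univ fun i _ ↦
      ((hfc i).mul (hfc' i)).mul_const (c i ^ 2)).sub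
      (tendsto_finsetSum Finset.univ fun i _ ↦
        (tendsto_finsetSum Finset.univ fun j _ ↦ (hAc i j).mul (tendsto_pi_nhds.1 hYlim j)).mul
          ((hfc i).const_mul (c i)))
    suffices e : ∑ i, f i 0 * f' i 0 * c i ^ 2
        - ∑ i, (∑ j, A' 0 i j * c j) * (c i * f i 0) = 0 by rw [e] at h1; exact h1
    rw [Finset.sum_eq_zero (fun i _ ↦ by rw [h.hff' i, zero_mul]), zero_sub, neg_eq_zero]
    refine Finset.sum_eq_zero fun i _ ↦ ?_
    rw [Finset.sum_eq_single i, h.hA'0, Matrix.diagonal_apply_eq]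
    · linear_combination c i * c i * h.hff' i
    · intro j _ hj
      rw [h.hA'0, Matrix.diagonal_apply_ne _ hj.symm, zero_mul]
    · simp
  have hGt : 0 ≤ G t := by
    refine le_of_tendsto hG0 ?_
    filter_upwards [Ioo_mem_nhdsGT ht.1] with s hs
    exact hGmono ⟨hs.1, hs.2.trans ht.2⟩ ht hs.2.le
  have hyY : y = Y t := by
    have hu : IsUnit (A t) := (Matrix.isUnit_iff_isUnit_det _).2 (hdet t ht).isUnit
    exact Matrix.mulVec_injective_iff_isUnit.2 hu (hy.trans (hCY t ht).symm)
  rw [hyY, hCY t ht]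
  exact sub_nonneg.1 hGt

/-- The logarithmic derivative of det A / ∏ fᵢ is tr(A'A⁻¹) - Σ fᵢ'/fᵢ. It is nonpositive by the
Riccati comparison applied to each coordinate vector. The quotient starts at the limit 1, and the
bound passes to the end point H, where det A may vanish, by continuity. -/
lemma abs_det_le (h : JacobiComparison A A' R f f' κ) (hH : 0 < H)
    (hf0 : ∀ s ∈ Ioo 0 H, ∀ i, 0 < f i s) (hdet : ∀ s ∈ Ioo 0 H, (A s).det ≠ 0) :
    |(A H).det| ≤ ∏ i, f i H := by
  have hAd : ∀ s, HasDerivAt (fun t ↦ (A t).det) (((A s).adjugate * A' s).trace) s :=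
    fun s ↦ hasDerivAt_det (h.hA s)
  have hfd : ∀ s, DifferentiableAt ℝ (fun t ↦ ∏ i, f i t) s := fun s ↦
    DifferentiableAt.fun_finsetProd fun i _ ↦ (h.hf s i).differentiableAt
  let q : ℝ → ℝ := fun s ↦ (A s).det / ∏ i, f i s
  have hprod : ∀ s ∈ Ioo 0 H, 0 < ∏ i, f i s := fun s hs ↦ Finset.prod_pos fun i _ ↦ hf0 s hs i
  have hq1 : Tendsto q (𝓝[>] 0) (𝓝 1) := by
    have := (continuous_id.matrix_det.tendsto (1 : Matrix ι ι ℝ)).comp h.tendsto_normalized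
    simp only [id, Matrix.det_one] at this
    exact this.congr fun s ↦ det_normalized s
  have hqc : ContinuousOn q (Ioo 0 H) := fun s hs ↦
    ((hAd s).continuousAt.div (hfd s).continuousAt (hprod s hs).ne').continuousWithinAt
  have hqne : ∀ s ∈ Ioo 0 H, q s ≠ 0 := fun s hs ↦ div_ne_zero (hdet s hs) (hprod s hs).ne'
  -- The quotient is near 1 close to 0 and never vanishes, so a negative value would contradict the
  -- intermediate value theorem.
  have hqpos : ∀ s ∈ Ioo 0 H, 0 < q s := by
    intro s hs
    by_contra hcon
    have hlt : q s < 0 := lt_of_le_of_ne (not_lt.1 hcon) (hqne s hs)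
    have hev : ∀ᶠ r in 𝓝[>] (0 : ℝ), 0 < q r := hq1.eventually (lt_mem_nhds one_pos)
    obtain ⟨r, hr, hr'⟩ := (hev.and (Ioo_mem_nhdsGT hH)).exists
    have := isPreconnected_Ioo.intermediate_value hs hr' hqc
    obtain ⟨z, hz, hz0⟩ := this ⟨hlt.le, hr.le⟩
    exact hqne z hz hz0
  -- The diagonal entries of A' adj A are det A times the Riccati form on unit vectors; the test
  -- coefficient is 1/fᵢ.
  have htr : ∀ s ∈ Ioo 0 H, ((A s).adjugate * A' s).trace
      ≤ (A s).det * ∑ i, f' i s / f i s := by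
    intro s hs
    have hd : 0 < (A s).det := by
      have := mul_pos (hqpos s hs) (hprod s hs)
      rwa [div_mul_cancel₀ _ (hprod s hs).ne'] at this
    rw [Matrix.trace_mul_comm, Matrix.trace, Finset.mul_sum]
    refine Finset.sum_le_sum fun i _ ↦ ?_
    let y : ι → ℝ := ((A s).det)⁻¹ • ((A s).adjugate *ᵥ Pi.single i 1)
    have hy0 : A s *ᵥ y = Pi.single i 1 := by
      simp only [y, Matrix.mulVec_smul, Matrix.mulVec_mulVec, Matrix.mul_adjugate]
      rw [Matrix.smul_mulVec, smul_smul, inv_mul_cancel₀ hd.ne', one_smul, Matrix.one_mulVec]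
    have hy : A s *ᵥ y = fun j ↦ (Pi.single i (f i s)⁻¹ : ι → ℝ) j * f j s := by
      rw [hy0]
      ext j
      by_cases hj : j = i
      · subst hj; simp [(hf0 s hs j).ne']
      · simp [hj]
    have hr := h.riccati_le hf0 hdet hs _ y hy
    rw [hy0, Finset.sum_eq_single i (by intro j _ hj; simp [hj]) (by simp),
      dotProduct_single, mul_one] at hr
    have e1 : (A' s *ᵥ y) i = ((A s).det)⁻¹ * (A' s * (A s).adjugate) i i := by
      simp only [y, Matrix.mulVec_smul, Matrix.mulVec_mulVec, Pi.smul_apply, smul_eq_mul]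
      simp
    have e2 : f i s * f' i s * (Pi.single i (f i s)⁻¹ : ι → ℝ) i ^ 2 = f' i s / f i s := by
      have := (hf0 s hs i).ne'
      simp only [Pi.single_eq_same]
      field_simp
    rw [e1, e2, inv_mul_le_iff₀ hd] at hr
    exact hr
  have hanti : AntitoneOn q (Ioo 0 H) := by
    refine antitoneOn_of_deriv_nonpos (convex_Ioo 0 H) hqc ?_ ?_
    · rw [interior_Ioo]
      exact fun s hs ↦
        ((hAd s).differentiableAt.div (hfd s) (hprod s hs).ne').differentiableWithinAt
    · rw [interior_Ioo]
      intro s hs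
      have hp : HasDerivAt (fun t ↦ ∏ i, f i t) ((∏ i, f i s) * ∑ i, f' i s / f i s) s := by
        have := HasDerivAt.fun_finsetProd (u := Finset.univ) fun i _ ↦ h.hf s i
        refine this.congr_deriv ?_
        rw [Finset.mul_sum]
        refine Finset.sum_congr rfl fun i _ ↦ ?_
        rw [← Finset.prod_erase_mul _ _ (Finset.mem_univ i), smul_eq_mul]
        field_simp [(hf0 s hs i).ne']
      rw [((hAd s).fun_div hp (hprod s hs).ne').deriv]
      refine div_nonpos_of_nonpos_of_nonneg ?_ (sq_nonneg _)
      nlinarith [htr s hs, hprod s hs]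
  have hq_le : ∀ s ∈ Ioo 0 H, q s ≤ 1 := by
    intro s hs
    refine ge_of_tendsto hq1 ?_
    filter_upwards [Ioo_mem_nhdsGT hs.1] with r hr
    exact hanti ⟨hr.1, hr.2.trans hs.2⟩ hs hr.2.le
  have hfin : ∀ s ∈ Ioo 0 H, |(A s).det| ≤ ∏ i, f i s := by
    intro s hs
    have h1 := hq_le s hs
    have h2 := hqpos s hs
    have h3 := hprod s hs
    simp only [q] at h1 h2
    rw [div_le_one h3] at h1
    rw [abs_of_pos ((div_pos_iff_of_pos_right h3).1 h2)]
    exact h1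
  have hc1 : Tendsto (fun s ↦ |(A s).det|) (𝓝[<] H) (𝓝 |(A H).det|) :=
    ((hAd H).continuousAt.abs).tendsto.mono_left nhdsWithin_le_nhds
  have hc2 : Tendsto (fun s ↦ ∏ i, f i s) (𝓝[<] H) (𝓝 (∏ i, f i H)) :=
    (hfd H).continuousAt.tendsto.mono_left nhdsWithin_le_nhds
  refine le_of_tendsto_of_tendsto hc1 hc2 ?_
  filter_upwards [Ioo_mem_nhdsLT hH] with s hs
  exact hfin s hs

/-- With nonpositive curvature, Jacobi fields with orthogonal initial data do not vanish. -/
lemma det_ne_zero_of_nonpos (h : JacobiComparison A A' R f f' κ)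
    (hR0 : ∀ s x, x ⬝ᵥ (R s *ᵥ x) ≤ 0) {s : ℝ} (hs : 0 < s) : (A s).det ≠ 0 := by
  intro hdet
  obtain ⟨v, hv, hAv⟩ := Matrix.exists_mulVec_eq_zero_iff.2 hdet
  have hy : ∀ s i, HasDerivAt (fun t ↦ (A t *ᵥ v) i) ((A' s *ᵥ v) i) s := fun s i ↦ by
    simp only [Matrix.mulVec, dotProduct]
    exact HasDerivAt.fun_sum fun j _ ↦ (h.hA s i j).mul_const _
  have hy' : ∀ s i, HasDerivAt (fun t ↦ (A' t *ᵥ v) i) (-(R s *ᵥ (A s *ᵥ v)) i) s := fun s i ↦ by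
    rw [Matrix.mulVec_mulVec]
    simp only [Matrix.mulVec, dotProduct, ← Finset.sum_neg_distrib, ← neg_mul]
    exact HasDerivAt.fun_sum fun j _ ↦ (h.hA' s i j).mul_const _
  -- This is half the derivative of |Av|². Its own derivative |A'v|² - ⟨RAv,Av⟩ is nonnegative and
  -- it starts at 0, so |Av|² is nondecreasing. A zero at s then forces Av = 0 on [0,s], and both
  -- initial values in each coordinate vanish.
  let p : ℝ → ℝ := fun t ↦ ∑ i, (A t *ᵥ v) i * (A' t *ᵥ v) i
  have hp : ∀ t, HasDerivAt p (∑ i, (A' t *ᵥ v) i ^ 2 - (A t *ᵥ v) ⬝ᵥ (R t *ᵥ (A t *ᵥ v))) t := by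
    intro t
    refine (HasDerivAt.fun_sum (u := Finset.univ) fun i _ ↦ (hy t i).mul (hy' t i)).congr_deriv ?_
    simp only [dotProduct, ← Finset.sum_sub_distrib]
    exact Finset.sum_congr rfl fun i _ ↦ by ring
  have hp0 : p 0 = 0 := by
    simp only [p, h.hA0, h.hA'0, Matrix.mulVec_diagonal]
    exact Finset.sum_eq_zero fun i _ ↦ by linear_combination v i * v i * h.hff' i
  have hpm : Monotone p := monotone_of_deriv_nonneg (fun t ↦ (hp t).differentiableAt) fun t ↦ by
    rw [(hp t).deriv]
    have := Finset.sum_nonneg fun i (_ : i ∈ Finset.univ) ↦ sq_nonneg ((A' t *ᵥ v) i)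
    linarith [hR0 t (A t *ᵥ v)]
  let n : ℝ → ℝ := fun t ↦ ∑ i, (A t *ᵥ v) i ^ 2
  have hn : ∀ t, HasDerivAt n (2 * p t) t := by
    intro t
    refine (HasDerivAt.fun_sum (u := Finset.univ) fun i _ ↦ (hy t i).pow 2).congr_deriv ?_
    simp only [p, Finset.mul_sum]
    exact Finset.sum_congr rfl fun i _ ↦ by norm_num; ring
  have hnm : MonotoneOn n (Ici 0) := by
    refine monotoneOn_of_deriv_nonneg (convex_Ici 0)
      (fun t _ ↦ (hn t).continuousAt.continuousWithinAt)
      (fun t _ ↦ (hn t).differentiableAt.differentiableWithinAt) fun t ht ↦ ?_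
    rw [interior_Ici] at ht
    rw [(hn t).deriv]
    have := hpm (le_of_lt ht)
    rw [hp0] at this
    linarith
  have hzero : ∀ t ∈ Icc 0 s, A t *ᵥ v = 0 := by
    intro t ht
    have h1 : n t ≤ 0 := by
      have := hnm (mem_Ici.2 ht.1) (mem_Ici.2 hs.le) ht.2
      simpa [n, hAv] using this
    have h2 : n t = 0 := le_antisymm h1 (Finset.sum_nonneg fun i _ ↦ sq_nonneg _)
    ext i
    have := (Finset.sum_eq_zero_iff_of_nonneg fun i _ ↦ sq_nonneg _).1 h2 i (Finset.mem_univ i)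
    simpa using this
  apply hv
  ext i
  have h0 := congrFun (hzero 0 ⟨le_rfl, hs.le⟩) i
  rw [h.hA0, Matrix.mulVec_diagonal] at h0
  -- Vanishing is known only to the right of 0, so the derivative is identified as a one-sided one.
  have h0' : (A' 0 *ᵥ v) i = 0 := by
    have h1 : HasDerivWithinAt (fun t ↦ (A t *ᵥ v) i) ((A' 0 *ᵥ v) i) (Ici 0) 0 :=
      (hy 0 i).hasDerivWithinAt
    have h2 : HasDerivWithinAt (fun t ↦ (A t *ᵥ v) i) 0 (Ici 0) 0 := by
      refine (hasDerivWithinAt_const (0 : ℝ) (Ici 0) (0 : ℝ)).congr_of_eventuallyEq ?_ ?_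
      · filter_upwards [Ico_mem_nhdsGE hs] with t ht
        rw [hzero t ⟨ht.1, ht.2.le⟩]; rfl
      · rw [hzero 0 ⟨le_rfl, hs.le⟩]; rfl
    exact (uniqueDiffWithinAt_Ici 0).eq_deriv _ h1 h2
  rw [h.hA'0, Matrix.mulVec_diagonal] at h0'
  rcases h.hne i with hi | hi
  · simpa [hi] using h0
  · simpa [hi] using h0'

end JacobiComparison

end MatrixComparison

end Fermi
end

noncomputable section
namespace Fermi
open Filter Topology

/-! ### Metrics and Levi-Civita connections on open subsets of a vector space -/

section VectorSpace

variable {E F X : Type*} [NormedAddCommGroup E] [NormedSpace ℝ E]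
  [NormedAddCommGroup F] [NormedSpace ℝ F] [NormedAddCommGroup X] [NormedSpace ℝ X]

/-- The product rule for a map that is bilinear in its last two arguments. -/
lemma hasFDerivAt_bilinear [FiniteDimensional ℝ E] {f : E → E → E → F} {c V W : X → E} {x : X}
    (hf : DifferentiableAt ℝ (fun q : E × E × E ↦ f q.1 q.2.1 q.2.2) (c x, V x, W x))
    (hB : ∃ B : E →ₗ[ℝ] E →ₗ[ℝ] F, ∀ v w, f (c x) v w = B v w) {c' V' W' : X →L[ℝ] E}
    (hc : HasFDerivAt c c' x) (hV : HasFDerivAt V V' x) (hW : HasFDerivAt W W' x) :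
    ∃ L : X →L[ℝ] F, HasFDerivAt (fun t ↦ f (c t) (V t) (W t)) L x ∧ ∀ u, L u =
      fderiv ℝ (fun z ↦ f z (V x) (W x)) (c x) (c' u) + f (c x) (V' u) (W x)
        + f (c x) (V x) (W' u) := by
  obtain ⟨B, hB⟩ := hB
  have hid : ∀ x : E, HasFDerivAt (fun z : E ↦ z) (ContinuousLinearMap.id ℝ E) x := hasFDerivAt_id
  set D := fderiv ℝ (fun q : E × E × E ↦ f q.1 q.2.1 q.2.2) (c x, V x, W x)
  have hD : HasFDerivAt (fun q : E × E × E ↦ f q.1 q.2.1 q.2.2) D (c x, V x, W x) := hf.hasFDerivAt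
  have hD1 : ∀ u, fderiv ℝ (fun z ↦ f z (V x) (W x)) (c x) u = D (u, 0, 0) := by
    intro u
    have h1 : HasFDerivAt (fun z : E ↦ (z, V x, W x)) (ContinuousLinearMap.inl ℝ E (E × E)) (c x) :=
      hasFDerivAt_prodMk_left _ _
    have h2 : HasFDerivAt (fun z ↦ f z (V x) (W x)) _ (c x) :=
      HasFDerivAt.comp (f := fun z : E ↦ (z, V x, W x)) (c x) hD h1
    rw [h2.fderiv]; rfl
  have hD2 : ∀ u, f (c x) u (W x) = D (0, u, 0) := by
    intro u
    have h1 : HasFDerivAt (fun z : E ↦ (c x, z, W x)) _ (V x) :=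
      (hasFDerivAt_const (c x) (V x)).prodMk
        ((hid (V x)).prodMk (hasFDerivAt_const (W x) (V x)))
    have h2 : HasFDerivAt (fun z ↦ f (c x) z (W x)) _ (V x) :=
      HasFDerivAt.comp (f := fun z : E ↦ (c x, z, W x)) (V x) hD h1
    have h3 : HasFDerivAt (fun z ↦ f (c x) z (W x)) (B.flip (W x)).toContinuousLinearMap (V x) := by
      simp only [hB]
      exact (B.flip (W x)).toContinuousLinearMap.hasFDerivAt
    have := DFunLike.congr_fun (h3.unique h2) u
    rw [hB]
    simpa using this
  have hD3 : ∀ u, f (c x) (V x) u = D (0, 0, u) := by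
    intro u
    have h1 : HasFDerivAt (fun z : E ↦ (c x, V x, z)) _ (W x) :=
      (hasFDerivAt_const (c x) (W x)).prodMk
        ((hasFDerivAt_const (V x) (W x)).prodMk (hid (W x)))
    have h2 : HasFDerivAt (fun z ↦ f (c x) (V x) z) _ (W x) :=
      HasFDerivAt.comp (f := fun z : E ↦ (c x, V x, z)) (W x) hD h1
    have h3 : HasFDerivAt (fun z ↦ f (c x) (V x) z) (B (V x)).toContinuousLinearMap (W x) := by
      simp only [hB]
      exact (B (V x)).toContinuousLinearMap.hasFDerivAt
    have := DFunLike.congr_fun (h3.unique h2) u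
    rw [hB]
    simpa using this
  refine ⟨D.comp (c'.prod (V'.prod W')),
    HasFDerivAt.comp (f := fun t ↦ (c t, V t, W t)) x hD (hc.prodMk (hV.prodMk hW)), fun u ↦ ?_⟩
  rw [hD1, hD2, hD3, ← map_add, ← map_add]
  simp

lemma hasDerivAt_bilinear [FiniteDimensional ℝ E] {f : E → E → E → F} {c V W : ℝ → E} {t : ℝ}
    (hf : DifferentiableAt ℝ (fun q : E × E × E ↦ f q.1 q.2.1 q.2.2) (c t, V t, W t))
    (hB : ∃ B : E →ₗ[ℝ] E →ₗ[ℝ] F, ∀ v w, f (c t) v w = B v w) {c' V' W' : E}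
    (hc : HasDerivAt c c' t) (hV : HasDerivAt V V' t) (hW : HasDerivAt W W' t) :
    HasDerivAt (fun t ↦ f (c t) (V t) (W t))
      (fderiv ℝ (fun z ↦ f z (V t) (W t)) (c t) c' + f (c t) V' (W t) + f (c t) (V t) W') t := by
  obtain ⟨L, hL, hLu⟩ := hasFDerivAt_bilinear hf hB hc.hasFDerivAt hV.hasFDerivAt hW.hasFDerivAt
  refine hL.hasDerivAt.congr_deriv ?_
  rw [hLu]
  simp

/-- The derivative, in its first argument, of a map that is bilinear in its last two arguments is
trilinear. -/
lemma fderiv_bilinear {f : E → E → E → F} {y : E}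
    (hf : ∀ v w, DifferentiableAt ℝ (fun y ↦ f y v w) y)
    (hf' : ∀ᶠ z in 𝓝 y, ∃ B : E →ₗ[ℝ] E →ₗ[ℝ] F, ∀ v w, f z v w = B v w) :
    ∃ T : E →ₗ[ℝ] E →ₗ[ℝ] E →ₗ[ℝ] F, ∀ u v w, fderiv ℝ (fun y ↦ f y v w) y u = T u v w := by
  have hadd1 : ∀ v v' w, fderiv ℝ (fun y ↦ f y (v + v') w) y
      = fderiv ℝ (fun y ↦ f y v w) y + fderiv ℝ (fun y ↦ f y v' w) y := by
    intro v v' w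
    rw [← fderiv_fun_add (hf _ _) (hf _ _)]
    apply Filter.EventuallyEq.fderiv_eq
    filter_upwards [hf'] with z ⟨B, hB⟩
    simp [hB]
  have hsmul1 : ∀ (r : ℝ) v w, fderiv ℝ (fun y ↦ f y (r • v) w) y
      = r • fderiv ℝ (fun y ↦ f y v w) y := by
    intro r v w
    rw [← fderiv_fun_const_smul (hf _ _)]
    apply Filter.EventuallyEq.fderiv_eq
    filter_upwards [hf'] with z ⟨B, hB⟩
    simp [hB]
  have hadd2 : ∀ v w w', fderiv ℝ (fun y ↦ f y v (w + w')) y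
      = fderiv ℝ (fun y ↦ f y v w) y + fderiv ℝ (fun y ↦ f y v w') y := by
    intro v w w'
    rw [← fderiv_fun_add (hf _ _) (hf _ _)]
    apply Filter.EventuallyEq.fderiv_eq
    filter_upwards [hf'] with z ⟨B, hB⟩
    simp [hB]
  have hsmul2 : ∀ (r : ℝ) v w, fderiv ℝ (fun y ↦ f y v (r • w)) y
      = r • fderiv ℝ (fun y ↦ f y v w) y := by
    intro r v w
    rw [← fderiv_fun_const_smul (hf _ _)]
    apply Filter.EventuallyEq.fderiv_eq
    filter_upwards [hf'] with z ⟨B, hB⟩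
    simp [hB]
  refine ⟨LinearMap.mk₂ ℝ (fun u v ↦
    { toFun := fun w ↦ fderiv ℝ (fun y ↦ f y v w) y u
      map_add' := fun w w' ↦ by rw [hadd2]; rfl
      map_smul' := fun r w ↦ by rw [hsmul2]; rfl }) ?_ ?_ ?_ ?_, fun u v w ↦ rfl⟩
  · intro u u' v; ext w; simp
  · intro r u v; ext w; simp
  · intro u v v'; ext w; simp [hadd1]
  · intro r u v; ext w; simp [hsmul1]

/-- `g` is a Riemannian metric on `U`, and `Γ` the Christoffel map of its Levi-Civita connection. -/
structure IsLeviCivita (U : Set E) (g : E → E → E → ℝ) (Γ : E → E → E → E) : Prop where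
  isOpen : IsOpen U
  contDiffAt_metric : ∀ y ∈ U, ∀ v w,
    ContDiffAt ℝ ∞ (fun q : E × E × E ↦ g q.1 q.2.1 q.2.2) (y, v, w)
  contDiffAt : ∀ y ∈ U, ∀ v w, ContDiffAt ℝ ∞ (fun q : E × E × E ↦ Γ q.1 q.2.1 q.2.2) (y, v, w)
  metric_bilin : ∀ y ∈ U, ∃ B : E →ₗ[ℝ] E →ₗ[ℝ] ℝ, ∀ v w, g y v w = B v w
  bilin : ∀ y ∈ U, ∃ B : E →ₗ[ℝ] E →ₗ[ℝ] E, ∀ v w, Γ y v w = B v w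
  metric_symm : ∀ y ∈ U, ∀ v w, g y v w = g y w v
  metric_pos : ∀ y ∈ U, ∀ v, v ≠ 0 → 0 < g y v v
  symm : ∀ y ∈ U, ∀ v w, Γ y v w = Γ y w v
  compat : ∀ y ∈ U, ∀ u v w, fderiv ℝ (fun z ↦ g z v w) y u = g y (Γ y u v) w + g y v (Γ y u w)

/-- The curvature tensor of the connection with Christoffel map `Γ`. -/
def curv (Γ : E → E → E → E) (y v w z : E) : E :=
  fderiv ℝ (fun y' ↦ Γ y' w z) y v - fderiv ℝ (fun y' ↦ Γ y' v z) y w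
    + Γ y v (Γ y w z) - Γ y w (Γ y v z)

lemma curv_swap (Γ : E → E → E → E) (y v w z : E) : curv Γ y v w z = -curv Γ y w v z := by
  simp only [curv]; abel

/-- Symmetry of second derivatives: since `k` is the time derivative of `f` near `p`, its spatial
derivative is a mixed second derivative of `f`. -/
lemma hasDerivAt_fderiv_swap {Q : Type*} [NormedAddCommGroup Q] [NormedSpace ℝ Q] {f k : ℝ × Q → F}
    {p : ℝ × Q} (hf : ContDiffAt ℝ 2 f p)
    (hk : ∀ᶠ z in 𝓝 p, HasDerivAt (fun s ↦ f (s, z.2)) (k z) z.1) (a : Q) :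
    HasDerivAt (fun s ↦ fderiv ℝ f (s, p.2) (0, a)) (fderiv ℝ k p (0, a)) p.1 := by
  have h1 : DifferentiableAt ℝ (fderiv ℝ f) p :=
    (hf.fderiv_right (m := 1) (by norm_num)).differentiableAt (by simp)
  have h2 : HasDerivAt (fun s : ℝ ↦ (s, p.2)) ((1, 0) : ℝ × Q) p.1 :=
    (hasDerivAt_id p.1).prodMk (hasDerivAt_const _ _)
  have h3 : HasDerivAt (fun s ↦ fderiv ℝ f (s, p.2)) (fderiv ℝ (fderiv ℝ f) p (1, 0)) p.1 :=
    HasFDerivAt.comp_hasDerivAt (f := fun s : ℝ ↦ (s, p.2)) p.1 h1.hasFDerivAt h2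
  have h4 : HasDerivAt (fun s ↦ fderiv ℝ f (s, p.2) (0, a)) _ p.1 :=
    h3.clm_apply (hasDerivAt_const p.1 ((0, a) : ℝ × Q))
  refine h4.congr_deriv ?_
  have hk' : k =ᶠ[𝓝 p] fun z ↦ fderiv ℝ f z (1, 0) := by
    filter_upwards [hk, (hf.of_le (m := 1) (by norm_num)).eventually (by simp)] with z hz hz'
    have h5 : HasDerivAt (fun s : ℝ ↦ (s, z.2)) ((1, 0) : ℝ × Q) z.1 :=
      (hasDerivAt_id z.1).prodMk (hasDerivAt_const _ _)
    exact hz.unique (HasFDerivAt.comp_hasDerivAt (f := fun s : ℝ ↦ (s, z.2)) z.1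
      (hz'.differentiableAt (by simp)).hasFDerivAt h5)
  have h5 : fderiv ℝ k p (0, a) = fderiv ℝ (fderiv ℝ f) p (0, a) (1, 0) := by
    rw [hk'.fderiv_eq, fderiv_clm_apply h1 (differentiableAt_const _)]
    simp
  rw [h5, map_zero, add_zero]
  exact (hf.isSymmSndFDerivAt (by simp)) _ _

namespace IsLeviCivita

variable [FiniteDimensional ℝ E] {U : Set E} {g : E → E → E → ℝ} {Γ : E → E → E → E}

omit [FiniteDimensional ℝ E] in
lemma differentiableAt_metric (h : IsLeviCivita U g Γ) {y : E} (hy : y ∈ U) (v w : E) :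
    DifferentiableAt ℝ (fun q : E × E × E ↦ g q.1 q.2.1 q.2.2) (y, v, w) :=
  (h.contDiffAt_metric y hy v w).differentiableAt (by simp)

omit [FiniteDimensional ℝ E] in
lemma differentiableAt (h : IsLeviCivita U g Γ) {y : E} (hy : y ∈ U) (v w : E) :
    DifferentiableAt ℝ (fun q : E × E × E ↦ Γ q.1 q.2.1 q.2.2) (y, v, w) :=
  (h.contDiffAt y hy v w).differentiableAt (by simp)

/-- The product rule for the covariant derivative along a curve. -/
lemma hasDerivAt_inner (h : IsLeviCivita U g Γ) {c V W : ℝ → E} {c' V' W' : E} {t : ℝ}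
    (hc : HasDerivAt c c' t) (hV : HasDerivAt V V' t) (hW : HasDerivAt W W' t) (hU : c t ∈ U) :
    HasDerivAt (fun s ↦ g (c s) (V s) (W s))
      (g (c t) (V' + Γ (c t) c' (V t)) (W t) + g (c t) (V t) (W' + Γ (c t) c' (W t))) t := by
  refine (hasDerivAt_bilinear (h.differentiableAt_metric hU _ _) (h.metric_bilin _ hU)
    hc hV hW).congr_deriv ?_
  obtain ⟨B, hB⟩ := h.metric_bilin _ hU
  rw [h.compat _ hU]
  simp only [hB, map_add, LinearMap.add_apply]
  ring

omit [FiniteDimensional ℝ E] in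
lemma eq_of_forall_inner_eq (h : IsLeviCivita U g Γ) {y : E} (hy : y ∈ U) {v w : E}
    (hvw : ∀ z, g y v z = g y w z) : v = w := by
  by_contra hne
  have h1 := h.metric_pos y hy (v - w) (sub_ne_zero.2 hne)
  have h2 := hvw (v - w)
  obtain ⟨B, hB⟩ := h.metric_bilin _ hy
  simp only [hB, map_sub, LinearMap.sub_apply] at h1 h2
  linarith

omit [FiniteDimensional ℝ E] in
lemma fderiv_symm (h : IsLeviCivita U g Γ) {y : E} (hy : y ∈ U) (v w : E) :
    fderiv ℝ (fun y ↦ Γ y v w) y = fderiv ℝ (fun y ↦ Γ y w v) y := by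
  apply Filter.EventuallyEq.fderiv_eq
  filter_upwards [h.isOpen.mem_nhds hy] with z hz using h.symm z hz v w

-- The first Bianchi identity holds because Γ is symmetric: all terms cancel in pairs.
omit [FiniteDimensional ℝ E] in
lemma curv_bianchi (h : IsLeviCivita U g Γ) {y : E} (hy : y ∈ U) (u v w : E) :
    curv Γ y u v w + curv Γ y v w u + curv Γ y w u v = 0 := by
  simp only [curv]
  rw [h.fderiv_symm hy w v, h.fderiv_symm hy w u, h.fderiv_symm hy v u,
    h.symm y hy v w, h.symm y hy u w, h.symm y hy u v]
  abel

omit [FiniteDimensional ℝ E] in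
lemma differentiableAt_left (h : IsLeviCivita U g Γ) {y : E} (hy : y ∈ U) (b z : E) :
    DifferentiableAt ℝ (fun y ↦ Γ y b z) y :=
  DifferentiableAt.comp (f := fun y : E ↦ (y, b, z)) y (h.differentiableAt hy b z) (by fun_prop)

/-- The curvature operator is skew-symmetric. -/
lemma inner_curv_self (h : IsLeviCivita U g Γ) {y : E} (hy : y ∈ U) (a b z : E) :
    g y (curv Γ y a b z) z = 0 := by
  -- The second derivative of y ↦ g(z,z) is symmetric. Computed through metric compatibility, its
  -- antisymmetric part is 2g(R(a,b)z,z), which is therefore zero.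
  let q : E → ℝ := fun y ↦ g y z z
  have hq : ∀ y ∈ U, ∀ u, fderiv ℝ q y u = 2 * g y (Γ y u z) z := by
    intro y hy u
    rw [h.compat y hy, h.metric_symm y hy z]
    ring
  have hqc : ContDiffAt ℝ 2 q y := by
    have h1 := (h.contDiffAt_metric y hy z z).of_le (m := 2) (by norm_cast)
    exact ContDiffAt.comp (f := fun y : E ↦ (y, z, z)) y h1 (by fun_prop)
  have hd : DifferentiableAt ℝ (fderiv ℝ q) y :=
    (hqc.fderiv_right (m := 1) (by norm_num)).differentiableAt (by simp)
  have hsnd : ∀ a b, fderiv ℝ (fderiv ℝ q) y a b = 2 * (g y (Γ y a (Γ y b z)) z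
      + g y (Γ y b z) (Γ y a z) + g y (fderiv ℝ (fun y ↦ Γ y b z) y a) z) := by
    intro a b
    have h1 : HasFDerivAt (fun y ↦ fderiv ℝ q y b)
        ((ContinuousLinearMap.apply ℝ ℝ b).comp (fderiv ℝ (fderiv ℝ q) y)) y :=
      (ContinuousLinearMap.apply ℝ ℝ b).hasFDerivAt.comp y hd.hasFDerivAt
    have h2 : (fun y ↦ fderiv ℝ q y b) =ᶠ[𝓝 y] fun y ↦ 2 * g y (Γ y b z) z := by
      filter_upwards [h.isOpen.mem_nhds hy] with x hx using hq x hx b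
    obtain ⟨L, hL, hLu⟩ := hasFDerivAt_bilinear (c := id) (W := fun _ ↦ z)
      (h.differentiableAt_metric hy (Γ y b z) z) (h.metric_bilin y hy) (hasFDerivAt_id y)
      (h.differentiableAt_left hy b z).hasFDerivAt (hasFDerivAt_const z y)
    have h4 := (h1.congr_of_eventuallyEq h2.symm).unique (hL.const_mul 2)
    have h5 := DFunLike.congr_fun h4 a
    simp only [ContinuousLinearMap.comp_apply, ContinuousLinearMap.apply_apply] at h5
    rw [h5]
    obtain ⟨B, hB⟩ := h.metric_bilin _ hy
    simp only [smul_apply, hLu, id, ContinuousLinearMap.id_apply, h.compat y hy, hB]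
    simp
  have hs : fderiv ℝ (fderiv ℝ q) y a b = fderiv ℝ (fderiv ℝ q) y b a :=
    (hqc.isSymmSndFDerivAt (by simp)) a b
  rw [hsnd, hsnd] at hs
  have := h.metric_symm y hy (Γ y b z) (Γ y a z)
  obtain ⟨B, hB⟩ := h.metric_bilin _ hy
  simp only [curv, hB, map_add, map_sub, LinearMap.add_apply, LinearMap.sub_apply] at this hs ⊢
  linarith

omit [FiniteDimensional ℝ E] in
lemma fderiv_bilin (h : IsLeviCivita U g Γ) {y : E} (hy : y ∈ U) :
    ∃ T : E →ₗ[ℝ] E →ₗ[ℝ] E →ₗ[ℝ] E, ∀ u v w, fderiv ℝ (fun y ↦ Γ y v w) y u = T u v w :=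
  fderiv_bilinear (h.differentiableAt_left hy)
    (Filter.Eventually.mono (h.isOpen.mem_nhds hy) h.bilin)

omit [FiniteDimensional ℝ E] in
/-- The curvature tensor is multilinear. -/
lemma curv_multilinear (h : IsLeviCivita U g Γ) {y : E} (hy : y ∈ U) :
    ∃ R : E →ₗ[ℝ] E →ₗ[ℝ] E →ₗ[ℝ] E, ∀ u v w, curv Γ y u v w = R u v w := by
  obtain ⟨T, hT⟩ := h.fderiv_bilin hy
  obtain ⟨B, hB⟩ := h.bilin y hy
  refine ⟨LinearMap.mk₂ ℝ (fun u v ↦ T u v - T v u + (B u).comp (B v) - (B v).comp (B u))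
    ?_ ?_ ?_ ?_, fun u v w ↦ ?_⟩
  · intro u u' v; ext w; simp; abel
  · intro r u v; ext w; simp [smul_sub, smul_add]
  · intro u v v'; ext w; simp; abel
  · intro r u v; ext w; simp [smul_sub, smul_add]
  · simp [curv, hT, hB]

/-- Polarization of `inner_curv_self`. -/
lemma inner_curv_skew (h : IsLeviCivita U g Γ) {y : E} (hy : y ∈ U) (a b z w : E) :
    g y (curv Γ y a b z) w = -g y (curv Γ y a b w) z := by
  have h1 := h.inner_curv_self hy a b (z + w)
  have h2 := h.inner_curv_self hy a b z
  have h3 := h.inner_curv_self hy a b w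
  obtain ⟨R, hR⟩ := h.curv_multilinear hy
  obtain ⟨B, hB⟩ := h.metric_bilin _ hy
  simp only [hR, hB, map_add, LinearMap.add_apply] at h1 h2 h3 ⊢
  linarith

/-- The pair symmetry of the curvature tensor. -/
lemma inner_curv_pair_symm (h : IsLeviCivita U g Γ) {y : E} (hy : y ∈ U) (a b c d : E) :
    g y (curv Γ y a b c) d = g y (curv Γ y c d a) b := by
  obtain ⟨G, hG⟩ := h.metric_bilin _ hy
  have B : ∀ a b c d, g y (curv Γ y a b c) d + g y (curv Γ y b c a) d + g y (curv Γ y c a b) d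
      = 0 := by
    intro a b c d
    simp only [hG]
    rw [← LinearMap.add_apply, ← LinearMap.add_apply, ← map_add, ← map_add, h.curv_bianchi hy]
    simp
  have S : ∀ a b c d, g y (curv Γ y a b c) d = -g y (curv Γ y a b d) c := h.inner_curv_skew hy
  have A : ∀ a b c d, g y (curv Γ y a b c) d = -g y (curv Γ y b a c) d := by
    intro a b c d; rw [curv_swap]; simp [hG]
  -- The classical octahedron argument: four Bianchi identities combined through the two
  -- skew-symmetries.
  linarith [B a b c d, B b c d a, B c d a b, B d a b c, S a b c d, S b c a d, S c a b d, S b c d a,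
    S c d b a, S d b c a, S c d a b, S d a c b, S a c d b, S d a b c, S a b d c, S b d a c,
    A a b c d, A b c a d, A c a b d, A b d c a, A d a c b, A c d a b, A a c d b,
    A c d b a, A d b c a]

/-- The transformation law of the Christoffel map under a change of coordinates. -/
lemma christoffel_transform (h : IsLeviCivita U g Γ) {U' : Set E} {g' : E → E → E → ℝ}
    {Γ' : E → E → E → E} (h' : IsLeviCivita U' g' Γ') {τ : E → E} {y : E} (hy : y ∈ U)
    (hτ : ContDiffAt ℝ 2 τ y) (hy' : τ y ∈ U')
    (hG : ∀ᶠ z in 𝓝 y, ∀ v w, g z v w = g' (τ z) (fderiv ℝ τ z v) (fderiv ℝ τ z w))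
    (hs : Function.Surjective (fderiv ℝ τ y)) (v w : E) :
    fderiv ℝ τ y (Γ y v w)
      = Γ' (τ y) (fderiv ℝ τ y v) (fderiv ℝ τ y w) + fderiv ℝ (fderiv ℝ τ) y v w := by
  set D := fderiv ℝ τ y with hD
  have hd : HasFDerivAt τ D y := (hτ.differentiableAt (by simp)).hasFDerivAt
  have hdd : HasFDerivAt (fderiv ℝ τ) (fderiv ℝ (fderiv ℝ τ) y) y :=
    ((hτ.fderiv_right (m := 1) (by norm_num)).differentiableAt (by simp)).hasFDerivAt
  have hdv : ∀ v, HasFDerivAt (fun z ↦ fderiv ℝ τ z v)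
      ((ContinuousLinearMap.apply ℝ E v).comp (fderiv ℝ (fderiv ℝ τ) y)) y := fun v ↦
    (ContinuousLinearMap.apply ℝ E v).hasFDerivAt.comp y hdd
  -- The defect of the transformation law. The form g'(Δ(u,v),Dw) is symmetric in u, v because both
  -- connections are torsion-free. Differentiating the isometry relation shows that it is skew in v,
  -- w.
  let Δ : E → E → E := fun v w ↦ D (Γ y v w) - Γ' (τ y) (D v) (D w) - fderiv ℝ (fderiv ℝ τ) y v w
  have hΔs : ∀ v w, Δ v w = Δ w v := by
    intro v w
    simp only [Δ]
    rw [h.symm y hy, h'.symm _ hy', (hτ.isSymmSndFDerivAt (by simp)).eq v w]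
  have hmet : ∀ v w, g y v w = g' (τ y) (D v) (D w) := hG.self_of_nhds
  obtain ⟨B, hB⟩ := h'.metric_bilin _ hy'
  have hskew : ∀ u v w, g' (τ y) (Δ u v) (D w) + g' (τ y) (D v) (Δ u w) = 0 := by
    intro u v w
    obtain ⟨L, hL, hLu⟩ := hasFDerivAt_bilinear (f := g') (c := τ)
      (h'.differentiableAt_metric hy' _ _) (h'.metric_bilin _ hy') hd (hdv v) (hdv w)
    have h4 : (fun z ↦ g z v w) =ᶠ[𝓝 y]
        fun z ↦ g' (τ z) (fderiv ℝ τ z v) (fderiv ℝ τ z w) := by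
      filter_upwards [hG] with z hz using hz v w
    have h5 : fderiv ℝ (fun z ↦ g z v w) y u = L u := by
      rw [(hL.congr_of_eventuallyEq h4).fderiv]
    rw [h.compat y hy, hLu, h'.compat _ hy', ← hD, hmet, hmet] at h5
    simp only [Δ, hB, map_sub, LinearMap.sub_apply, ContinuousLinearMap.comp_apply,
      ContinuousLinearMap.apply_apply] at h5 ⊢
    linarith
  -- A trilinear form symmetric in the first pair of arguments and skew in the last pair vanishes,
  -- as in the uniqueness of the Levi-Civita connection.
  have hzero : ∀ u v w, g' (τ y) (Δ u v) (D w) = 0 := by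
    intro u v w
    have e : ∀ a b c, g' (τ y) (Δ a b) (D c) = -g' (τ y) (Δ a c) (D b) := fun a b c ↦ by
      have := hskew a b c
      rw [h'.metric_symm _ hy' (D b)] at this
      linarith
    have s : ∀ a b c, g' (τ y) (Δ a b) (D c) = g' (τ y) (Δ b a) (D c) := fun a b c ↦ by
      rw [hΔs]
    linarith [e u v w, s u w v, e w u v, s w v u, e v w u, s v u w]
  have : Δ v w = 0 := h'.eq_of_forall_inner_eq hy' fun z ↦ by
    obtain ⟨z, rfl⟩ := hs z
    rw [hzero]; simp [hB]
  simp only [Δ] at this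
  rw [sub_sub, sub_eq_zero] at this
  exact this

/-- The linearization of the geodesic equation. -/
lemma hasDerivAt_variation (h : IsLeviCivita U g Γ) {Q : Type*} [NormedAddCommGroup Q]
    [NormedSpace ℝ Q] {c T : ℝ × Q → E} {p : ℝ × Q} (hc : DifferentiableAt ℝ c p)
    (hT : ContDiffAt ℝ 2 T p) (hp : c p ∈ U)
    (hgeo : ∀ᶠ z in 𝓝 p, HasDerivAt (fun s ↦ T (s, z.2)) (-Γ (c z) (T z) (T z)) z.1) (a : Q) :
    HasDerivAt (fun s ↦ fderiv ℝ T (s, p.2) (0, a))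
      (-fderiv ℝ (fun y ↦ Γ y (T p) (T p)) (c p) (fderiv ℝ c p (0, a))
        - (2 : ℝ) • Γ (c p) (T p) (fderiv ℝ T p (0, a))) p.1 := by
  refine (hasDerivAt_fderiv_swap hT hgeo a).congr_deriv ?_
  have h2 := (hT.differentiableAt (by simp)).hasFDerivAt
  obtain ⟨L, hL, hLu⟩ := hasFDerivAt_bilinear (h.differentiableAt hp _ _) (h.bilin _ hp)
    hc.hasFDerivAt h2 h2
  rw [hL.fun_neg.fderiv, neg_apply, hLu, h.symm _ hp (fderiv ℝ T p (0, a)), two_smul]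
  abel

/-- The Jacobi equation: the second covariant derivative of a variation of geodesics is
`R(T, Y) T`. -/
lemma hasDerivAt_covariant (h : IsLeviCivita U g Γ) {c T Y Y' : ℝ → E} {t : ℝ}
    (hc : HasDerivAt c (T t) t) (hT : HasDerivAt T (-Γ (c t) (T t) (T t)) t)
    (hY : HasDerivAt Y (Y' t) t)
    (hY' : HasDerivAt Y' (-fderiv ℝ (fun y ↦ Γ y (T t) (T t)) (c t) (Y t)
      - (2 : ℝ) • Γ (c t) (T t) (Y' t)) t)
    (hU : c t ∈ U) :
    ∃ Z, HasDerivAt (fun s ↦ Y' s + Γ (c s) (T s) (Y s)) Z t ∧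
      Z + Γ (c t) (T t) (Y' t + Γ (c t) (T t) (Y t)) = curv Γ (c t) (T t) (Y t) (T t) := by
  refine ⟨_, hY'.add (hasDerivAt_bilinear (h.differentiableAt hU _ _) (h.bilin _ hU) hc hT hY), ?_⟩
  have h1 := h.symm _ hU (Γ (c t) (T t) (T t)) (Y t)
  have h2 := h.symm _ hU (T t) (Y t)
  obtain ⟨B, hB⟩ := h.bilin _ hU
  rw [curv, h.fderiv_symm hU (T t) (Y t)]
  simp only [hB, map_add, map_neg, LinearMap.neg_apply, two_smul] at h1 h2 ⊢
  rw [h1, h2]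
  abel

end IsLeviCivita

end VectorSpace

end Fermi
end

noncomputable section
namespace Fermi
open Filter Topology

/-! ### Tangent vectors in charts -/

section Charts

variable {d : ℕ} {M : Type*} [TopologicalSpace M] [ChartedSpace (EuclideanSpace ℝ (Fin d)) M]

lemma chartVec_add (x : M) {p : M} (v w : TangentSpace (𝓡 d) p) :
    chartVec x (v + w) = chartVec x v + chartVec x w :=
  map_add (mfderiv (𝓡 d) 𝓘(ℝ, EuclideanSpace ℝ (Fin d)) (extChartAt (𝓡 d) x) p) v w

lemma chartVec_smul (x : M) {p : M} (r : ℝ) (v : TangentSpace (𝓡 d) p) :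
    chartVec x (r • v) = r • chartVec x v :=
  map_smul (mfderiv (𝓡 d) 𝓘(ℝ, EuclideanSpace ℝ (Fin d)) (extChartAt (𝓡 d) x) p) r v

lemma coordVec_add (x : M) (y v w : EuclideanSpace ℝ (Fin d)) :
    coordVec x y (v + w) = coordVec x y v + coordVec x y w :=
  map_add (mfderiv 𝓘(ℝ, EuclideanSpace ℝ (Fin d)) (𝓡 d) (extChartAt (𝓡 d) x).symm y) v w

lemma coordVec_smul (x : M) (y : EuclideanSpace ℝ (Fin d)) (r : ℝ) (v : EuclideanSpace ℝ (Fin d)) :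
    coordVec x y (r • v) = r • coordVec x y v :=
  map_smul (mfderiv 𝓘(ℝ, EuclideanSpace ℝ (Fin d)) (𝓡 d) (extChartAt (𝓡 d) x).symm y) r v

variable [IsManifold (𝓡 d) ∞ M]

lemma chartVec_coordVec {x : M} {y : EuclideanSpace ℝ (Fin d)}
    (hy : y ∈ (extChartAt (𝓡 d) x).target) (v : EuclideanSpace ℝ (Fin d)) :
    chartVec x (coordVec x y v) = v := by
  have : IsManifold (𝓡 d) 1 M := .of_le (n := ∞) (by norm_cast)
  have := mfderiv_extChartAt_comp_mfderivWithin_extChartAt_symm (I := 𝓡 d) hy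
  rw [modelWithCornersSelf_coe, range_id, mfderivWithin_univ] at this
  exact DFunLike.congr_fun this v

lemma coordVec_chartVec {x : M} {y : EuclideanSpace ℝ (Fin d)}
    (hy : y ∈ (extChartAt (𝓡 d) x).target) (v : TangentSpace (𝓡 d) ((extChartAt (𝓡 d) x).symm y)) :
    coordVec x y (chartVec x v) = v := by
  have : IsManifold (𝓡 d) 1 M := .of_le (n := ∞) (by norm_cast)
  have := mfderivWithin_extChartAt_symm_comp_mfderiv_extChartAt (I := 𝓡 d) hy
  rw [modelWithCornersSelf_coe, range_id, mfderivWithin_univ] at this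
  exact DFunLike.congr_fun this v

-- Lets a point of a chart domain be replaced by the image of its coordinates, so that tangent
-- vectors there have the type in which `coordVec` takes its values.
omit [IsManifold (𝓡 d) ∞ M] in
lemma exists_mem_target_eq {x p : M} (hp : p ∈ (extChartAt (𝓡 d) x).source) :
    ∃ y ∈ (extChartAt (𝓡 d) x).target, p = (extChartAt (𝓡 d) x).symm y ∧
      extChartAt (𝓡 d) x p = y :=
  ⟨_, (extChartAt (𝓡 d) x).map_source hp, ((extChartAt (𝓡 d) x).left_inv hp).symm, rfl⟩

lemma mk_coordVec_chartVec {x p : M} (hp : p ∈ (extChartAt (𝓡 d) x).source)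
    (v : TangentSpace (𝓡 d) p) :
    (⟨(extChartAt (𝓡 d) x).symm (extChartAt (𝓡 d) x p),
      coordVec x (extChartAt (𝓡 d) x p) (chartVec x v)⟩ : TangentBundle (𝓡 d) M) = ⟨p, v⟩ := by
  obtain ⟨y, hy, rfl, h⟩ := exists_mem_target_eq hp
  rw [h, coordVec_chartVec hy]

lemma chartVec_injective {x p : M} (hp : p ∈ (extChartAt (𝓡 d) x).source) :
    Function.Injective (chartVec (d := d) x (p := p)) := by
  obtain ⟨y, hy, rfl, h⟩ := exists_mem_target_eq hp
  exact Function.LeftInverse.injective (g := coordVec x y) (coordVec_chartVec hy)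

lemma chartVec_surjective {x p : M} (hp : p ∈ (extChartAt (𝓡 d) x).source) :
    Function.Surjective (chartVec (d := d) x (p := p)) := by
  obtain ⟨y, hy, rfl, h⟩ := exists_mem_target_eq hp
  exact Function.RightInverse.surjective (g := coordVec x y) (chartVec_coordVec hy)

lemma contMDiffAt_extChartAt_symm {x : M} {y : EuclideanSpace ℝ (Fin d)}
    (hy : y ∈ (extChartAt (𝓡 d) x).target) :
    ContMDiffAt 𝓘(ℝ, EuclideanSpace ℝ (Fin d)) (𝓡 d) ∞ (extChartAt (𝓡 d) x).symm y :=
  (contMDiffOn_extChartAt_symm x).contMDiffAt ((isOpen_extChartAt_target x).mem_nhds hy)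

lemma contMDiffAt_extChartAt_of_mem {x p : M} (hp : p ∈ (extChartAt (𝓡 d) x).source) :
    ContMDiffAt (𝓡 d) 𝓘(ℝ, EuclideanSpace ℝ (Fin d)) ∞ (extChartAt (𝓡 d) x) p :=
  contMDiffAt_extChartAt' (by rwa [← extChartAt_source (𝓡 d)])

lemma contDiffAt_coordChange {x x' : M} {y : EuclideanSpace ℝ (Fin d)}
    (hy : y ∈ (extChartAt (𝓡 d) x).target)
    (hy' : (extChartAt (𝓡 d) x).symm y ∈ (extChartAt (𝓡 d) x').source) :
    ContDiffAt ℝ ∞ (extChartAt (𝓡 d) x' ∘ (extChartAt (𝓡 d) x).symm) y :=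
  ((contMDiffAt_extChartAt_of_mem hy').comp y (contMDiffAt_extChartAt_symm hy)).contDiffAt

lemma chartVec_eq_fderiv {x x' : M} {y : EuclideanSpace ℝ (Fin d)}
    (hy : y ∈ (extChartAt (𝓡 d) x).target)
    (hy' : (extChartAt (𝓡 d) x).symm y ∈ (extChartAt (𝓡 d) x').source)
    (v : EuclideanSpace ℝ (Fin d)) :
    chartVec x' (coordVec x y v)
      = fderiv ℝ (extChartAt (𝓡 d) x' ∘ (extChartAt (𝓡 d) x).symm) y v := by
  rw [← mfderiv_eq_fderiv, mfderiv_comp y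
    ((contMDiffAt_extChartAt_of_mem hy').mdifferentiableAt (by simp))
    ((contMDiffAt_extChartAt_symm hy).mdifferentiableAt (by simp))]
  rfl

lemma chartVec_change {x x' p : M} (hp : p ∈ (extChartAt (𝓡 d) x).source)
    (hp' : p ∈ (extChartAt (𝓡 d) x').source) (v : TangentSpace (𝓡 d) p) :
    chartVec x' v = fderiv ℝ (extChartAt (𝓡 d) x' ∘ (extChartAt (𝓡 d) x).symm)
      (extChartAt (𝓡 d) x p) (chartVec x v) := by
  obtain ⟨y, hy, rfl, h⟩ := exists_mem_target_eq hp
  rw [h, ← chartVec_eq_fderiv hy hp', coordVec_chartVec hy]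

lemma eventually_mem_source_of_mem_target {x x' : M} {y : EuclideanSpace ℝ (Fin d)}
    (hy : y ∈ (extChartAt (𝓡 d) x).target)
    (hy' : (extChartAt (𝓡 d) x).symm y ∈ (extChartAt (𝓡 d) x').source) :
    ∀ᶠ z in 𝓝 y, z ∈ (extChartAt (𝓡 d) x).target ∧
      (extChartAt (𝓡 d) x).symm z ∈ (extChartAt (𝓡 d) x').source :=
  Filter.Eventually.and ((isOpen_extChartAt_target x).mem_nhds hy)
    ((contMDiffAt_extChartAt_symm hy).continuousAt.preimage_mem_nhds
      ((isOpen_extChartAt_source x').mem_nhds hy'))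

lemma hasDerivAt_extChartAt {x : M} {γ : ℝ → M} {t : ℝ}
    (hγ : MDifferentiableAt 𝓘(ℝ, ℝ) (𝓡 d) γ t) (ht : γ t ∈ (extChartAt (𝓡 d) x).source) :
    HasDerivAt (fun s ↦ extChartAt (𝓡 d) x (γ s)) (chartVec x (velocity (d := d) γ t)) t := by
  have h1 := ((contMDiffAt_extChartAt_of_mem ht).mdifferentiableAt (by simp)).hasMFDerivAt.comp t
    hγ.hasMFDerivAt
  refine (hasFDerivAt_iff_hasDerivAt (f := fun s ↦ extChartAt (𝓡 d) x (γ s))).1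
    (hasMFDerivAt_iff_hasFDerivAt.1 h1)

/-- The coordinate field is the tangent map of the inverse chart applied to a constant section. -/
lemma contMDiffAt_coordVec {x : M} {y : EuclideanSpace ℝ (Fin d)}
    (hy : y ∈ (extChartAt (𝓡 d) x).target) (v : EuclideanSpace ℝ (Fin d)) :
    ContMDiffAt 𝓘(ℝ, EuclideanSpace ℝ (Fin d)) (𝓡 d).tangent ∞
      (fun z ↦ (⟨(extChartAt (𝓡 d) x).symm z, coordVec x z v⟩ : TangentBundle (𝓡 d) M)) y := by
  have hU := isOpen_extChartAt_target (I := 𝓡 d) x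
  have h1 := (contMDiffOn_extChartAt_symm (I := 𝓡 d) (n := ∞) x).contMDiffOn_tangentMapWithin
    (m := ∞) (by simp) hU.uniqueMDiffOn
  have h2 : ContMDiffAt 𝓘(ℝ, EuclideanSpace ℝ (Fin d)) 𝓘(ℝ, EuclideanSpace ℝ (Fin d)).tangent ∞
      (fun z ↦ (⟨z, v⟩ : TangentBundle 𝓘(ℝ, EuclideanSpace ℝ (Fin d)) (EuclideanSpace ℝ (Fin d))))
      y := contMDiffAt_vectorSpace_iff_contDiffAt.2 contDiffAt_const
  have h3 := (h1.contMDiffAt (x := ⟨y, v⟩) ((hU.preimage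
    (FiberBundle.continuous_proj _ _)).mem_nhds hy)).comp y h2
  refine h3.congr_of_eventuallyEq ?_
  filter_upwards [hU.mem_nhds hy] with z hz
  simp only [Function.comp_apply, tangentMapWithin]
  rw [mfderivWithin_of_isOpen hU hz]
  rfl

variable [RiemannianBundle (fun p : M ↦ TangentSpace (𝓡 d) p)]

lemma metric_chartVec {x p : M} (hp : p ∈ (extChartAt (𝓡 d) x).source)
    (v w : TangentSpace (𝓡 d) p) :
    metric x (extChartAt (𝓡 d) x p) (chartVec x v) (chartVec x w) = inner ℝ v w := by
  obtain ⟨y, hy, rfl, h⟩ := exists_mem_target_eq hp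
  rw [h, metric, coordVec_chartVec hy, coordVec_chartVec hy]

lemma metric_coordChange {x x' : M} {y : EuclideanSpace ℝ (Fin d)}
    (hy : y ∈ (extChartAt (𝓡 d) x).target)
    (hy' : (extChartAt (𝓡 d) x).symm y ∈ (extChartAt (𝓡 d) x').source)
    (v w : EuclideanSpace ℝ (Fin d)) :
    metric x y v w = metric x' ((extChartAt (𝓡 d) x' ∘ (extChartAt (𝓡 d) x).symm) y)
      (fderiv ℝ (extChartAt (𝓡 d) x' ∘ (extChartAt (𝓡 d) x).symm) y v)
      (fderiv ℝ (extChartAt (𝓡 d) x' ∘ (extChartAt (𝓡 d) x).symm) y w) := by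
  rw [← chartVec_eq_fderiv hy hy', ← chartVec_eq_fderiv hy hy', Function.comp_apply,
    metric_chartVec hy', metric]

variable (d) in
omit [IsManifold (𝓡 d) ∞ M] in
lemma metric_bilinear (x : M) (y : EuclideanSpace ℝ (Fin d)) :
    ∃ B : EuclideanSpace ℝ (Fin d) →ₗ[ℝ] EuclideanSpace ℝ (Fin d) →ₗ[ℝ] ℝ,
      ∀ v w, metric x y v w = B v w :=
  ⟨LinearMap.mk₂ ℝ (metric x y) (fun u v w ↦ by simp only [metric, coordVec_add, inner_add_left])
    (fun r v w ↦ by simp only [metric, coordVec_smul, inner_smul_left]; rfl)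
    (fun u v w ↦ by simp only [metric, coordVec_add, inner_add_right])
    (fun r v w ↦ by simp only [metric, coordVec_smul, inner_smul_right]; rfl), fun _ _ ↦ rfl⟩

omit [IsManifold (𝓡 d) ∞ M] in
lemma metric_comm (x : M) (y v w : EuclideanSpace ℝ (Fin d)) : metric x y v w = metric x y w v :=
  real_inner_comm _ _

lemma metric_self_pos {x : M} {y : EuclideanSpace ℝ (Fin d)}
    (hy : y ∈ (extChartAt (𝓡 d) x).target) {v : EuclideanSpace ℝ (Fin d)} (hv : v ≠ 0) :
    0 < metric x y v v := by
  refine real_inner_self_pos.2 fun h ↦ hv ?_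
  rw [← chartVec_coordVec hy v, h, ← zero_smul ℝ (0 : TangentSpace (𝓡 d) _), chartVec_smul,
    zero_smul]

variable [IsContMDiffRiemannianBundle (𝓡 d) ∞ (EuclideanSpace ℝ (Fin d))
      (fun p : M ↦ TangentSpace (𝓡 d) p)]

lemma contDiffAt_metric_single {x : M} {y : EuclideanSpace ℝ (Fin d)}
    (hy : y ∈ (extChartAt (𝓡 d) x).target) (v w : EuclideanSpace ℝ (Fin d)) :
    ContDiffAt ℝ ∞ (fun z ↦ metric x z v w) y :=
  (ContMDiffAt.inner_bundle (IB := 𝓡 d) (F := EuclideanSpace ℝ (Fin d))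
    (E := fun p : M ↦ TangentSpace (𝓡 d) p) (b := (extChartAt (𝓡 d) x).symm)
    (v := fun z ↦ coordVec x z v) (w := fun z ↦ coordVec x z w)
    (contMDiffAt_coordVec hy v) (contMDiffAt_coordVec hy w)).contDiffAt

/-- Expansion in the standard basis makes the metric a polynomial in the vectors whose coefficients
are smooth by `contDiffAt_metric_single`. -/
lemma contDiffAt_metric {x : M} {y : EuclideanSpace ℝ (Fin d)}
    (hy : y ∈ (extChartAt (𝓡 d) x).target) (v w : EuclideanSpace ℝ (Fin d)) :
    ContDiffAt ℝ ∞ (fun q : EuclideanSpace ℝ (Fin d) × EuclideanSpace ℝ (Fin d) ×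
      EuclideanSpace ℝ (Fin d) ↦ metric x q.1 q.2.1 q.2.2) (y, v, w) := by
  have h1 : ∀ y v w : EuclideanSpace ℝ (Fin d), metric x y v w = ∑ i, ∑ j, v i * w j *
      metric x y (EuclideanSpace.single i 1) (EuclideanSpace.single j 1) := by
    intro y v w
    obtain ⟨B, hB⟩ := metric_bilinear d x y
    simp only [hB]
    conv_lhs => rw [← (EuclideanSpace.basisFun (Fin d) ℝ).sum_repr v,
      ← (EuclideanSpace.basisFun (Fin d) ℝ).sum_repr w]
    simp only [EuclideanSpace.basisFun_apply, EuclideanSpace.basisFun_repr, map_sum, map_smul,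
      LinearMap.sum_apply, LinearMap.smul_apply, smul_eq_mul, Finset.mul_sum]
    rw [Finset.sum_comm]
    exact Finset.sum_congr rfl fun i _ ↦ Finset.sum_congr rfl fun j _ ↦ by ring
  refine ContDiffAt.congr_of_eventuallyEq ?_ (Eventually.of_forall fun q ↦ h1 q.1 q.2.1 q.2.2)
  refine ContDiffAt.sum fun i _ ↦ ContDiffAt.sum fun j _ ↦ ?_
  refine ContDiffAt.mul (by fun_prop) ?_
  exact ContDiffAt.comp (f := Prod.fst) (y, v, w)
      (contDiffAt_metric_single (d := d) (x := x) (y := y) hy _ _)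
    contDiffAt_fst

omit [IsManifold (𝓡 d) ∞ M] [IsContMDiffRiemannianBundle (𝓡 d) ∞ (EuclideanSpace ℝ (Fin d))
      (fun p : M ↦ TangentSpace (𝓡 d) p)] in
lemma metric_eq_sum_gram (x : M) (y v : EuclideanSpace ℝ (Fin d)) (l : Fin d) :
    metric x y v (EuclideanSpace.single l 1) = ∑ k, v k * gram x y k l := by
  obtain ⟨B, hB⟩ := metric_bilinear d x y
  simp only [gram, Matrix.of_apply, hB]
  conv_lhs => rw [← (EuclideanSpace.basisFun (Fin d) ℝ).sum_repr v]
  simp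

omit [IsManifold (𝓡 d) ∞ M] [IsContMDiffRiemannianBundle (𝓡 d) ∞ (EuclideanSpace ℝ (Fin d))
      (fun p : M ↦ TangentSpace (𝓡 d) p)] in
lemma gram_symm (x : M) (y : EuclideanSpace ℝ (Fin d)) (i j : Fin d) :
    gram x y i j = gram x y j i :=
  metric_comm x y _ _

-- A vector in the kernel of the Gram matrix would be orthogonal to itself, against positivity.
omit [IsContMDiffRiemannianBundle (𝓡 d) ∞ (EuclideanSpace ℝ (Fin d))
      (fun p : M ↦ TangentSpace (𝓡 d) p)] in
lemma det_gram_ne_zero {x : M} {y : EuclideanSpace ℝ (Fin d)}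
    (hy : y ∈ (extChartAt (𝓡 d) x).target) : (gram x y).det ≠ 0 := by
  intro h
  obtain ⟨v, hv, hv'⟩ := Matrix.exists_vecMul_eq_zero_iff.2 h
  have hne : WithLp.toLp 2 v ≠ 0 := by simpa using hv
  refine (metric_self_pos hy hne).ne' ?_
  have h1 : ∀ l, metric x y (WithLp.toLp 2 v) (EuclideanSpace.single l 1) = 0 := by
    intro l
    rw [metric_eq_sum_gram]
    exact congrFun hv' l
  obtain ⟨B, hB⟩ := metric_bilinear d x y
  simp only [hB] at h1 ⊢
  have h2 : B (WithLp.toLp 2 v) = 0 :=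
    (EuclideanSpace.basisFun (Fin d) ℝ).toBasis.ext fun l ↦ by simpa using h1 l
  rw [h2, LinearMap.zero_apply]

/-- The Koszul formula. -/
lemma metric_christoffel {x : M} {y : EuclideanSpace ℝ (Fin d)}
    (hy : y ∈ (extChartAt (𝓡 d) x).target) (v w u : EuclideanSpace ℝ (Fin d)) :
    metric x y (christoffel x y v w) u = (1 / 2 : ℝ) * (fderiv ℝ (fun z ↦ metric x z w u) y v
      + fderiv ℝ (fun z ↦ metric x z v u) y w - fderiv ℝ (fun z ↦ metric x z v w) y u) := by
  obtain ⟨T, hT⟩ := fderiv_bilinear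
    (fun v w ↦ (contDiffAt_metric_single (x := x) hy v w).differentiableAt (by simp))
    (Eventually.of_forall fun z ↦ metric_bilinear d x z)
  obtain ⟨B, hB⟩ := metric_bilinear d x y
  -- Both sides are linear in u, so they are compared on the standard basis. There the sum over k of
  -- g_{kl}g^{km} collapses to a Kronecker delta.
  suffices h : B (christoffel x y v w)
      = (1 / 2 : ℝ) • (T v w + T w v - (T.flip v).flip w) by
    have := LinearMap.congr_fun h u
    simpa [hT, hB] using this
  refine (EuclideanSpace.basisFun (Fin d) ℝ).toBasis.ext fun l ↦ ?_
  have hsum : ∀ m, ∑ k, gram x y k l * (gram x y)⁻¹ k m = if l = m then 1 else 0 := by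
    intro m
    have h1 := congrFun (congrFun (Matrix.mul_nonsing_inv (gram x y)
      (isUnit_iff_ne_zero.2 (det_gram_ne_zero hy))) l) m
    rw [Matrix.mul_apply, Matrix.one_apply] at h1
    rw [← h1]
    exact Finset.sum_congr rfl fun k _ ↦ by rw [gram_symm]
  have h2 : B (christoffel x y v w) (EuclideanSpace.single l 1) = _ :=
    (hB _ _).symm.trans (metric_eq_sum_gram x y (christoffel x y v w) l)
  have h3 : ∀ k, christoffel x y v w k * gram x y k l = ∑ m, (1 / 2 : ℝ) *
      (gram x y k l * (gram x y)⁻¹ k m) * (T v w (EuclideanSpace.single m 1)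
        + T w v (EuclideanSpace.single m 1) - T (EuclideanSpace.single m 1) v w) := by
    intro k
    simp only [christoffel, hT, Finset.mul_sum, Finset.sum_mul]
    exact Finset.sum_congr rfl fun m _ ↦ by ring
  simp only [OrthonormalBasis.coe_toBasis, EuclideanSpace.basisFun_apply]
  rw [h2]
  simp_rw [h3]
  rw [Finset.sum_comm]
  simp_rw [← Finset.sum_mul, ← Finset.mul_sum, hsum]
  simp

omit [IsManifold (𝓡 d) ∞ M] [IsContMDiffRiemannianBundle (𝓡 d) ∞ (EuclideanSpace ℝ (Fin d))
      (fun p : M ↦ TangentSpace (𝓡 d) p)] in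
lemma christoffel_comm (x : M) (y v w : EuclideanSpace ℝ (Fin d)) :
    christoffel x y v w = christoffel x y w v := by
  simp only [christoffel, metric_comm x _ v w]
  congr 1; ext k
  congr 1
  exact Finset.sum_congr rfl fun l _ ↦ by ring

lemma contDiffAt_christoffel {x : M} {y : EuclideanSpace ℝ (Fin d)}
    (hy : y ∈ (extChartAt (𝓡 d) x).target) (v w : EuclideanSpace ℝ (Fin d)) :
    ContDiffAt ℝ ∞ (fun q : EuclideanSpace ℝ (Fin d) × EuclideanSpace ℝ (Fin d) ×
      EuclideanSpace ℝ (Fin d) ↦ christoffel x q.1 q.2.1 q.2.2) (y, v, w) := by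
  have hg : ∀ i j, ContDiffAt ℝ ∞ (fun q : EuclideanSpace ℝ (Fin d) × EuclideanSpace ℝ (Fin d) ×
      EuclideanSpace ℝ (Fin d) ↦ gram x q.1 i j) (y, v, w) := fun i j ↦
    ContDiffAt.comp (f := Prod.fst) (y, v, w)
      (contDiffAt_metric_single (d := d) (x := x) (y := y) hy _ _)
      contDiffAt_fst
  have hdet : ∀ A : EuclideanSpace ℝ (Fin d) × EuclideanSpace ℝ (Fin d) ×
      EuclideanSpace ℝ (Fin d) → Matrix (Fin d) (Fin d) ℝ,
      (∀ i j, ContDiffAt ℝ ∞ (fun q ↦ A q i j) (y, v, w)) →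
        ContDiffAt ℝ ∞ (fun q ↦ (A q).det) (y, v, w) := by
    intro A hA
    simp only [Matrix.det_apply]
    refine ContDiffAt.sum fun σ _ ↦ ContDiffAt.const_smul _ (contDiffAt_prod fun i _ ↦ hA _ _)
  -- The inverse matrix is the adjugate over the determinant, and the entries of the adjugate are
  -- again determinants.
  have hinv : ∀ i j, ContDiffAt ℝ ∞ (fun q : EuclideanSpace ℝ (Fin d) × EuclideanSpace ℝ (Fin d) ×
      EuclideanSpace ℝ (Fin d) ↦ (gram x q.1)⁻¹ i j) (y, v, w) := by
    intro i j
    simp only [Matrix.inv_def, Matrix.smul_apply, Ring.inverse_eq_inv', Matrix.adjugate_apply,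
      smul_eq_mul]
    refine ContDiffAt.mul (ContDiffAt.inv (hdet _ hg) (det_gram_ne_zero hy)) (hdet _ fun k l ↦ ?_)
    by_cases hk : k = j
    · subst hk; simpa using contDiffAt_const
    · simpa [Matrix.updateRow_ne hk] using hg k l
  have hD : ∀ a b c : EuclideanSpace ℝ (Fin d) × EuclideanSpace ℝ (Fin d) ×
      EuclideanSpace ℝ (Fin d) → EuclideanSpace ℝ (Fin d), ContDiff ℝ ∞ a → ContDiff ℝ ∞ b →
      ContDiff ℝ ∞ c → ContDiffAt ℝ ∞ (fun q ↦ fderiv ℝ (fun z ↦ metric x z (a q) (b q)) q.1 (c q))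
        (y, v, w) := by
    intro a b c ha hb hc
    refine ContDiffAt.clm_apply (ContDiffAt.fderiv (n := ∞)
      (f := fun q z ↦ metric x z (a q) (b q)) (g := Prod.fst) ?_ contDiffAt_fst (by simp))
      hc.contDiffAt
    exact ContDiffAt.comp (f := fun q : (EuclideanSpace ℝ (Fin d) × EuclideanSpace ℝ (Fin d) ×
      EuclideanSpace ℝ (Fin d)) × EuclideanSpace ℝ (Fin d) ↦ (q.2, a q.1, b q.1)) ((y, v, w), y)
      (contDiffAt_metric (d := d) (x := x) (y := y) hy _ _) (by fun_prop)
  rw [contDiffAt_piLp]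
  intro k
  simp only [christoffel]
  refine contDiffAt_const.mul (ContDiffAt.sum fun l _ ↦ (hinv _ _).mul ?_)
  exact ((hD _ _ _ (by fun_prop) (by fun_prop) (by fun_prop)).add
    (hD _ _ _ (by fun_prop) (by fun_prop) (by fun_prop))).sub
    (hD _ _ _ (by fun_prop) (by fun_prop) (by fun_prop))

lemma christoffel_bilinear {x : M} {y : EuclideanSpace ℝ (Fin d)}
    (hy : y ∈ (extChartAt (𝓡 d) x).target) :
    ∃ B : EuclideanSpace ℝ (Fin d) →ₗ[ℝ] EuclideanSpace ℝ (Fin d) →ₗ[ℝ] EuclideanSpace ℝ (Fin d),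
      ∀ v w, christoffel x y v w = B v w := by
  obtain ⟨T, hT⟩ := fderiv_bilinear
    (fun v w ↦ (contDiffAt_metric_single (x := x) hy v w).differentiableAt (by simp))
    (Eventually.of_forall fun z ↦ metric_bilinear d x z)
  have hadd : ∀ v v' w, christoffel x y (v + v') w
      = christoffel x y v w + christoffel x y v' w := by
    intro v v' w
    ext k
    simp only [christoffel, hT, map_add, LinearMap.add_apply, PiLp.add_apply, ← mul_add,
      ← Finset.sum_add_distrib]
    congr 1
    exact Finset.sum_congr rfl fun l _ ↦ by ring
  have hsmul : ∀ (r : ℝ) v w, christoffel x y (r • v) w = r • christoffel x y v w := by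
    intro r v w
    ext k
    simp only [christoffel, hT, map_smul, LinearMap.smul_apply, PiLp.smul_apply, smul_eq_mul]
    rw [mul_left_comm r, Finset.mul_sum, Finset.mul_sum, Finset.mul_sum]
    exact Finset.sum_congr rfl fun l _ ↦ by ring
  exact ⟨LinearMap.mk₂ ℝ (christoffel x y) hadd hsmul
    (fun v w w' ↦ by rw [christoffel_comm, hadd, christoffel_comm x y w, christoffel_comm x y w'])
    (fun r v w ↦ by rw [christoffel_comm, hsmul, christoffel_comm x y w]), fun _ _ ↦ rfl⟩

-- Metric compatibility results from adding two instances of the Koszul formula: all but one of the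
-- derivative terms cancel.
variable (d) in
lemma isLeviCivita (x : M) :
    IsLeviCivita (extChartAt (𝓡 d) x).target (metric x) (christoffel (d := d) x) where
  isOpen := isOpen_extChartAt_target x
  contDiffAt_metric _ := contDiffAt_metric
  contDiffAt _ := contDiffAt_christoffel
  metric_bilin y _ := metric_bilinear d x y
  bilin _ := christoffel_bilinear
  metric_symm y _ := metric_comm x y
  metric_pos _ hy _ := metric_self_pos hy
  symm y _ := christoffel_comm x y
  compat y hy u v w := by
    rw [metric_christoffel hy, metric_comm x y v, metric_christoffel hy]
    simp only [metric_comm x _ w]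
    ring

lemma christoffel_coordChange {x x' : M} {y : EuclideanSpace ℝ (Fin d)}
    (hy : y ∈ (extChartAt (𝓡 d) x).target)
    (hy' : (extChartAt (𝓡 d) x).symm y ∈ (extChartAt (𝓡 d) x').source)
    (v w : EuclideanSpace ℝ (Fin d)) :
    fderiv ℝ (extChartAt (𝓡 d) x' ∘ (extChartAt (𝓡 d) x).symm) y (christoffel x y v w)
      = christoffel x' ((extChartAt (𝓡 d) x' ∘ (extChartAt (𝓡 d) x).symm) y)
          (fderiv ℝ (extChartAt (𝓡 d) x' ∘ (extChartAt (𝓡 d) x).symm) y v)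
          (fderiv ℝ (extChartAt (𝓡 d) x' ∘ (extChartAt (𝓡 d) x).symm) y w)
        + fderiv ℝ (fderiv ℝ (extChartAt (𝓡 d) x' ∘ (extChartAt (𝓡 d) x).symm)) y v w := by
  refine (isLeviCivita d x).christoffel_transform (isLeviCivita d x') hy
    ((contDiffAt_coordChange hy hy').of_le (by norm_cast)) ((extChartAt (𝓡 d) x').map_source hy')
    ?_ ?_ v w
  · filter_upwards [eventually_mem_source_of_mem_target hy hy'] with z hz v w
    exact metric_coordChange hz.1 hz.2 v w
  · intro u
    obtain ⟨u, rfl⟩ := chartVec_surjective hy' u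
    exact ⟨chartVec x u, by rw [← chartVec_eq_fderiv hy hy', coordVec_chartVec hy]⟩

end Charts

end Fermi
end

noncomputable section
namespace Fermi
open Filter Topology

/-! ### Autonomous differential equations given in charts -/

/-- A space covered by charts with values in `E`, together with a smooth vector field. -/
structure FlowSystem (X ι E : Type*) [NormedAddCommGroup E] [NormedSpace ℝ E] where
  src : ι → Set X
  chart : ι → X → E
  inv : ι → E → X
  field : ι → E → E
  exists_mem : ∀ p, ∃ i, p ∈ src i
  inv_chart : ∀ {i p}, p ∈ src i → inv i (chart i p) = p
  eventually_mem : ∀ {i j p}, p ∈ src i → p ∈ src j →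
    ∀ᶠ y in 𝓝 (chart i p), inv i y ∈ src i ∧ inv i y ∈ src j ∧ chart i (inv i y) = y
  contDiffAt_change : ∀ {i j p}, p ∈ src i → p ∈ src j →
    ContDiffAt ℝ ∞ (fun y ↦ chart j (inv i y)) (chart i p)
  contDiffAt_field : ∀ {i p}, p ∈ src i → ContDiffAt ℝ ∞ (field i) (chart i p)
  field_change : ∀ {i j p}, p ∈ src i → p ∈ src j →
    fderiv ℝ (fun y ↦ chart j (inv i y)) (chart i p) (field i (chart i p)) = field j (chart j p)
  -- The Hausdorff property expressed in charts, because `X` carries no topology here. It closes up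
  -- the coincidence set in `eqOn_of_isSol`.
  separated : ∀ {p q}, p ≠ q → ∃ i j, p ∈ src i ∧ q ∈ src j ∧
    ∃ A ∈ 𝓝 (chart i p), ∃ B ∈ 𝓝 (chart j q),
      ∀ r ∈ src i, r ∈ src j → chart i r ∈ A → chart j r ∉ B

namespace FlowSystem

variable {X ι E Q : Type*} [NormedAddCommGroup E] [NormedSpace ℝ E] [NormedAddCommGroup Q]
  [NormedSpace ℝ Q] (S : FlowSystem X ι E)

/-- The map `z` into a space with charts is `C^n` at `q₀`. -/
def SmoothAt (n : ℕ) (z : Q → X) (q₀ : Q) : Prop :=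
  ∀ i, z q₀ ∈ S.src i → (∀ᶠ q in 𝓝 q₀, z q ∈ S.src i) ∧
    ContDiffAt ℝ n (fun q ↦ S.chart i (z q)) q₀

/-- The curve `f` solves the differential equation at time `t`. -/
def IsSol (f : ℝ → X) (t : ℝ) : Prop :=
  ∀ i, f t ∈ S.src i → (∀ᶠ s in 𝓝 t, f s ∈ S.src i) ∧
    HasDerivAt (fun s ↦ S.chart i (f s)) (S.field i (S.chart i (f t))) t

variable {S}

/-- In the absence of a topology on `X`, closeness to p is read off in chart i; this converts it to
chart j. -/
lemma eventually_change {α : Type*} {l : Filter α} {z : α → X} {p : X} {i j : ι} (hi : p ∈ S.src i)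
    (hj : p ∈ S.src j) (h1 : ∀ᶠ a in l, z a ∈ S.src i)
    (h2 : Tendsto (fun a ↦ S.chart i (z a)) l (𝓝 (S.chart i p))) :
    ∀ᶠ a in l, z a ∈ S.src j ∧ S.chart j (z a) = S.chart j (S.inv i (S.chart i (z a))) := by
  filter_upwards [h1, h2.eventually (S.eventually_mem hi hj)] with a ha ha'
  rw [S.inv_chart ha] at ha' ⊢
  exact ⟨ha'.2.1, rfl⟩

lemma SmoothAt.of_chart {n : ℕ} {z : Q → X} {q₀ : Q} {i : ι} (hi : z q₀ ∈ S.src i)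
    (h1 : ∀ᶠ q in 𝓝 q₀, z q ∈ S.src i) (h2 : ContDiffAt ℝ n (fun q ↦ S.chart i (z q)) q₀) :
    S.SmoothAt n z q₀ := by
  intro j hj
  have h3 := eventually_change hi hj h1 h2.continuousAt
  refine ⟨h3.mono fun q hq ↦ hq.1, ?_⟩
  have h4 : ContDiffAt ℝ n (fun y ↦ S.chart j (S.inv i y)) (S.chart i (z q₀)) :=
    (S.contDiffAt_change hi hj).of_le (by exact_mod_cast le_top)
  refine (h4.comp q₀ h2).congr_of_eventuallyEq ?_
  filter_upwards [h3] with q hq using hq.2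

/-- One chart is enough: the chain rule and `field_change` carry the equation to any other chart. -/
lemma IsSol.of_chart {f : ℝ → X} {t : ℝ} {i : ι} (hi : f t ∈ S.src i)
    (h1 : ∀ᶠ s in 𝓝 t, f s ∈ S.src i)
    (h2 : HasDerivAt (fun s ↦ S.chart i (f s)) (S.field i (S.chart i (f t))) t) :
    S.IsSol f t := by
  intro j hj
  have h3 := eventually_change hi hj h1 h2.continuousAt
  refine ⟨h3.mono fun q hq ↦ hq.1, ?_⟩
  have h4 : HasFDerivAt (fun y ↦ S.chart j (S.inv i y)) _ (S.chart i (f t)) :=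
    ((S.contDiffAt_change hi hj).differentiableAt (by simp)).hasFDerivAt
  have h5 := HasFDerivAt.comp_hasDerivAt (f := fun s ↦ S.chart i (f s)) t h4 h2
  rw [S.field_change hi hj] at h5
  refine h5.congr_of_eventuallyEq ?_
  filter_upwards [h3] with q hq using hq.2

lemma IsSol.congr {f g : ℝ → X} {t : ℝ} (h : S.IsSol f t) (hfg : g =ᶠ[𝓝 t] f) : S.IsSol g t := by
  intro i hi
  rw [hfg.eq_of_nhds] at hi ⊢
  obtain ⟨h1, h2⟩ := h i hi
  refine ⟨?_, h2.congr_of_eventuallyEq ?_⟩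
  · filter_upwards [h1, hfg] with s h1 h2 using h2 ▸ h1
  · filter_upwards [hfg] with s h2 using by rw [h2]

lemma IsSol.comp_add_const {f : ℝ → X} {t c : ℝ} (h : S.IsSol f (t + c)) :
    S.IsSol (fun s ↦ f (s + c)) t := by
  intro i hi
  obtain ⟨h1, h2⟩ := h i hi
  exact ⟨(((continuous_id.add continuous_const).tendsto t).eventually h1 :),
    h2.comp_add_const t c⟩

/-- The field is C¹ in a chart, hence locally Lipschitz, and the uniqueness theorem for differential
equations applies. -/
lemma eventuallyEq_of_isSol {f g : ℝ → X} {t : ℝ} (hf : ∀ᶠ s in 𝓝 t, S.IsSol f s)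
    (hg : ∀ᶠ s in 𝓝 t, S.IsSol g s) (h : f t = g t) : f =ᶠ[𝓝 t] g := by
  obtain ⟨i, hi⟩ := S.exists_mem (f t)
  have hi' : g t ∈ S.src i := h ▸ hi
  obtain ⟨hf1, hf2⟩ := hf.self_of_nhds i hi
  obtain ⟨hg1, hg2⟩ := hg.self_of_nhds i hi'
  obtain ⟨K, U, hU, hK⟩ := ((S.contDiffAt_field hi).of_le (m := 1)
    (by norm_cast)).exists_lipschitzOnWith
  have h1 : (fun s ↦ S.chart i (f s)) =ᶠ[𝓝 t] fun s ↦ S.chart i (g s) := by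
    refine ODE_solution_unique_of_eventually (v := fun _ ↦ S.field i) (s := fun _ ↦ U) (K := K)
      (Eventually.of_forall fun _ ↦ hK) ?_ ?_ (by rw [h])
    · filter_upwards [hf, hf1, hf2.continuousAt.preimage_mem_nhds hU] with s h1 h2 h3
      exact ⟨(h1 i h2).2, h3⟩
    · rw [h] at hU
      filter_upwards [hg, hg1, hg2.continuousAt.preimage_mem_nhds hU] with s h1 h2 h3
      exact ⟨(h1 i h2).2, h3⟩
  filter_upwards [h1, hf1, hg1] with s h1 h2 h3
  rw [← S.inv_chart h2, h1, S.inv_chart h3]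

/-- The interior of the coincidence set is relatively closed in J by `separated` combined with local
uniqueness. It is nonempty, so it contains the preconnected set J. -/
lemma eqOn_of_isSol {f g : ℝ → X} {J : Set ℝ} (hJ : IsOpen J) (hJ' : IsPreconnected J) {t₀ : ℝ}
    (ht₀ : t₀ ∈ J) (hf : ∀ s ∈ J, S.IsSol f s) (hg : ∀ s ∈ J, S.IsSol g s) (h : f t₀ = g t₀) :
    EqOn f g J := by
  have hloc : ∀ t ∈ J, f t = g t → f =ᶠ[𝓝 t] g := fun t ht h ↦ eventuallyEq_of_isSol
    (eventually_of_mem (hJ.mem_nhds ht) hf) (eventually_of_mem (hJ.mem_nhds ht) hg) h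
  let u : Set ℝ := interior {t | f t = g t}
  have hu : ∀ t ∈ J, f t = g t → t ∈ u := fun t ht h ↦
    mem_interior_iff_mem_nhds.2 (hloc t ht h)
  have hcl : closure u ∩ J ⊆ u := by
    rintro t ⟨htu, ht⟩
    refine hu t ht ?_
    by_contra hne
    obtain ⟨i, j, hi, hj, A, hA, B, hB, hAB⟩ := S.separated hne
    obtain ⟨hf1, hf2⟩ := hf t ht i hi
    obtain ⟨hg1, hg2⟩ := hg t ht j hj
    have h1 : ∃ᶠ s in 𝓝 t, s ∈ u := mem_closure_iff_frequently.1 htu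
    have hA' : ∀ᶠ s in 𝓝 t, S.chart i (f s) ∈ A := hf2.continuousAt.preimage_mem_nhds hA
    have hB' : ∀ᶠ s in 𝓝 t, S.chart j (g s) ∈ B := hg2.continuousAt.preimage_mem_nhds hB
    obtain ⟨s, hs, h2, h3, h4, h5⟩ :=
      (h1.and_eventually (hf1.and (hg1.and (hA'.and hB')))).exists
    have hs' : f s = g s := interior_subset (s := {t | f t = g t}) hs
    exact hAB (f s) h2 (hs' ▸ h3) h4 (hs' ▸ h5)
  intro t ht
  have htu : t ∈ u := hJ'.subset_of_closure_inter_subset isOpen_interior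
    ⟨t₀, ht₀, hu t₀ ht₀ h⟩ hcl ht
  exact interior_subset (s := {t | f t = g t}) htu

lemma eq_of_isSol {f g : ℝ → X} {t₀ : ℝ} (hf : ∀ s, S.IsSol f s) (hg : ∀ s, S.IsSol g s)
    (h : f t₀ = g t₀) : f = g :=
  funext fun t ↦ eqOn_of_isSol isOpen_univ isPreconnected_univ (mem_univ t₀) (fun s _ ↦ hf s)
    (fun s _ ↦ hg s) h (mem_univ t)

variable [FiniteDimensional ℝ E]

lemma exists_localFlow {n : ℕ} (hn : n ≠ 0) {p : X} {i : ι} (hp : p ∈ S.src i) :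
    ∃ δ > 0, ∃ Ψ : ℝ × E → E, ∀ τ y, |τ| < δ → dist y (S.chart i p) < δ →
      ContDiffAt ℝ n Ψ (τ, y) ∧ Ψ (0, y) = y ∧ S.inv i (Ψ (τ, y)) ∈ S.src i ∧
        S.chart i (S.inv i (Ψ (τ, y))) = Ψ (τ, y) ∧ S.IsSol (fun s ↦ S.inv i (Ψ (s, y))) τ := by
  obtain ⟨δ, hδ, Ψ, hΨ⟩ := exists_contDiffAt_localFlow hn
    ((S.contDiffAt_field hp).of_le (by exact_mod_cast le_top)) (S.eventually_mem hp hp)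
  refine ⟨δ, hδ, Ψ, fun τ y hτ hy ↦ ?_⟩
  obtain ⟨h1, h2, h3, h4, -, h5⟩ := hΨ τ y hτ hy
  refine ⟨h1, h2, h4, h5, .of_chart h4 ?_ ?_⟩
  · filter_upwards [(isOpen_lt continuous_abs continuous_const).mem_nhds hτ] with s hs
    exact (hΨ s y hs hy).2.2.2.1
  · rw [h5]
    refine h3.congr_of_eventuallyEq ?_
    filter_upwards [(isOpen_lt continuous_abs continuous_const).mem_nhds hτ] with s hs
    exact (hΨ s y hs hy).2.2.2.2.2

variable (S) in
/-- Solutions on bounded intervals accumulate at the end points. -/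
def IsComplete : Prop :=
  ∀ (f : ℝ → X) (a b : ℝ), a < b → (∀ t ∈ Ioo a b, S.IsSol f t) → ∀ e ∈ Icc a b,
    ∃ i p, p ∈ S.src i ∧ ∀ W ∈ 𝓝 (S.chart i p),
      ∃ᶠ t in 𝓝[Ioo a b] e, f t ∈ S.src i ∧ S.chart i (f t) ∈ W

/-- Near the accumulation point the local flow runs for a time δ independent of the starting point.
Started at a time within δ/2 of e, it continues the solution to distance δ/2 on both sides of e. -/
lemma IsComplete.extend (hS : S.IsComplete) {f : ℝ → X} {a b e : ℝ} (hab : a < b)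
    (hf : ∀ t ∈ Ioo a b, S.IsSol f t) (he : e ∈ Icc a b) :
    ∃ g : ℝ → X, EqOn g f (Ioo a b) ∧ ∃ ε > 0,
      ∀ t ∈ Ioo a b ∪ Ioo (e - ε) (e + ε), S.IsSol g t := by
  obtain ⟨i, p, hp, hfreq⟩ := hS f a b hab hf e he
  obtain ⟨δ, hδ, Ψ, hΨ⟩ := S.exists_localFlow one_ne_zero hp
  obtain ⟨t₁, ⟨h1, h2⟩, h3, h4⟩ := ((hfreq _ (Metric.ball_mem_nhds _ hδ)).and_eventually
    ((eventually_mem_nhdsWithin).and (mem_nhdsWithin_of_mem_nhds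
      (Ioo_mem_nhds (a := e - δ / 2) (b := e + δ / 2) (by linarith) (by linarith))))).exists
  let k : ℝ → X := fun s ↦ S.inv i (Ψ (s - t₁, S.chart i (f t₁)))
  have hk : ∀ t ∈ Ioo (t₁ - δ) (t₁ + δ), S.IsSol k t := by
    intro t ht
    have hτ : |t - t₁| < δ := by rw [abs_lt]; constructor <;> linarith [ht.1, ht.2]
    have := (hΨ (t - t₁) _ hτ h2).2.2.2.2
    exact IsSol.comp_add_const (c := -t₁) this
  have hk0 : k t₁ = f t₁ := by
    simp only [k, sub_self]
    rw [(hΨ 0 _ (by simpa using hδ) h2).2.1, S.inv_chart h1]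
  have heq : EqOn k f (Ioo (t₁ - δ) (t₁ + δ) ∩ Ioo a b) :=
    eqOn_of_isSol (isOpen_Ioo.inter isOpen_Ioo)
      (by rw [Ioo_inter_Ioo]; exact isPreconnected_Ioo)
      ⟨⟨by linarith, by linarith⟩, h3⟩ (fun s hs ↦ hk s hs.1) (fun s hs ↦ hf s hs.2) hk0
  classical
  refine ⟨(Ioo a b).piecewise f k, piecewise_eqOn _ _ _, δ / 2, by positivity, ?_⟩
  rintro t (ht | ht)
  · exact (hf t ht).congr ((piecewise_eqOn _ _ _).eventuallyEq_of_mem (isOpen_Ioo.mem_nhds ht))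
  · have ht' : t ∈ Ioo (t₁ - δ) (t₁ + δ) := ⟨by linarith [ht.1, h4.2], by linarith [ht.2, h4.1]⟩
    refine (hk t ht').congr ?_
    filter_upwards [isOpen_Ioo.mem_nhds ht'] with s hs
    by_cases hs' : s ∈ Ioo a b
    · rw [piecewise_eq_of_mem _ _ _ hs', heq ⟨hs, hs'⟩]
    · rw [piecewise_eq_of_notMem _ _ _ hs']

-- Solutions through q on symmetric intervals agree on common intervals by uniqueness, so they can
-- be glued.
omit [FiniteDimensional ℝ E] in
lemma exists_isSol_of_forall {q : X} {J : Set ℝ}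
    (h : ∀ t ∈ J, ∃ T, |t| < T ∧ ∃ f : ℝ → X, f 0 = q ∧ ∀ t ∈ Ioo (-T) T, S.IsSol f t) :
    ∃ f : ℝ → X, f 0 = q ∧ ∀ t ∈ J, S.IsSol f t := by
  classical
  let f : ℝ → X := fun t ↦ if h : ∃ f : ℝ → X, ∃ T, |t| < T ∧ f 0 = q ∧
    ∀ t ∈ Ioo (-T) T, S.IsSol f t then h.choose t else q
  have key : ∀ (g : ℝ → X) T, g 0 = q → (∀ t ∈ Ioo (-T) T, S.IsSol g t) →
      EqOn f g (Ioo (-T) T) := by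
    intro g T hg0 hg t ht
    have htT : |t| < T := abs_lt.2 ht
    have hex : ∃ f : ℝ → X, ∃ T, |t| < T ∧ f 0 = q ∧ ∀ t ∈ Ioo (-T) T, S.IsSol f t :=
      ⟨g, T, htT, hg0, hg⟩
    have hft : f t = hex.choose t := dif_pos hex
    obtain ⟨T', hT', h0, hsol⟩ := hex.choose_spec
    rw [hft]
    have hpos := (abs_nonneg t).trans_lt htT
    have hpos' := (abs_nonneg t).trans_lt hT'
    exact eqOn_of_isSol (J := Ioo (-T) T ∩ Ioo (-T') T') (isOpen_Ioo.inter isOpen_Ioo)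
      (by rw [Ioo_inter_Ioo]; exact isPreconnected_Ioo) (t₀ := 0)
      ⟨⟨by linarith, by linarith⟩, ⟨by linarith, by linarith⟩⟩ (fun s hs ↦ hsol s hs.2)
      (fun s hs ↦ hg s hs.1) (h0.trans hg0.symm) ⟨ht, abs_lt.1 hT'⟩
  refine ⟨f, ?_, fun t ht ↦ ?_⟩
  · by_cases h0 : ∃ f : ℝ → X, ∃ T, |(0 : ℝ)| < T ∧ f 0 = q ∧ ∀ t ∈ Ioo (-T) T, S.IsSol f t
    · exact (dif_pos h0 : f 0 = h0.choose 0).trans h0.choose_spec.choose_spec.2.1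
    · exact dif_neg h0
  · obtain ⟨T, hT, g, hg0, hg⟩ := h t ht
    exact (hg t (abs_lt.1 hT)).congr
      ((key g T hg0 hg).eventuallyEq_of_mem (isOpen_Ioo.mem_nhds (abs_lt.1 hT)))

/-- The set of T admitting a solution on (-T,T) contains its supremum by gluing. Extending at both
ends would exceed that supremum, so the set is unbounded. -/
theorem IsComplete.exists_isSol (hS : S.IsComplete) (q : X) :
    ∃ f : ℝ → X, f 0 = q ∧ ∀ t, S.IsSol f t := by
  let P : ℝ → Prop := fun T ↦ ∃ f : ℝ → X, f 0 = q ∧ ∀ t ∈ Ioo (-T) T, S.IsSol f t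
  have hmono : ∀ {T T'}, T' ≤ T → P T → P T' := by
    rintro T T' hTT' ⟨f, h0, hf⟩
    exact ⟨f, h0, fun t ht ↦ hf t ⟨by linarith [ht.1], by linarith [ht.2]⟩⟩
  have hpos : ∃ T > 0, P T := by
    obtain ⟨i, hi⟩ := S.exists_mem q
    obtain ⟨δ, hδ, Ψ, hΨ⟩ := S.exists_localFlow one_ne_zero hi
    refine ⟨δ, hδ, fun s ↦ S.inv i (Ψ (s, S.chart i q)), ?_, fun t ht ↦
      (hΨ t _ (abs_lt.2 ht) (by simpa using hδ)).2.2.2.2⟩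
    beta_reduce
    rw [(hΨ 0 (S.chart i q) (by simpa using hδ) (by simpa using hδ)).2.1, S.inv_chart hi]
  have hstep : ∀ T > 0, P T → ∃ T' > T, P T' := by
    rintro T hT ⟨f, h0, hf⟩
    obtain ⟨g, hg, ε, hε, hg'⟩ := hS.extend (e := T) (by linarith) hf ⟨by linarith, le_rfl⟩
    have hg'' : ∀ t ∈ Ioo (-T) (T + ε), S.IsSol g t := by
      intro t ht
      rcases lt_or_ge t T with h | h
      · exact hg' t (.inl ⟨ht.1, h⟩)
      · exact hg' t (.inr ⟨by linarith, ht.2⟩)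
    obtain ⟨k, hk, ε', hε', hk'⟩ := hS.extend (e := -T) (by linarith) hg''
      ⟨le_rfl, by linarith⟩
    refine ⟨T + min ε ε', by linarith [lt_min hε hε'], k, ?_, fun t ht ↦ ?_⟩
    · rw [hk ⟨by linarith, by linarith⟩, hg ⟨by linarith, by linarith⟩, h0]
    · have h1 := min_le_left ε ε'
      have h2 := min_le_right ε ε'
      rcases lt_or_ge (-T) t with h | h
      · exact hk' t (.inl ⟨h, by linarith [ht.2]⟩)
      · exact hk' t (.inr ⟨by linarith [ht.1], by linarith⟩)
  have hall : ∀ T, P T := by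
    by_contra! h
    obtain ⟨T₀, hT₀⟩ := h
    obtain ⟨T₁, hT₁, hP⟩ := hpos
    have hbdd : BddAbove {T | P T} :=
      ⟨T₀, fun T hT ↦ le_of_not_gt fun hlt ↦ hT₀ (hmono hlt.le hT)⟩
    set R := sSup {T | P T} with hR
    have hR1 : 0 < R := hT₁.trans_le (le_csSup hbdd hP)
    have hPR : P R := by
      refine exists_isSol_of_forall fun t ht ↦ ?_
      obtain ⟨T, hT, hlt⟩ := exists_lt_of_lt_csSup ⟨T₁, hP⟩ (abs_lt.2 ht)
      exact ⟨T, hlt, hT⟩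
    obtain ⟨T', hT', hP'⟩ := hstep R hR1 hPR
    exact absurd (le_csSup hbdd hP') (not_le.2 hT')
  obtain ⟨f, h0, hf⟩ := exists_isSol_of_forall (S := S) (q := q) (J := univ) fun t _ ↦
    ⟨|t| + 1, by linarith, hall _⟩
  exact ⟨f, h0, fun t ↦ hf t (mem_univ t)⟩

/-- Solutions depend smoothly on time and on the initial value. -/
theorem smoothAt_of_isSol {n : ℕ} (hn : n ≠ 0) {f : Q → ℝ → X} {q₀ : Q}
    (hf : ∀ q t, S.IsSol (f q) t) (h0 : S.SmoothAt n (fun q ↦ f q 0) q₀) (s : ℝ) :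
    S.SmoothAt n (fun z : ℝ × Q ↦ f z.2 z.1) (s, q₀) := by
  -- Near time `s₀` the solution at time s₂ is the local flow for time s₂ - s₁ applied to the
  -- solution at time s₁. Smoothness at s₁ thus passes to every nearby s₂, jointly in time and
  -- parameter.
  have key : ∀ s₀, ∃ ε > 0, ∀ s₁ s₂, |s₁ - s₀| < ε → |s₂ - s₀| < ε →
      S.SmoothAt n (fun q ↦ f q s₁) q₀ → S.SmoothAt n (fun z : ℝ × Q ↦ f z.2 z.1) (s₂, q₀) := by
    intro s₀
    obtain ⟨i, hi⟩ := S.exists_mem (f q₀ s₀)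
    obtain ⟨δ, hδ, Ψ, hΨ⟩ := S.exists_localFlow hn hi
    obtain ⟨h1, h2⟩ := hf q₀ s₀ i hi
    obtain ⟨ε, hε, hball⟩ := Metric.eventually_nhds_iff.1
      (h1.and (h2.continuousAt.preimage_mem_nhds (Metric.ball_mem_nhds _ hδ)))
    refine ⟨min ε (δ / 2), by positivity, fun s₁ s₂ hs₁ hs₂ hsm ↦ ?_⟩
    obtain ⟨hm, hd⟩ := hball (y := s₁) (hs₁.trans_le (min_le_left _ _))
    have hs : |s₂ - s₁| < δ := by
      have := min_le_right ε (δ / 2)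
      rw [abs_lt] at hs₁ hs₂ ⊢
      constructor <;> linarith
    obtain ⟨hev, hcd⟩ := hsm i hm
    have hd' : ∀ᶠ q in 𝓝 q₀, dist (S.chart i (f q s₁)) (S.chart i (f q₀ s₀)) < δ :=
      hcd.continuousAt.preimage_mem_nhds (Metric.isOpen_ball.mem_nhds hd)
    have hτ : ∀ᶠ t in 𝓝 s₂, |t - s₁| < δ :=
      (isOpen_lt (by fun_prop) continuous_const).mem_nhds hs
    have hflow : ∀ q t, f q s₁ ∈ S.src i → dist (S.chart i (f q s₁)) (S.chart i (f q₀ s₀)) < δ →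
        |t - s₁| < δ → f q t = S.inv i (Ψ (t - s₁, S.chart i (f q s₁))) := by
      intro q t hq hq' ht
      refine eqOn_of_isSol (S := S) (f := f q)
        (g := fun t ↦ S.inv i (Ψ (t - s₁, S.chart i (f q s₁)))) (J := Ioo (s₁ - δ) (s₁ + δ))
        isOpen_Ioo isPreconnected_Ioo (t₀ := s₁) ⟨by linarith, by linarith⟩
        (fun s _ ↦ hf q s) (fun s hs ↦ ?_) ?_ ?_
      · have hτ : |s - s₁| < δ := by rw [abs_lt]; constructor <;> linarith [hs.1, hs.2]
        exact IsSol.comp_add_const (c := -s₁) (hΨ (s - s₁) _ hτ hq').2.2.2.2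
      · rw [sub_self, (hΨ 0 _ (by simpa using hδ) hq').2.1, S.inv_chart hq]
      · rw [abs_lt] at ht
        exact ⟨by linarith, by linarith⟩
    have hall : ∀ᶠ z : ℝ × Q in 𝓝 (s₂, q₀), f z.2 z.1 ∈ S.src i ∧
        S.chart i (f z.2 z.1) = Ψ (z.1 - s₁, S.chart i (f z.2 s₁)) := by
      rw [nhds_prod_eq]
      filter_upwards [hτ.prod_mk (hev.and hd')] with z hz
      obtain ⟨h1, h2, h3⟩ := hz
      rw [hflow _ _ h2 h3 h1]
      obtain ⟨-, -, h4, h5, -⟩ := hΨ _ _ h1 h3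
      exact ⟨h4, h5⟩
    refine .of_chart hall.self_of_nhds.1 (hall.mono fun z hz ↦ hz.1) ?_
    refine ContDiffAt.congr_of_eventuallyEq ?_ (hall.mono fun z hz ↦ hz.2)
    refine ContDiffAt.comp (f := fun z : ℝ × Q ↦ (z.1 - s₁, S.chart i (f z.2 s₁))) (s₂, q₀)
      (hΨ _ _ hs hd).1 ((contDiffAt_fst.sub contDiffAt_const).prodMk ?_)
    exact ContDiffAt.comp (f := Prod.snd) (s₂, q₀) hcd contDiffAt_snd
  have hslice : ∀ s, S.SmoothAt n (fun z : ℝ × Q ↦ f z.2 z.1) (s, q₀) →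
      S.SmoothAt n (fun q ↦ f q s) q₀ := by
    intro s hs i hi
    obtain ⟨h1, h2⟩ := hs i hi
    have hc : ContDiff ℝ n (fun q : Q ↦ (s, q)) := by fun_prop
    exact ⟨(hc.continuous.tendsto q₀).eventually h1,
      ContDiffAt.comp (f := fun q : Q ↦ (s, q)) q₀ h2 hc.contDiffAt⟩
  -- By `key`, a closure point of this set is an interior point. The set is therefore open and
  -- closed, and it contains 0.
  let A : Set ℝ := {s | S.SmoothAt n (fun q ↦ f q s) q₀}
  have hA : IsClopen A := by
    rw [isClopen_iff_frontier_eq_empty, eq_empty_iff_forall_notMem]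
    intro s₀ hs₀
    obtain ⟨ε, hε, h⟩ := key s₀
    obtain ⟨s₁, hs₁, hs₁'⟩ := Metric.mem_closure_iff.1 hs₀.1 ε hε
    refine hs₀.2 (mem_interior.2 ⟨Metric.ball s₀ ε, fun s₂ hs₂ ↦ ?_, Metric.isOpen_ball,
      Metric.mem_ball_self hε⟩)
    rw [dist_comm, Real.dist_eq] at hs₁'
    exact hslice _ (h s₁ s₂ hs₁' hs₂ hs₁)
  have huniv : A = univ := hA.eq_univ ⟨0, h0⟩
  obtain ⟨ε, hε, h⟩ := key s
  exact h s s (by simpa using hε) (by simpa using hε) (huniv ▸ mem_univ s : s ∈ A)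

end FlowSystem

end Fermi
end

noncomputable section
namespace Fermi
open Filter Topology

/-! ### The geodesic flow and parallel transport as flow systems -/

section Systems

variable {d : ℕ} {M : Type*} [TopologicalSpace M] [ChartedSpace (EuclideanSpace ℝ (Fin d)) M]
  [IsManifold (𝓡 d) ∞ M] [RiemannianBundle (fun p : M ↦ TangentSpace (𝓡 d) p)]
  [IsContMDiffRiemannianBundle (𝓡 d) ∞ (EuclideanSpace ℝ (Fin d))
      (fun p : M ↦ TangentSpace (𝓡 d) p)]

/-- Differentiates the coordinate change of tangent vectors, (y,V) ↦ dτ_y(V). The second derivative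
of τ that appears is the inhomogeneous term in the law for Christoffel symbols. -/
lemma hasFDerivAt_fderiv_apply {E F X : Type*} [NormedAddCommGroup E] [NormedSpace ℝ E]
    [NormedAddCommGroup F] [NormedSpace ℝ F] [NormedAddCommGroup X] [NormedSpace ℝ X]
    {τ : E → F} {y V : X → E} {q : X} {y' V' : X →L[ℝ] E} (hτ : ContDiffAt ℝ 2 τ (y q))
    (hy : HasFDerivAt y y' q) (hV : HasFDerivAt V V' q) :
    ∃ L : X →L[ℝ] F, HasFDerivAt (fun z ↦ fderiv ℝ τ (y z) (V z)) L q ∧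
      ∀ u, L u = fderiv ℝ (fderiv ℝ τ) (y q) (y' u) (V q) + fderiv ℝ τ (y q) (V' u) := by
  have h1 : HasFDerivAt (fderiv ℝ τ) (fderiv ℝ (fderiv ℝ τ) (y q)) (y q) :=
    ((hτ.fderiv_right (m := 1) (by norm_num)).differentiableAt (by simp)).hasFDerivAt
  have h2 : HasFDerivAt (fun z ↦ fderiv ℝ τ (y z)) _ q := HasFDerivAt.comp (f := y) q h1 hy
  refine ⟨_, h2.clm_apply hV, fun u ↦ ?_⟩
  simp [add_comm]

variable (d M) in
/-- The geodesic equation. -/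
def geodesicSystem [T2Space M] : FlowSystem (TangentBundle (𝓡 d) M) M
    (EuclideanSpace ℝ (Fin d) × EuclideanSpace ℝ (Fin d)) where
  src x := {q | q.proj ∈ (extChartAt (𝓡 d) x).source}
  chart x q := (extChartAt (𝓡 d) x q.proj, chartVec x q.snd)
  inv x z := ⟨(extChartAt (𝓡 d) x).symm z.1, coordVec x z.1 z.2⟩
  field x z := (z.2, -christoffel x z.1 z.2 z.2)
  exists_mem q := ⟨q.proj, mem_extChartAt_source q.proj⟩
  inv_chart {x q} hq := mk_coordVec_chartVec hq q.snd
  eventually_mem {x x' q} hq hq' := by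
    obtain ⟨y, hy, hy', h⟩ := exists_mem_target_eq hq
    have h1 := eventually_mem_source_of_mem_target (x' := x') hy (hy' ▸ hq')
    rw [← h] at h1
    filter_upwards [continuousAt_fst.eventually h1] with z hz
    exact ⟨(extChartAt (𝓡 d) x).map_target hz.1, hz.2,
      Prod.ext ((extChartAt (𝓡 d) x).right_inv hz.1) (chartVec_coordVec hz.1 z.2)⟩
  contDiffAt_change {x x' q} hq hq' := by
    obtain ⟨y, hy, hy', h⟩ := exists_mem_target_eq hq
    have hq'' : (extChartAt (𝓡 d) x).symm y ∈ (extChartAt (𝓡 d) x').source := hy' ▸ hq'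
    have h1 := eventually_mem_source_of_mem_target (x' := x') hy hq''
    rw [h]
    have hτ := contDiffAt_coordChange hy hq''
    have h2 : ContDiffAt ℝ ∞ (fun z : EuclideanSpace ℝ (Fin d) × EuclideanSpace ℝ (Fin d) ↦
        ((extChartAt (𝓡 d) x' ∘ (extChartAt (𝓡 d) x).symm) z.1,
          fderiv ℝ (extChartAt (𝓡 d) x' ∘ (extChartAt (𝓡 d) x).symm) z.1 z.2))
        (y, chartVec x q.snd) := by
      refine (ContDiffAt.comp (f := Prod.fst) (y, chartVec x q.snd) hτ contDiffAt_fst).prodMk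
        (ContDiffAt.clm_apply ?_ contDiffAt_snd)
      exact ContDiffAt.comp (f := Prod.fst) (y, chartVec x q.snd)
        (hτ.fderiv_right (m := ∞) (by simp)) contDiffAt_fst
    refine h2.congr_of_eventuallyEq ?_
    filter_upwards [(continuousAt_fst (p := (y, chartVec x q.snd))).eventually h1] with z hz
    exact Prod.ext rfl (chartVec_eq_fderiv hz.1 hz.2 z.2)
  contDiffAt_field {x q} hq := by
    obtain ⟨y, hy, hy', h⟩ := exists_mem_target_eq hq
    rw [h]
    refine contDiffAt_snd.prodMk (ContDiffAt.neg ?_)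
    exact ContDiffAt.comp (f := fun z : EuclideanSpace ℝ (Fin d) × EuclideanSpace ℝ (Fin d) ↦
      (z.1, z.2, z.2)) (y, chartVec x q.snd) (contDiffAt_christoffel hy _ _) (by fun_prop)
  -- The second derivative of the coordinate change is cancelled by the inhomogeneous term of
  -- `christoffel_coordChange`.
  field_change {x x' q} hq hq' := by
    obtain ⟨y, hy, hy', h⟩ := exists_mem_target_eq hq
    have hq'' : (extChartAt (𝓡 d) x).symm y ∈ (extChartAt (𝓡 d) x').source := hy' ▸ hq'
    have h1 := eventually_mem_source_of_mem_target (x' := x') hy hq''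
    have hc := christoffel_coordChange hy hq''
    have hv := chartVec_change hq hq' q.snd
    rw [h] at hv
    have hx' : extChartAt (𝓡 d) x' q.proj
        = (extChartAt (𝓡 d) x' ∘ (extChartAt (𝓡 d) x).symm) y := by
      rw [Function.comp_apply, ← hy']
    rw [h, hv, hx']
    have hτ := contDiffAt_coordChange hy hq''
    set τ := extChartAt (𝓡 d) x' ∘ (extChartAt (𝓡 d) x).symm
    obtain ⟨L, hL, hLu⟩ := hasFDerivAt_fderiv_apply (τ := τ)
      (q := (y, chartVec x q.snd)) (hτ.of_le (by norm_cast)) hasFDerivAt_fst hasFDerivAt_snd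
    have h3 := ((HasFDerivAt.comp (f := Prod.fst) (y, chartVec x q.snd)
      (hτ.differentiableAt (by simp)).hasFDerivAt hasFDerivAt_fst).prodMk hL)
    have h4 : (fun z : EuclideanSpace ℝ (Fin d) × EuclideanSpace ℝ (Fin d) ↦
        (extChartAt (𝓡 d) x' ((extChartAt (𝓡 d) x).symm z.1), chartVec x' (coordVec x z.1 z.2)))
        =ᶠ[𝓝 (y, chartVec x q.snd)] fun z ↦ (τ z.1, fderiv ℝ τ z.1 z.2) := by
      filter_upwards [(continuousAt_fst (p := (y, chartVec x q.snd))).eventually h1] with z hz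
      exact Prod.ext rfl (chartVec_eq_fderiv hz.1 hz.2 z.2)
    rw [(h3.congr_of_eventuallyEq h4).fderiv]
    refine Prod.ext rfl ?_
    simp only [ContinuousLinearMap.prod_apply, hLu, ContinuousLinearMap.coe_fst',
      ContinuousLinearMap.coe_snd', map_neg, hc]
    abel
  -- Distinct tangent vectors differ in their base points, which M separates, or within one fibre,
  -- where their coordinates in a common chart differ.
  separated {q q'} hne := by
    by_cases hp : q.proj = q'.proj
    · obtain ⟨p, v⟩ := q
      obtain ⟨p', v'⟩ := q'
      obtain rfl : p = p' := hp
      have hvv : v ≠ v' := fun h ↦ hne (by rw [h])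
      have hpm := mem_extChartAt_source (I := 𝓡 d) p
      have hne' := (chartVec_injective hpm).ne hvv
      obtain ⟨A, B, hA, hB, hAv, hBv, hAB⟩ := t2_separation hne'
      refine ⟨p, p, hpm, hpm, Prod.snd ⁻¹' A, continuousAt_snd.preimage_mem_nhds (hA.mem_nhds hAv),
        Prod.snd ⁻¹' B, continuousAt_snd.preimage_mem_nhds (hB.mem_nhds hBv), ?_⟩
      intro r _ _ hrA hrB
      exact hAB.le_bot ⟨hrA, hrB⟩
    · obtain ⟨A, B, hA, hB, hAp, hBp, hAB⟩ := t2_separation hp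
      have key : ∀ (p : M) (v : EuclideanSpace ℝ (Fin d)) (A : Set M), IsOpen A → p ∈ A →
          {z : EuclideanSpace ℝ (Fin d) × EuclideanSpace ℝ (Fin d) |
            (extChartAt (𝓡 d) p).symm z.1 ∈ A} ∈ 𝓝 (extChartAt (𝓡 d) p p, v) := by
        intro p v A hA hp
        have h1 : ContinuousAt (extChartAt (𝓡 d) p).symm (extChartAt (𝓡 d) p p) :=
          continuousAt_extChartAt_symm p
        have h2 := h1.preimage_mem_nhds (hA.mem_nhds (by rwa [extChartAt_to_inv]))
        exact (continuousAt_fst (p := (extChartAt (𝓡 d) p p, v))).preimage_mem_nhds h2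
      refine ⟨q.proj, q'.proj, mem_extChartAt_source _, mem_extChartAt_source _, _,
        key q.proj _ A hA hAp, _, key q'.proj _ B hB hBp, ?_⟩
      intro r hr hr' hrA hrB
      have e1 : r.proj ∈ A := by
        have h : (extChartAt (𝓡 d) q.proj).symm (extChartAt (𝓡 d) q.proj r.proj) ∈ A := hrA
        rwa [(extChartAt (𝓡 d) q.proj).left_inv hr] at h
      have e2 : r.proj ∈ B := by
        have h : (extChartAt (𝓡 d) q'.proj).symm (extChartAt (𝓡 d) q'.proj r.proj) ∈ B := hrB
        rwa [(extChartAt (𝓡 d) q'.proj).left_inv hr'] at h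
      exact hAB.le_bot ⟨e1, e2⟩

omit [RiemannianBundle (fun p : M ↦ TangentSpace (𝓡 d) p)]
  [IsContMDiffRiemannianBundle (𝓡 d) ∞ (EuclideanSpace ℝ (Fin d))
      (fun p : M ↦ TangentSpace (𝓡 d) p)] in
lemma contDiffAt_extChartAt_comp {x : M} {c : ℝ → M} (hc : ContMDiff 𝓘(ℝ, ℝ) (𝓡 d) ∞ c) {t : ℝ}
    (ht : c t ∈ (extChartAt (𝓡 d) x).source) :
    ContDiffAt ℝ ∞ (fun s ↦ extChartAt (𝓡 d) x (c s)) t :=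
  ((contMDiffAt_extChartAt_of_mem ht).comp t hc.contMDiffAt).contDiffAt

/-- The equation of parallel transport along `c`. -/
def parallelSystem {c : ℝ → M} (hc : ContMDiff 𝓘(ℝ, ℝ) (𝓡 d) ∞ c) :
    FlowSystem (Σ t, TangentSpace (𝓡 d) (c t)) M (ℝ × EuclideanSpace ℝ (Fin d)) where
  src x := {q | c q.1 ∈ (extChartAt (𝓡 d) x).source}
  chart x q := (q.1, chartVec x q.2)
  inv x z := ⟨z.1, Function.invFun (chartVec x) z.2⟩
  -- Time is kept as a coordinate with derivative 1, which makes the time-dependent linear equation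
  -- autonomous.
  field x z := (1, -christoffel x (extChartAt (𝓡 d) x (c z.1)) (chartVec x (velocity c z.1)) z.2)
  exists_mem q := ⟨c q.1, mem_extChartAt_source (c q.1)⟩
  inv_chart {x q} hq := by
    dsimp only
    rw [Function.leftInverse_invFun (chartVec_injective hq)]
  eventually_mem {x x' q} hq hq' := by
    have h1 : ∀ᶠ t in 𝓝 q.1, c t ∈ (extChartAt (𝓡 d) x).source ∧
        c t ∈ (extChartAt (𝓡 d) x').source := hc.continuous.continuousAt.eventually
      (((isOpen_extChartAt_source x).inter (isOpen_extChartAt_source x')).mem_nhds ⟨hq, hq'⟩)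
    filter_upwards [(continuousAt_fst (p := (q.1, chartVec x q.2))).eventually h1] with z hz
    exact ⟨hz.1, hz.2, Prod.ext rfl (Function.rightInverse_invFun (chartVec_surjective hz.1) z.2)⟩
  contDiffAt_change {x x' q} hq hq' := by
    have h1 : ∀ᶠ t in 𝓝 q.1, c t ∈ (extChartAt (𝓡 d) x).source ∧
        c t ∈ (extChartAt (𝓡 d) x').source := hc.continuous.continuousAt.eventually
      (((isOpen_extChartAt_source x).inter (isOpen_extChartAt_source x')).mem_nhds ⟨hq, hq'⟩)
    have hτ := contDiffAt_coordChange (x' := x') ((extChartAt (𝓡 d) x).map_source hq)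
      (by rw [(extChartAt (𝓡 d) x).left_inv hq]; exact hq')
    have h2 : ContDiffAt ℝ ∞ (fun z : ℝ × EuclideanSpace ℝ (Fin d) ↦
        (z.1, fderiv ℝ (extChartAt (𝓡 d) x' ∘ (extChartAt (𝓡 d) x).symm)
          (extChartAt (𝓡 d) x (c z.1)) z.2)) (q.1, chartVec x q.2) := by
      refine contDiffAt_fst.prodMk (ContDiffAt.clm_apply ?_ contDiffAt_snd)
      refine ContDiffAt.comp (f := fun z : ℝ × EuclideanSpace ℝ (Fin d) ↦
        extChartAt (𝓡 d) x (c z.1)) (q.1, chartVec x q.2) (hτ.fderiv_right (m := ∞) (by simp)) ?_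
      exact ContDiffAt.comp (f := Prod.fst) (q.1, chartVec x q.2)
        (contDiffAt_extChartAt_comp (x := x) hc hq) contDiffAt_fst
    refine h2.congr_of_eventuallyEq ?_
    filter_upwards [(continuousAt_fst (p := (q.1, chartVec x q.2))).eventually h1] with z hz
    refine Prod.ext rfl ?_
    dsimp only
    rw [chartVec_change hz.1 hz.2, Function.rightInverse_invFun (chartVec_surjective hz.1)]
  contDiffAt_field {x q} hq := by
    have hm := (extChartAt (𝓡 d) x).map_source hq
    have hcx := contDiffAt_extChartAt_comp hc hq
    refine contDiffAt_const.prodMk (ContDiffAt.neg ?_)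
    -- The velocity is replaced by the derivative of the coordinates of c, for which smoothness is
    -- evident.
    have h1 : ContDiffAt ℝ ∞ (fun z : ℝ × EuclideanSpace ℝ (Fin d) ↦
        christoffel x (extChartAt (𝓡 d) x (c z.1))
          (deriv (fun s ↦ extChartAt (𝓡 d) x (c s)) z.1) z.2) (q.1, chartVec x q.2) := by
      refine ContDiffAt.comp (f := fun z : ℝ × EuclideanSpace ℝ (Fin d) ↦
        (extChartAt (𝓡 d) x (c z.1), deriv (fun s ↦ extChartAt (𝓡 d) x (c s)) z.1, z.2))
        (q.1, chartVec x q.2)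
        (contDiffAt_christoffel hm _ _) ?_
      refine (ContDiffAt.comp (f := Prod.fst) (q.1, chartVec x q.2) hcx contDiffAt_fst).prodMk
        (ContDiffAt.prodMk ?_ contDiffAt_snd)
      have hd : ContDiffAt ℝ ∞ (fun t ↦ deriv (fun s ↦ extChartAt (𝓡 d) x (c s)) t) q.1 :=
        (hcx.fderiv_right (m := ∞) (by simp)).clm_apply (contDiffAt_const (c := (1 : ℝ)))
      exact ContDiffAt.comp (f := Prod.fst) (q.1, chartVec x q.2) hd contDiffAt_fst
    refine h1.congr_of_eventuallyEq ?_
    have h2 : ∀ᶠ t in 𝓝 q.1, c t ∈ (extChartAt (𝓡 d) x).source :=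
      hc.continuous.continuousAt.eventually ((isOpen_extChartAt_source x).mem_nhds hq)
    filter_upwards [(continuousAt_fst (p := (q.1, chartVec x q.2))).eventually h2] with z hz
    rw [(hasDerivAt_extChartAt ((hc z.1).mdifferentiableAt (by simp)) hz).deriv]
  field_change {x x' q} hq hq' := by
    have h1 : ∀ᶠ t in 𝓝 q.1, c t ∈ (extChartAt (𝓡 d) x).source ∧
        c t ∈ (extChartAt (𝓡 d) x').source := hc.continuous.continuousAt.eventually
      (((isOpen_extChartAt_source x).inter (isOpen_extChartAt_source x')).mem_nhds ⟨hq, hq'⟩)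
    have hm := (extChartAt (𝓡 d) x).map_source hq
    have hm' : (extChartAt (𝓡 d) x).symm (extChartAt (𝓡 d) x (c q.1))
        ∈ (extChartAt (𝓡 d) x').source := by
      rw [(extChartAt (𝓡 d) x).left_inv hq]; exact hq'
    have hτ := contDiffAt_coordChange hm hm'
    have hcc := christoffel_coordChange hm hm'
    have hx' : extChartAt (𝓡 d) x' (c q.1) = (extChartAt (𝓡 d) x' ∘ (extChartAt (𝓡 d) x).symm)
        (extChartAt (𝓡 d) x (c q.1)) := by
      rw [Function.comp_apply, (extChartAt (𝓡 d) x).left_inv hq]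
    rw [chartVec_change hq hq' q.2, chartVec_change hq hq' (velocity c q.1), hx']
    have hdc := hasDerivAt_extChartAt ((hc q.1).mdifferentiableAt (by simp)) hq
    set τ := extChartAt (𝓡 d) x' ∘ (extChartAt (𝓡 d) x).symm
    obtain ⟨L, hL, hLu⟩ := hasFDerivAt_fderiv_apply (τ := τ)
      (y := fun z : ℝ × EuclideanSpace ℝ (Fin d) ↦ extChartAt (𝓡 d) x (c z.1))
      (q := (q.1, chartVec x q.2)) (hτ.of_le (by norm_cast))
      (HasFDerivAt.comp (f := Prod.fst) (q.1, chartVec x q.2) hdc.hasFDerivAt hasFDerivAt_fst)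
      hasFDerivAt_snd
    have h3 := (hasFDerivAt_fst (p := (q.1, chartVec x q.2))).prodMk hL
    have h4 : (fun z : ℝ × EuclideanSpace ℝ (Fin d) ↦
        (z.1, chartVec x' (Function.invFun (chartVec x (p := c z.1)) z.2)))
        =ᶠ[𝓝 (q.1, chartVec x q.2)] fun z ↦ (z.1, fderiv ℝ τ (extChartAt (𝓡 d) x (c z.1)) z.2) := by
      filter_upwards [(continuousAt_fst (p := (q.1, chartVec x q.2))).eventually h1] with z hz
      refine Prod.ext rfl ?_
      dsimp only
      rw [chartVec_change hz.1 hz.2, Function.rightInverse_invFun (chartVec_surjective hz.1)]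
    rw [(h3.congr_of_eventuallyEq h4).fderiv]
    refine Prod.ext rfl ?_
    simp only [ContinuousLinearMap.prod_apply, hLu, ContinuousLinearMap.comp_apply,
      ContinuousLinearMap.coe_fst', ContinuousLinearMap.coe_snd', map_neg, hcc,
      ContinuousLinearMap.toSpanSingleton_apply, one_smul]
    abel
  separated {q q'} hne := by
    by_cases hp : q.1 = q'.1
    · obtain ⟨t, v⟩ := q
      obtain ⟨t', v'⟩ := q'
      obtain rfl : t = t' := hp
      have hvv : v ≠ v' := fun h ↦ hne (by rw [h])
      have hpm := mem_extChartAt_source (I := 𝓡 d) (c t)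
      have hne' := (chartVec_injective hpm).ne hvv
      obtain ⟨A, B, hA, hB, hAv, hBv, hAB⟩ := t2_separation hne'
      refine ⟨c t, c t, hpm, hpm, Prod.snd ⁻¹' A,
        continuousAt_snd.preimage_mem_nhds (hA.mem_nhds hAv),
        Prod.snd ⁻¹' B, continuousAt_snd.preimage_mem_nhds (hB.mem_nhds hBv), ?_⟩
      intro r _ _ hrA hrB
      exact hAB.le_bot ⟨hrA, hrB⟩
    · obtain ⟨A, B, hA, hB, hAp, hBp, hAB⟩ := t2_separation hp
      refine ⟨c q.1, c q'.1, mem_extChartAt_source _, mem_extChartAt_source _, Prod.fst ⁻¹' A,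
        continuousAt_fst.preimage_mem_nhds (hA.mem_nhds hAp),
        Prod.fst ⁻¹' B, continuousAt_fst.preimage_mem_nhds (hB.mem_nhds hBp), ?_⟩
      intro r _ _ hrA hrB
      exact hAB.le_bot ⟨hrA, hrB⟩

end Systems

end Fermi
end

/-! ### Completeness of the geodesic and parallel systems -/

noncomputable section
namespace Fermi
open Filter Topology

section

variable {d : ℕ} {M : Type*} [TopologicalSpace M] [ChartedSpace (EuclideanSpace ℝ (Fin d)) M]
  [IsManifold (𝓡 d) ∞ M]

lemma contMDiffAt_of_extChartAt {Q : Type*} [NormedAddCommGroup Q] [NormedSpace ℝ Q] {n : ℕ∞}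
    {z : Q → M} {q : Q} {x : M} (h1 : ∀ᶠ r in 𝓝 q, z r ∈ (extChartAt (𝓡 d) x).source)
    (h2 : ContDiffAt ℝ n (fun r ↦ extChartAt (𝓡 d) x (z r)) q) :
    ContMDiffAt 𝓘(ℝ, Q) (𝓡 d) n z q := by
  have h3 := (contMDiffAt_extChartAt_symm (x := x)
    ((extChartAt (𝓡 d) x).map_source h1.self_of_nhds)).of_le (m := n) (by exact_mod_cast le_top)
  refine (ContMDiffAt.comp q h3 h2.contMDiffAt).congr_of_eventuallyEq ?_
  filter_upwards [h1] with r hr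
  exact ((extChartAt (𝓡 d) x).left_inv hr).symm

variable [RiemannianBundle (fun p : M ↦ TangentSpace (𝓡 d) p)]
  [IsContMDiffRiemannianBundle (𝓡 d) ∞ (EuclideanSpace ℝ (Fin d))
      (fun p : M ↦ TangentSpace (𝓡 d) p)]

/-- Near x the Riemannian norm controls the coordinate norm uniformly, so compactness of Euclidean
balls becomes available for bounded tangent vectors. -/
lemma eventually_norm_chartVec_le (x : M) :
    ∃ C > 0, ∀ᶠ p in 𝓝 x, ∀ v : TangentSpace (𝓡 d) p, ‖chartVec x v‖ ≤ C * ‖v‖ := by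
  have : IsManifold (𝓡 d) 1 M := .of_le (n := ∞) (by norm_cast)
  have : IsContinuousRiemannianBundle (EuclideanSpace ℝ (Fin d))
      (fun p : M ↦ TangentSpace (𝓡 d) p) := by
    obtain ⟨g, hg, h⟩ := IsContMDiffRiemannianBundle.exists_contMDiff (IB := 𝓡 d) (n := ∞)
      (F := EuclideanSpace ℝ (Fin d)) (E := fun p : M ↦ TangentSpace (𝓡 d) p)
    exact ⟨g, hg.continuous, h⟩
  obtain ⟨C, hC, h⟩ := eventually_norm_mfderiv_extChartAt_lt (𝓡 d) x
  refine ⟨C, hC, ?_⟩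
  filter_upwards [h] with p hp v
  let _ := normedAddCommGroupTangentSpaceVectorSpace (E := EuclideanSpace ℝ (Fin d))
    (extChartAt (𝓡 d) x p)
  let _ := normedSpaceTangentSpaceVectorSpace (E := EuclideanSpace ℝ (Fin d))
    (extChartAt (𝓡 d) x p)
  exact (ContinuousLinearMap.le_opNorm _ v).trans
    (mul_le_mul_of_nonneg_right hp.le (norm_nonneg v))

/-- A bounded family of tangent vectors with converging base points accumulates. -/
lemma exists_frequently_chartVec {l : Filter ℝ} [NeBot l] {γ : ℝ → M} {p : M}
    (hγ : Tendsto γ l (𝓝 p)) {V : ∀ t, TangentSpace (𝓡 d) (γ t)} {C : ℝ}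
    (hV : ∀ᶠ t in l, ‖V t‖ ≤ C) :
    ∃ v, ∀ B ∈ 𝓝 v, ∃ᶠ t in l, chartVec p (V t) ∈ B := by
  obtain ⟨K, hK, h⟩ := eventually_norm_chartVec_le (d := d) p
  have h1 : ∀ᶠ t in l, chartVec p (V t) ∈ Metric.closedBall 0 (K * C) := by
    filter_upwards [hγ.eventually h, hV] with t ht ht'
    rw [mem_closedBall_zero_iff]
    exact (ht _).trans (by gcongr)
  obtain ⟨v, -, hv⟩ := (isCompact_closedBall (0 : EuclideanSpace ℝ (Fin d))
    (K * C)).exists_mapClusterPt_of_frequently (f := fun t ↦ chartVec p (V t)) h1.frequently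
  exact ⟨v, fun B hB ↦ hv.frequently hB⟩

/-- The product rule for the covariant derivative along a curve, in a chart. -/
lemma hasDerivAt_inner_of_chart {x : M} {γ : ℝ → M} {V W : ∀ t, TangentSpace (𝓡 d) (γ t)} {t : ℝ}
    (hev : ∀ᶠ s in 𝓝 t, γ s ∈ (extChartAt (𝓡 d) x).source) {c' V' W' : EuclideanSpace ℝ (Fin d)}
    (hc : HasDerivAt (fun s ↦ extChartAt (𝓡 d) x (γ s)) c' t)
    (hV : HasDerivAt (fun s ↦ chartVec x (V s)) V' t)
    (hW : HasDerivAt (fun s ↦ chartVec x (W s)) W' t) :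
    HasDerivAt (fun s ↦ inner ℝ (V s) (W s))
      (metric x (extChartAt (𝓡 d) x (γ t))
          (V' + christoffel x (extChartAt (𝓡 d) x (γ t)) c' (chartVec x (V t))) (chartVec x (W t))
        + metric x (extChartAt (𝓡 d) x (γ t)) (chartVec x (V t))
          (W' + christoffel x (extChartAt (𝓡 d) x (γ t)) c' (chartVec x (W t)))) t := by
  refine ((isLeviCivita d x).hasDerivAt_inner hc hV hW
    ((extChartAt (𝓡 d) x).map_source hev.self_of_nhds)).congr_of_eventuallyEq ?_
  filter_upwards [hev] with s hs
  exact (metric_chartVec hs _ _).symm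

lemma hasDerivAt_inner_of_parallel {x : M} {γ : ℝ → M} {V W : ∀ t, TangentSpace (𝓡 d) (γ t)} {t : ℝ}
    (hev : ∀ᶠ s in 𝓝 t, γ s ∈ (extChartAt (𝓡 d) x).source) {c' : EuclideanSpace ℝ (Fin d)}
    (hc : HasDerivAt (fun s ↦ extChartAt (𝓡 d) x (γ s)) c' t)
    (hV : HasDerivAt (fun s ↦ chartVec x (V s))
      (-christoffel x (extChartAt (𝓡 d) x (γ t)) c' (chartVec x (V t))) t)
    (hW : HasDerivAt (fun s ↦ chartVec x (W s))
      (-christoffel x (extChartAt (𝓡 d) x (γ t)) c' (chartVec x (W t))) t) :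
    HasDerivAt (fun s ↦ inner ℝ (V s) (W s)) 0 t := by
  refine (hasDerivAt_inner_of_chart hev hc hV hW).congr_deriv ?_
  obtain ⟨B, hB⟩ := metric_bilinear d x (extChartAt (𝓡 d) x (γ t))
  simp only [neg_add_cancel, hB, map_zero, LinearMap.zero_apply, add_zero]

omit [IsManifold (𝓡 d) ∞ M] [IsContMDiffRiemannianBundle (𝓡 d) ∞ (EuclideanSpace ℝ (Fin d))
      (fun p : M ↦ TangentSpace (𝓡 d) p)] in
lemma exists_norm_eq_of_hasDerivAt {γ : ℝ → M} {V : ∀ t, TangentSpace (𝓡 d) (γ t)} {a b : ℝ}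
    (h : ∀ t ∈ Ioo a b, HasDerivAt (fun s ↦ inner ℝ (V s) (V s)) 0 t) :
    ∃ C, ∀ t ∈ Ioo a b, ‖V t‖ = C := by
  obtain ⟨C, hC⟩ := isOpen_Ioo.exists_is_const_of_deriv_eq_zero isPreconnected_Ioo
    (f := fun s ↦ inner ℝ (V s) (V s)) (fun t ht ↦ (h t ht).differentiableAt.differentiableWithinAt)
    (fun t ht ↦ (h t ht).deriv)
  refine ⟨√C, fun t ht ↦ ?_⟩
  rw [← hC t ht, real_inner_self_eq_norm_sq, Real.sqrt_sq (norm_nonneg _)]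

end

namespace FlowSystem

variable {X ι E : Type*} [NormedAddCommGroup E] [NormedSpace ℝ E] [FiniteDimensional ℝ E]
  {S : FlowSystem X ι E}

/-- By uniqueness the solution coincides near t with a curve of the local flow, which is C^n in
time. -/
lemma SmoothAt.of_eventually_isSol {n : ℕ} (hn : n ≠ 0) {f : ℝ → X} {t : ℝ}
    (hf : ∀ᶠ s in 𝓝 t, S.IsSol f s) : S.SmoothAt n f t := by
  obtain ⟨i, hi⟩ := S.exists_mem (f t)
  obtain ⟨δ, hδ, Ψ, hΨ⟩ := S.exists_localFlow hn hi
  have hτ : ∀ᶠ s in 𝓝 t, |s - t| < δ :=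
    (isOpen_lt (by fun_prop) continuous_const).mem_nhds (by simpa using hδ)
  have hd : dist (S.chart i (f t)) (S.chart i (f t)) < δ := by simpa using hδ
  have hg : ∀ᶠ s in 𝓝 t, S.IsSol (fun s ↦ S.inv i (Ψ (s - t, S.chart i (f t)))) s := by
    filter_upwards [hτ] with s hs
    exact IsSol.comp_add_const (c := -t) (hΨ (s - t) _ hs hd).2.2.2.2
  have heq := eventuallyEq_of_isSol hf hg (by
    rw [sub_self, (hΨ 0 _ (by simpa using hδ) hd).2.1, S.inv_chart hi])
  refine .of_chart hi (hf.self_of_nhds i hi).1 (ContDiffAt.congr_of_eventuallyEq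
    (f := fun s ↦ Ψ (s - t, S.chart i (f t))) ?_ ?_)
  · exact ContDiffAt.comp (f := fun s ↦ (s - t, S.chart i (f t))) t
      (hΨ _ _ (by simpa using hδ) hd).1 (by fun_prop)
  · filter_upwards [heq, hτ] with s hs hs'
    rw [hs, (hΨ _ _ hs' hd).2.2.2.1]

end FlowSystem

section

variable {d : ℕ} {M : Type*} [EMetricSpace M] [CompleteSpace M]
  [ChartedSpace (EuclideanSpace ℝ (Fin d)) M]
  [IsManifold (𝓡 d) ∞ M] [RiemannianBundle (fun p : M ↦ TangentSpace (𝓡 d) p)]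
  [IsContMDiffRiemannianBundle (𝓡 d) ∞ (EuclideanSpace ℝ (Fin d))
      (fun p : M ↦ TangentSpace (𝓡 d) p)] [IsRiemannianManifold (𝓡 d) M]

omit [IsManifold (𝓡 d) ∞ M] [IsContMDiffRiemannianBundle (𝓡 d) ∞ (EuclideanSpace ℝ (Fin d))
      (fun p : M ↦ TangentSpace (𝓡 d) p)] in
/-- A curve of bounded speed on a bounded interval converges at the end points. -/
lemma exists_tendsto_of_norm_velocity_le {γ : ℝ → M} {a b : ℝ}
    (hγ : ∀ t ∈ Ioo a b, ContMDiffAt 𝓘(ℝ, ℝ) (𝓡 d) 1 γ t) {C : ℝ}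
    (hC : ∀ t ∈ Ioo a b, ‖velocity (d := d) γ t‖ ≤ C) {e : ℝ} (hab : a < b) (he : e ∈ Icc a b) :
    ∃ p, Tendsto γ (𝓝[Ioo a b] e) (𝓝 p) := by
  -- The Riemannian distance is at most the length of the curve, hence at most C times the elapsed
  -- time. The curve is therefore Lipschitz, and completeness of M gives the limit.
  have hle : ∀ s ∈ Ioo a b, ∀ t ∈ Ioo a b, s ≤ t →
      edist (γ s) (γ t) ≤ C.toNNReal * edist s t := by
    intro s hs t ht hst
    have hsub : Icc s t ⊆ Ioo a b := fun r hr ↦ ⟨hs.1.trans_le hr.1, hr.2.trans_lt ht.2⟩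
    rw [IsRiemannianManifold.out (I := 𝓡 d) (γ s) (γ t)]
    refine (riemannianEDist_le_pathELength (fun r hr ↦ (hγ r (hsub hr)).contMDiffWithinAt)
      rfl rfl hst).trans ?_
    rw [pathELength_eq_lintegral_mfderiv_Icc]
    calc ∫⁻ r in Icc s t, ‖mfderiv 𝓘(ℝ, ℝ) (𝓡 d) γ r 1‖ₑ
        ≤ ∫⁻ _ in Icc s t, (C.toNNReal : ℝ≥0∞) := by
          refine setLIntegral_mono measurable_const fun r hr ↦ ?_
          rw [enorm_le_coe, ← NNReal.coe_le_coe, coe_nnnorm]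
          exact (hC r (hsub hr)).trans (Real.le_coe_toNNReal C)
      _ = C.toNNReal * edist s t := by
          rw [setLIntegral_const, Real.volume_Icc, edist_comm, edist_dist, Real.dist_eq,
            abs_of_nonneg (sub_nonneg.2 hst)]
  have hlip : LipschitzOnWith C.toNNReal γ (Ioo a b) := by
    intro s hs t ht
    rcases le_total s t with h | h
    · exact hle s hs t ht h
    · rw [edist_comm, edist_comm s]
      exact hle t ht s hs h
  have hne : (𝓝[Ioo a b] e).NeBot := by
    rw [← mem_closure_iff_nhdsWithin_neBot, closure_Ioo hab.ne]
    exact he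
  have hcauchy' : Cauchy (𝓝[Ioo a b] e) := cauchy_nhds.mono nhdsWithin_le_nhds
  have hcauchy : Cauchy (map γ (𝓝[Ioo a b] e)) :=
    hcauchy'.map_of_le hlip.uniformContinuousOn inf_le_right
  exact CompleteSpace.complete hcauchy

/-- Geodesics of a complete manifold do not stop. -/
lemma isComplete_geodesicSystem : (geodesicSystem d M).IsComplete := by
  intro f a b hab hf e he
  set γ : ℝ → M := fun t ↦ (f t).proj with hγ
  have hsmooth : ∀ t ∈ Ioo a b, ContMDiffAt 𝓘(ℝ, ℝ) (𝓡 d) 1 γ t := by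
    intro t ht
    have h1 := FlowSystem.SmoothAt.of_eventually_isSol (n := 1) one_ne_zero
      (eventually_of_mem (isOpen_Ioo.mem_nhds ht) hf)
    obtain ⟨h2, h3⟩ := h1 (γ t) (mem_extChartAt_source (γ t))
    exact contMDiffAt_of_extChartAt (n := 1) h2 h3.fst
  have hvel : ∀ t ∈ Ioo a b, velocity γ t = (f t).snd := by
    intro t ht
    have hm := mem_extChartAt_source (I := 𝓡 d) (γ t)
    have h1 := ((hf t ht) (γ t) hm).2.fst
    have h2 := hasDerivAt_extChartAt ((hsmooth t ht).mdifferentiableAt (by simp)) hm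
    exact chartVec_injective hm (h2.unique h1)
  -- The speed is constant because the velocity is parallel along its own curve.
  obtain ⟨C, hC⟩ := exists_norm_eq_of_hasDerivAt (γ := γ) (V := fun t ↦ (f t).snd) (a := a) (b := b)
    (fun t ht ↦ by
      obtain ⟨h1, h2⟩ := hf t ht (γ t) (mem_extChartAt_source (γ t))
      exact hasDerivAt_inner_of_parallel h1 h2.fst h2.snd h2.snd)
  have hne : (𝓝[Ioo a b] e).NeBot := by
    rw [← mem_closure_iff_nhdsWithin_neBot, closure_Ioo hab.ne]
    exact he
  obtain ⟨p, hp⟩ := exists_tendsto_of_norm_velocity_le hsmooth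
    (fun t ht ↦ by rw [hvel t ht, hC t ht]) hab he
  obtain ⟨v, hv⟩ := exists_frequently_chartVec hp (V := fun t ↦ (f t).snd) (C := C)
    (eventually_nhdsWithin_of_forall fun t ht ↦ (hC t ht).le)
  have hm := mem_extChartAt_source (I := 𝓡 d) p
  obtain ⟨v, rfl⟩ := chartVec_surjective hm v
  refine ⟨p, ⟨p, v⟩, hm, fun W hW ↦ ?_⟩
  obtain ⟨A, hA, B, hB, hAB⟩ := mem_nhds_prod_iff.1 hW
  refine ((hv B hB).and_eventually ((hp.eventually
    ((isOpen_extChartAt_source p).mem_nhds hm)).and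
    (hp.eventually ((continuousAt_extChartAt p).preimage_mem_nhds hA)))).mono ?_
  rintro t ⟨h1, h2, h3⟩
  exact ⟨h2, hAB ⟨h3, h1⟩⟩

-- The base curve is defined for all times and parallel vectors have constant norm, so accumulation
-- at the end points needs no completeness of M.
omit [CompleteSpace M] [IsRiemannianManifold (𝓡 d) M] in
lemma isComplete_parallelSystem {c : ℝ → M} (hc : ContMDiff 𝓘(ℝ, ℝ) (𝓡 d) ∞ c) :
    (parallelSystem hc).IsComplete := by
  intro f a b hab hf e he
  have hfst : ∀ t ∈ Ioo a b, HasDerivAt (fun s ↦ (f s).1) 1 t := fun t ht ↦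
    ((hf t ht) _ (mem_extChartAt_source (c (f t).1))).2.fst
  -- The time coordinate has derivative 1, so it is t + k and converges to e + k.
  obtain ⟨k, hk⟩ := isOpen_Ioo.exists_is_const_of_deriv_eq_zero isPreconnected_Ioo
    (f := fun s ↦ (f s).1 - s)
    (fun t ht ↦ ((hfst t ht).sub (hasDerivAt_id t)).differentiableAt.differentiableWithinAt)
    (fun t ht ↦ by simpa using ((hfst t ht).fun_sub (hasDerivAt_id' t)).deriv)
  have hk' : ∀ t ∈ Ioo a b, (f t).1 = t + k := fun t ht ↦ by linarith [hk t ht]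
  set γ : ℝ → M := fun t ↦ c (f t).1 with hγ
  obtain ⟨C, hC⟩ := exists_norm_eq_of_hasDerivAt (γ := γ) (V := fun t ↦ (f t).2) (a := a) (b := b)
    (fun t ht ↦ by
      obtain ⟨h1, h2⟩ := hf t ht (γ t) (mem_extChartAt_source (γ t))
      have h3 := (hasDerivAt_extChartAt ((hc (f t).1).mdifferentiableAt (by simp))
        (mem_extChartAt_source (γ t))).scomp t (hfst t ht)
      rw [one_smul] at h3
      exact hasDerivAt_inner_of_parallel h1 h3 h2.snd h2.snd)
  have hne : (𝓝[Ioo a b] e).NeBot := by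
    rw [← mem_closure_iff_nhdsWithin_neBot, closure_Ioo hab.ne]
    exact he
  have hlim : Tendsto (fun t ↦ (f t).1) (𝓝[Ioo a b] e) (𝓝 (e + k)) := by
    refine Tendsto.congr' (f₁ := fun t ↦ t + k) ?_ ?_
    · filter_upwards [self_mem_nhdsWithin] with t ht using (hk' t ht).symm
    · exact ((continuous_id.add continuous_const).tendsto e).mono_left nhdsWithin_le_nhds
  have hp : Tendsto γ (𝓝[Ioo a b] e) (𝓝 (c (e + k))) :=
    (hc.continuous.tendsto _).comp hlim
  obtain ⟨v, hv⟩ := exists_frequently_chartVec hp (V := fun t ↦ (f t).2) (C := C)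
    (eventually_nhdsWithin_of_forall fun t ht ↦ (hC t ht).le)
  have hm := mem_extChartAt_source (I := 𝓡 d) (c (e + k))
  obtain ⟨v, rfl⟩ := chartVec_surjective hm v
  refine ⟨c (e + k), ⟨e + k, v⟩, hm, fun W hW ↦ ?_⟩
  obtain ⟨A, hA, B, hB, hAB⟩ := mem_nhds_prod_iff.1 hW
  refine ((hv B hB).and_eventually ((hp.eventually
    ((isOpen_extChartAt_source _).mem_nhds hm)).and (hlim.eventually hA))).mono ?_
  rintro t ⟨h1, h2, h3⟩
  exact ⟨h2, hAB ⟨h3, h1⟩⟩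

end

end Fermi
end

/-! ### Geodesics, parallel transport and the exponential map -/

noncomputable section
namespace Fermi
open Filter Topology

section

variable {d : ℕ} {M : Type*} [TopologicalSpace M] [ChartedSpace (EuclideanSpace ℝ (Fin d)) M]
  [IsManifold (𝓡 d) ∞ M] [RiemannianBundle (fun p : M ↦ TangentSpace (𝓡 d) p)]
  [IsContMDiffRiemannianBundle (𝓡 d) ∞ (EuclideanSpace ℝ (Fin d))
      (fun p : M ↦ TangentSpace (𝓡 d) p)]

omit [IsManifold (𝓡 d) ∞ M] [RiemannianBundle (fun p : M ↦ TangentSpace (𝓡 d) p)]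
  [IsContMDiffRiemannianBundle (𝓡 d) ∞ (EuclideanSpace ℝ (Fin d))
      (fun p : M ↦ TangentSpace (𝓡 d) p)] in
lemma eventually_mem_source {x : M} {c : ℝ → M} {t : ℝ} (hc : ContinuousAt c t)
    (ht : c t ∈ (extChartAt (𝓡 d) x).source) : ∀ᶠ s in 𝓝 t, c s ∈ (extChartAt (𝓡 d) x).source :=
  hc.eventually ((isOpen_extChartAt_source x).mem_nhds ht)

lemma IsGeodesic.isSol [T2Space M] {γ : ℝ → M} (hγ : IsGeodesic d γ) (t : ℝ) :
    (geodesicSystem d M).IsSol (fun t ↦ ⟨γ t, velocity γ t⟩) t := fun x hx ↦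
  ⟨eventually_mem_source hγ.1.continuous.continuousAt hx,
    (hasDerivAt_extChartAt ((hγ.1 t).mdifferentiableAt (by simp)) hx).prodMk (hγ.2 x t hx)⟩

/-- Solutions of the geodesic equation are geodesics. -/
lemma isGeodesic_of_isSol [T2Space M] {f : ℝ → TangentBundle (𝓡 d) M}
    (hf : ∀ t, (geodesicSystem d M).IsSol f t) :
    IsGeodesic d (fun t ↦ (f t).proj) ∧
      ∀ t, f t = ⟨(f t).proj, velocity (fun t ↦ (f t).proj) t⟩ := by
  set γ : ℝ → M := fun t ↦ (f t).proj with hγ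
  have hsmooth : ContMDiff 𝓘(ℝ, ℝ) (𝓡 d) ∞ γ := by
    intro t
    have hm := mem_extChartAt_source (I := 𝓡 d) (γ t)
    refine contMDiffAt_of_extChartAt (n := ⊤) (hf t (γ t) hm).1 (contDiffAt_infty.2 fun n ↦ ?_)
    -- The order is raised by one because the flow lemmas assume a nonzero order.
    have h1 := FlowSystem.SmoothAt.of_eventually_isSol (n := n + 1) (by simp)
      (Eventually.of_forall (f := 𝓝 t) hf)
    exact (h1 (γ t) hm).2.fst.of_le (by norm_cast; omega)
  have hvel : ∀ t, velocity γ t = (f t).snd := by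
    intro t
    have hm := mem_extChartAt_source (I := 𝓡 d) (γ t)
    exact chartVec_injective hm ((hasDerivAt_extChartAt
      ((hsmooth t).mdifferentiableAt (by simp)) hm).unique ((hf t) (γ t) hm).2.fst)
  have heq : ∀ t, f t = ⟨γ t, velocity γ t⟩ := fun t ↦ by rw [hvel]
  refine ⟨⟨hsmooth, fun x t ht ↦ ?_⟩, heq⟩
  have h1 := (hf t x ht).2.snd
  simp only [hvel]
  exact h1

lemma IsParallel.isSol {c : ℝ → M} (hc : ContMDiff 𝓘(ℝ, ℝ) (𝓡 d) ∞ c)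
    {V : ∀ t, TangentSpace (𝓡 d) (c t)} (hV : IsParallel c V) (t : ℝ) :
    (parallelSystem hc).IsSol (fun t ↦ ⟨t, V t⟩) t := fun x hx ↦
  ⟨eventually_mem_source hc.continuous.continuousAt hx, (hasDerivAt_id' t).prodMk (hV x t hx)⟩

lemma IsParallel.ext {c : ℝ → M} (hc : ContMDiff 𝓘(ℝ, ℝ) (𝓡 d) ∞ c)
    {V W : ∀ t, TangentSpace (𝓡 d) (c t)} (hV : IsParallel c V) (hW : IsParallel c W)
    (h : V 0 = W 0) (t : ℝ) : V t = W t := by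
  have := congrFun (FlowSystem.eq_of_isSol (t₀ := 0) (hV.isSol hc) (hW.isSol hc) (by simp [h])) t
  simpa using this

lemma IsParallel.contDiffAt {c : ℝ → M} (hc : ContMDiff 𝓘(ℝ, ℝ) (𝓡 d) ∞ c)
    {V : ∀ t, TangentSpace (𝓡 d) (c t)} (hV : IsParallel c V) {x : M} {t : ℝ}
    (ht : c t ∈ (extChartAt (𝓡 d) x).source) {n : ℕ} (hn : n ≠ 0) :
    ContDiffAt ℝ n (fun s ↦ chartVec x (V s)) t :=
  ((FlowSystem.SmoothAt.of_eventually_isSol hn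
    (Eventually.of_forall (f := 𝓝 t) (hV.isSol hc))) x ht).2.snd

lemma IsParallel.add_smul {c : ℝ → M} {V W : ∀ t, TangentSpace (𝓡 d) (c t)}
    (hV : IsParallel c V) (hW : IsParallel c W) (r : ℝ) :
    IsParallel c (fun t ↦ V t + r • W t) := by
  intro x t ht
  obtain ⟨B, hB⟩ := christoffel_bilinear ((extChartAt (𝓡 d) x).map_source ht)
  have h1 := (hV x t ht).fun_add ((hW x t ht).const_smul r)
  simp only [chartVec_add, chartVec_smul, hB] at h1 ⊢
  refine h1.congr_deriv ?_
  simp only [map_add, map_smul]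
  module

/-- Parallel transport is isometric. -/
lemma IsParallel.inner_eq {c : ℝ → M} (hc : ContMDiff 𝓘(ℝ, ℝ) (𝓡 d) ∞ c)
    {V W : ∀ t, TangentSpace (𝓡 d) (c t)} (hV : IsParallel c V) (hW : IsParallel c W) (t : ℝ) :
    (inner ℝ (V t) (W t) : ℝ) = inner ℝ (V 0) (W 0) := by
  have h : ∀ t, HasDerivAt (fun s ↦ inner ℝ (V s) (W s)) 0 t := fun t ↦ by
    have hm := mem_extChartAt_source (I := 𝓡 d) (c t)
    exact hasDerivAt_inner_of_parallel (eventually_mem_source hc.continuous.continuousAt hm)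
      (hasDerivAt_extChartAt ((hc t).mdifferentiableAt (by simp)) hm) (hV _ t hm) (hW _ t hm)
  exact is_const_of_deriv_eq_zero (fun t ↦ (h t).differentiableAt) (fun t ↦ (h t).deriv) t 0

end

section

variable {d : ℕ} {M : Type*} [EMetricSpace M]
  [ChartedSpace (EuclideanSpace ℝ (Fin d)) M]
  [IsManifold (𝓡 d) ∞ M] [RiemannianBundle (fun p : M ↦ TangentSpace (𝓡 d) p)]
  [IsContMDiffRiemannianBundle (𝓡 d) ∞ (EuclideanSpace ℝ (Fin d))
      (fun p : M ↦ TangentSpace (𝓡 d) p)]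

/-- A global solution of `parallelSystem` starting at time 0 has time coordinate t at time t, hence
is a vector field along c. -/
lemma exists_isParallel {c : ℝ → M} (hc : ContMDiff 𝓘(ℝ, ℝ) (𝓡 d) ∞ c)
    (v : TangentSpace (𝓡 d) (c 0)) :
    ∃ V : ∀ t, TangentSpace (𝓡 d) (c t), IsParallel c V ∧ V 0 = v := by
  obtain ⟨f, h0, hf⟩ := (isComplete_parallelSystem hc).exists_isSol ⟨0, v⟩
  have hfst : ∀ t, HasDerivAt (fun s ↦ (f s).1) 1 t := fun t ↦
    ((hf t) _ (mem_extChartAt_source (c (f t).1))).2.fst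
  have hfst' : ∀ t, (f t).1 = t := by
    intro t
    have h1 := is_const_of_deriv_eq_zero (f := fun s ↦ (f s).1 - s)
      (fun t ↦ ((hfst t).fun_sub (hasDerivAt_id' t)).differentiableAt)
      (fun t ↦ by simpa using ((hfst t).fun_sub (hasDerivAt_id' t)).deriv) t 0
    simp only [h0] at h1
    linarith
  have hex : ∀ t, ∃ v : TangentSpace (𝓡 d) (c t), f t = ⟨t, v⟩ := by
    intro t
    have h1 := hfst' t
    generalize f t = q at h1 ⊢
    obtain ⟨s, v⟩ := q
    obtain rfl : s = t := h1
    exact ⟨v, rfl⟩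
  choose V hV using hex
  obtain rfl : f = fun t ↦ ⟨t, V t⟩ := funext hV
  exact ⟨V, fun x t ht ↦ (hf t x ht).2.snd, by simpa using h0⟩

lemma isParallel_parallelTransport {c : ℝ → M} (hc : ContMDiff 𝓘(ℝ, ℝ) (𝓡 d) ∞ c)
    (v : TangentSpace (𝓡 d) (c 0)) : IsParallel c (fun u ↦ parallelTransport c u v) := by
  have h := exists_isParallel hc v
  have : (fun u ↦ parallelTransport c u v) = h.choose := funext fun u ↦ dif_pos h
  rw [this]
  exact h.choose_spec.1

lemma parallelTransport_zero {c : ℝ → M} (hc : ContMDiff 𝓘(ℝ, ℝ) (𝓡 d) ∞ c)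
    (v : TangentSpace (𝓡 d) (c 0)) : parallelTransport c 0 v = v := by
  have h := exists_isParallel hc v
  exact (dif_pos h : parallelTransport c 0 v = h.choose 0).trans h.choose_spec.2

lemma parallelTransport_add_smul {c : ℝ → M} (hc : ContMDiff 𝓘(ℝ, ℝ) (𝓡 d) ∞ c)
    (v w : TangentSpace (𝓡 d) (c 0)) (r u : ℝ) : parallelTransport c u (v + r • w)
      = parallelTransport c u v + r • parallelTransport c u w :=
  IsParallel.ext hc (isParallel_parallelTransport hc _)
    ((isParallel_parallelTransport hc v).add_smul (isParallel_parallelTransport hc w) r)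
    (by simp only [parallelTransport_zero hc]) u

variable (d) in
/-- Parallel transport as a linear map. -/
def parallelTransportₗ {c : ℝ → M} (hc : ContMDiff 𝓘(ℝ, ℝ) (𝓡 d) ∞ c) (u : ℝ) :
    TangentSpace (𝓡 d) (c 0) →ₗ[ℝ] TangentSpace (𝓡 d) (c u) where
  toFun := parallelTransport c u
  map_add' v w := by simpa using parallelTransport_add_smul hc v w 1 u
  map_smul' r v := by
    -- Applied to zero vectors, additivity forces the transport of 0 to be 0; homogeneity then
    -- follows.
    have h0 := parallelTransport_add_smul hc (0 : TangentSpace (𝓡 d) (c 0)) 0 1 u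
    have h1 := parallelTransport_add_smul hc 0 v r u
    rw [zero_add] at h1
    rw [smul_zero, zero_add, one_smul] at h0
    rw [h1, left_eq_add.1 h0, zero_add]
    rfl

lemma inner_parallelTransport {c : ℝ → M} (hc : ContMDiff 𝓘(ℝ, ℝ) (𝓡 d) ∞ c)
    (v w : TangentSpace (𝓡 d) (c 0)) (u : ℝ) :
    (inner ℝ (parallelTransport c u v) (parallelTransport c u w) : ℝ) = inner ℝ v w := by
  rw [(isParallel_parallelTransport hc v).inner_eq hc (isParallel_parallelTransport hc w),
    parallelTransport_zero hc, parallelTransport_zero hc]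

variable [CompleteSpace M] [IsRiemannianManifold (𝓡 d) M]

/-- The geodesic flow. -/
def geodesicFlow (q : TangentBundle (𝓡 d) M) : ℝ → TangentBundle (𝓡 d) M :=
  (isComplete_geodesicSystem.exists_isSol q).choose

lemma geodesicFlow_zero (q : TangentBundle (𝓡 d) M) : geodesicFlow q 0 = q :=
  (isComplete_geodesicSystem.exists_isSol q).choose_spec.1

lemma isSol_geodesicFlow (q : TangentBundle (𝓡 d) M) (t : ℝ) :
    (geodesicSystem d M).IsSol (geodesicFlow q) t :=
  (isComplete_geodesicSystem.exists_isSol q).choose_spec.2 t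

lemma IsGeodesic.eq_geodesicFlow {γ : ℝ → M} (hγ : IsGeodesic d γ) (t : ℝ) :
    (⟨γ t, velocity γ t⟩ : TangentBundle (𝓡 d) M) = geodesicFlow ⟨γ 0, velocity γ 0⟩ t :=
  congrFun (FlowSystem.eq_of_isSol (t₀ := 0) hγ.isSol (isSol_geodesicFlow _)
    (geodesicFlow_zero _).symm) t

/-- The geodesic chosen in the definition of `expMap` is, by uniqueness, the one given by the flow.
-/
lemma expMap_eq (p : M) (v : TangentSpace (𝓡 d) p) : expMap p v = (geodesicFlow ⟨p, v⟩ 1).proj := by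
  obtain ⟨h1, h2⟩ := isGeodesic_of_isSol (isSol_geodesicFlow (⟨p, v⟩ : TangentBundle (𝓡 d) M))
  have hex : ∃ γ : ℝ → M, IsGeodesic d γ ∧
      (⟨γ 0, velocity γ 0⟩ : TangentBundle (𝓡 d) M) = ⟨p, v⟩ :=
    ⟨_, h1, (h2 0).symm.trans (geodesicFlow_zero _)⟩
  have h3 : expMap p v = hex.choose 1 := dif_pos hex
  have h4 := hex.choose_spec.1.eq_geodesicFlow 1
  rw [hex.choose_spec.2] at h4
  rw [h3]
  exact congrArg TotalSpace.proj h4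

/-- A geodesic run at r times the speed is again a geodesic, since the acceleration term is
quadratic in the velocity. -/
lemma geodesicFlow_smul (p : M) (v : TangentSpace (𝓡 d) p) (r t : ℝ) :
    geodesicFlow ⟨p, r • v⟩ t
      = ⟨(geodesicFlow ⟨p, v⟩ (r * t)).proj, r • (geodesicFlow ⟨p, v⟩ (r * t)).snd⟩ := by
  refine congrFun (FlowSystem.eq_of_isSol (S := geodesicSystem d M) (t₀ := 0)
    (f := geodesicFlow ⟨p, r • v⟩)
    (g := fun t ↦ ⟨(geodesicFlow ⟨p, v⟩ (r * t)).proj, r • (geodesicFlow ⟨p, v⟩ (r * t)).snd⟩)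
    (isSol_geodesicFlow _) (fun t x hx ↦ ?_) ?_) t
  · obtain ⟨h1, h2⟩ := isSol_geodesicFlow (⟨p, v⟩ : TangentBundle (𝓡 d) M) (r * t) x hx
    have hr : HasDerivAt (fun t ↦ r * t) r t := by simpa using (hasDerivAt_id t).const_mul r
    refine ⟨hr.continuousAt.eventually h1, ?_⟩
    have h2a : HasDerivAt (fun t ↦ extChartAt (𝓡 d) x (geodesicFlow ⟨p, v⟩ t).proj)
      (chartVec x (geodesicFlow ⟨p, v⟩ (r * t)).snd) (r * t) := h2.fst
    have h2b : HasDerivAt (fun t ↦ chartVec x (geodesicFlow ⟨p, v⟩ t).snd)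
      (-christoffel x (extChartAt (𝓡 d) x (geodesicFlow ⟨p, v⟩ (r * t)).proj)
        (chartVec x (geodesicFlow ⟨p, v⟩ (r * t)).snd)
        (chartVec x (geodesicFlow ⟨p, v⟩ (r * t)).snd)) (r * t) := h2.snd
    have h3 := h2a.scomp t hr
    have h4 := (h2b.scomp t hr).const_smul r
    have h5 := h3.prodMk h4
    refine (h5.congr_deriv ?_).congr_of_eventuallyEq (Eventually.of_forall fun s ↦ ?_)
    · obtain ⟨B, hB⟩ := christoffel_bilinear ((extChartAt (𝓡 d) x).map_source hx)
      dsimp only at hx hB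
      simp only [geodesicSystem, chartVec_smul, hB, map_smul, LinearMap.smul_apply, smul_neg]
    · exact Prod.ext rfl (chartVec_smul x r _)
  · rw [geodesicFlow_zero, mul_zero, geodesicFlow_zero]

lemma expMap_smul (p : M) (v : TangentSpace (𝓡 d) p) (r : ℝ) :
    expMap p (r • v) = (geodesicFlow ⟨p, v⟩ r).proj := by
  rw [expMap_eq, geodesicFlow_smul, mul_one]

/-! ### The normal exponential map -/

/-- The parametrization of the normal bundle of `φ` by `ℝ × ℝ^(d-1)`. -/
def normalVec (φ : ℝ → M) (L : EuclideanSpace ℝ (Fin (d - 1)) →ₗᵢ[ℝ] TangentSpace (𝓡 d) (φ 0))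
    (q : ℝ × EuclideanSpace ℝ (Fin (d - 1))) : TangentBundle (𝓡 d) M :=
  ⟨φ q.1, parallelTransport φ q.1 (L q.2)⟩

lemma normalExp_eq (φ : ℝ → M)
    (L : EuclideanSpace ℝ (Fin (d - 1)) →ₗᵢ[ℝ] TangentSpace (𝓡 d) (φ 0))
    (q : ℝ × EuclideanSpace ℝ (Fin (d - 1))) :
    normalExp φ L q = (geodesicFlow (normalVec φ L q) 1).proj :=
  expMap_eq _ _

lemma normalExp_smul {φ : ℝ → M} (hφ : ContMDiff 𝓘(ℝ, ℝ) (𝓡 d) ∞ φ)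
    (L : EuclideanSpace ℝ (Fin (d - 1)) →ₗᵢ[ℝ] TangentSpace (𝓡 d) (φ 0))
    (u s : ℝ) (w : EuclideanSpace ℝ (Fin (d - 1))) :
    normalExp φ L (u, s • w) = (geodesicFlow (normalVec φ L (u, w)) s).proj := by
  have h : parallelTransport φ u (L (s • w)) = s • parallelTransport φ u (L w) := by
    rw [map_smul]
    exact map_smul (parallelTransportₗ d hφ u) s (L w)
  rw [normalExp, h, expMap_smul]
  rfl

-- Parallel transport is linear, so the normal vector is a combination of finitely many parallel
-- fields, each smooth along φ, with the coordinates of w as coefficients.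
omit [CompleteSpace M] [IsRiemannianManifold (𝓡 d) M] in
lemma smoothAt_normalVec {φ : ℝ → M} (hφ : ContMDiff 𝓘(ℝ, ℝ) (𝓡 d) ∞ φ)
    (L : EuclideanSpace ℝ (Fin (d - 1)) →ₗᵢ[ℝ] TangentSpace (𝓡 d) (φ 0)) {n : ℕ} (hn : n ≠ 0)
    (q : ℝ × EuclideanSpace ℝ (Fin (d - 1))) :
    (geodesicSystem d M).SmoothAt n (normalVec φ L) q := by
  intro x hx
  have hx' : φ q.1 ∈ (extChartAt (𝓡 d) x).source := hx
  refine ⟨continuousAt_fst.eventually (eventually_mem_source hφ.continuous.continuousAt hx'), ?_⟩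
  refine ContDiffAt.prodMk (ContDiffAt.comp (f := Prod.fst) q
    ((contDiffAt_extChartAt_comp hφ hx').of_le (by exact_mod_cast le_top)) contDiffAt_fst) ?_
  have h : ∀ u w, chartVec x (parallelTransport φ u (L w))
      = ∑ j, w j • chartVec x (parallelTransport φ u (L (EuclideanSpace.single j 1))) := by
    intro u w
    let T : EuclideanSpace ℝ (Fin (d - 1)) →ₗ[ℝ] EuclideanSpace ℝ (Fin d) :=
      { toFun := fun w ↦ chartVec x (parallelTransportₗ d hφ u (L w))
        map_add' := fun v w ↦ by simp only [map_add, chartVec_add]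
        map_smul' := fun r w ↦ by simp only [map_smul, chartVec_smul]; rfl }
    change T w = ∑ j, w j • T (EuclideanSpace.single j 1)
    conv_lhs => rw [← (EuclideanSpace.basisFun (Fin (d - 1)) ℝ).sum_repr w]
    simp
  refine ContDiffAt.congr_of_eventuallyEq (f := fun q : ℝ × EuclideanSpace ℝ (Fin (d - 1)) ↦
    ∑ j, q.2 j • chartVec x (parallelTransport φ q.1 (L (EuclideanSpace.single j 1)))) ?_
    (Eventually.of_forall fun q ↦ h q.1 q.2)
  have hcoord : ∀ j, ContDiffAt ℝ n (fun q : ℝ × EuclideanSpace ℝ (Fin (d - 1)) ↦ q.2 j) q :=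
    fun j ↦ by fun_prop
  refine ContDiffAt.sum fun j _ ↦ ContDiffAt.smul (hcoord j) ?_
  exact ContDiffAt.comp (f := Prod.fst) q
    ((isParallel_parallelTransport hφ (L (EuclideanSpace.single j 1))).contDiffAt hφ hx' hn)
    contDiffAt_fst

/-- The geodesics normal to `φ` depend smoothly on the initial vector and on time. -/
lemma smoothAt_geodesicFlow_normalVec {φ : ℝ → M} (hφ : ContMDiff 𝓘(ℝ, ℝ) (𝓡 d) ∞ φ)
    (L : EuclideanSpace ℝ (Fin (d - 1)) →ₗᵢ[ℝ] TangentSpace (𝓡 d) (φ 0)) {n : ℕ} (hn : n ≠ 0)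
    (s : ℝ) (q : ℝ × EuclideanSpace ℝ (Fin (d - 1))) :
    (geodesicSystem d M).SmoothAt n
      (fun z : ℝ × ℝ × EuclideanSpace ℝ (Fin (d - 1)) ↦ geodesicFlow (normalVec φ L z.2) z.1)
      (s, q) := by
  refine FlowSystem.smoothAt_of_isSol hn (f := fun q ↦ geodesicFlow (normalVec φ L q))
    (fun q t ↦ isSol_geodesicFlow _ t) ?_ s
  simp only [geodesicFlow_zero]
  exact smoothAt_normalVec hφ L hn q

end

end Fermi
end

noncomputable section
namespace Fermi
open Filter Topology

/-! ### Jacobi fields along the normal geodesics -/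

lemma chartVec_mfderiv {d : ℕ} {M : Type*} [TopologicalSpace M]
    [ChartedSpace (EuclideanSpace ℝ (Fin d)) M] [IsManifold (𝓡 d) ∞ M] {Q : Type*}
    [NormedAddCommGroup Q] [NormedSpace ℝ Q] {z : Q → M} {q : Q}
    (hz : MDifferentiableAt 𝓘(ℝ, Q) (𝓡 d) z q) {x : M}
    (hq : z q ∈ (extChartAt (𝓡 d) x).source) (a : Q) :
    chartVec x (mfderiv 𝓘(ℝ, Q) (𝓡 d) z q a : TangentSpace (𝓡 d) (z q))
      = fderiv ℝ (fun q ↦ extChartAt (𝓡 d) x (z q)) q a := by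
  have h := mfderiv_comp q
    ((contMDiffAt_extChartAt_of_mem hq).mdifferentiableAt (by simp)) hz
  rw [← mfderiv_eq_fderiv]
  exact (DFunLike.congr_fun h a).symm

section

variable {d : ℕ} {M : Type*} [EMetricSpace M] [CompleteSpace M]
  [ChartedSpace (EuclideanSpace ℝ (Fin d)) M]
  [IsManifold (𝓡 d) ∞ M] [RiemannianBundle (fun p : M ↦ TangentSpace (𝓡 d) p)]
  [IsContMDiffRiemannianBundle (𝓡 d) ∞ (EuclideanSpace ℝ (Fin d))
      (fun p : M ↦ TangentSpace (𝓡 d) p)] [IsRiemannianManifold (𝓡 d) M]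
  {φ : ℝ → M} {L : EuclideanSpace ℝ (Fin (d - 1)) →ₗᵢ[ℝ] TangentSpace (𝓡 d) (φ 0)}

/-- The point at time `z.1` on the geodesic normal to `φ` with initial vector `z.2`. -/
def normalGeodesic (φ : ℝ → M)
    (L : EuclideanSpace ℝ (Fin (d - 1)) →ₗᵢ[ℝ] TangentSpace (𝓡 d) (φ 0))
    (z : ℝ × ℝ × EuclideanSpace ℝ (Fin (d - 1))) : M :=
  (geodesicFlow (normalVec φ L z.2) z.1).proj

/-- The velocity of the normal geodesics. -/
def normalVelocity (φ : ℝ → M)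
    (L : EuclideanSpace ℝ (Fin (d - 1)) →ₗᵢ[ℝ] TangentSpace (𝓡 d) (φ 0))
    (z : ℝ × ℝ × EuclideanSpace ℝ (Fin (d - 1))) : TangentSpace (𝓡 d) (normalGeodesic φ L z) :=
  (geodesicFlow (normalVec φ L z.2) z.1).snd

lemma eventually_normalGeodesic_mem (hφ : ContMDiff 𝓘(ℝ, ℝ) (𝓡 d) ∞ φ) {x : M}
    {z : ℝ × ℝ × EuclideanSpace ℝ (Fin (d - 1))}
    (hz : normalGeodesic φ L z ∈ (extChartAt (𝓡 d) x).source) :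
    ∀ᶠ z in 𝓝 z, normalGeodesic φ L z ∈ (extChartAt (𝓡 d) x).source :=
  (smoothAt_geodesicFlow_normalVec hφ L one_ne_zero z.1 z.2 x hz).1

lemma contDiffAt_normalGeodesic (hφ : ContMDiff 𝓘(ℝ, ℝ) (𝓡 d) ∞ φ) {x : M}
    {z : ℝ × ℝ × EuclideanSpace ℝ (Fin (d - 1))}
    (hz : normalGeodesic φ L z ∈ (extChartAt (𝓡 d) x).source) {n : ℕ} (hn : n ≠ 0) :
    ContDiffAt ℝ n (fun z ↦ extChartAt (𝓡 d) x (normalGeodesic φ L z)) z :=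
  (smoothAt_geodesicFlow_normalVec hφ L hn z.1 z.2 x hz).2.fst

lemma contDiffAt_normalVelocity (hφ : ContMDiff 𝓘(ℝ, ℝ) (𝓡 d) ∞ φ) {x : M}
    {z : ℝ × ℝ × EuclideanSpace ℝ (Fin (d - 1))}
    (hz : normalGeodesic φ L z ∈ (extChartAt (𝓡 d) x).source) {n : ℕ} (hn : n ≠ 0) :
    ContDiffAt ℝ n (fun z ↦ chartVec x (normalVelocity φ L z)) z :=
  (smoothAt_geodesicFlow_normalVec hφ L hn z.1 z.2 x hz).2.snd

lemma hasDerivAt_normalGeodesic {x : M} {z : ℝ × ℝ × EuclideanSpace ℝ (Fin (d - 1))}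
    (hz : normalGeodesic φ L z ∈ (extChartAt (𝓡 d) x).source) :
    HasDerivAt (fun s ↦ extChartAt (𝓡 d) x (normalGeodesic φ L (s, z.2)))
      (chartVec x (normalVelocity φ L z)) z.1 :=
  (isSol_geodesicFlow (normalVec φ L z.2) z.1 x hz).2.fst

lemma hasDerivAt_normalVelocity {x : M} {z : ℝ × ℝ × EuclideanSpace ℝ (Fin (d - 1))}
    (hz : normalGeodesic φ L z ∈ (extChartAt (𝓡 d) x).source) :
    HasDerivAt (fun s ↦ chartVec x (normalVelocity φ L (s, z.2)))
      (-christoffel x (extChartAt (𝓡 d) x (normalGeodesic φ L z))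
        (chartVec x (normalVelocity φ L z)) (chartVec x (normalVelocity φ L z))) z.1 :=
  (isSol_geodesicFlow (normalVec φ L z.2) z.1 x hz).2.snd

lemma mdifferentiableAt_normalGeodesic (hφ : ContMDiff 𝓘(ℝ, ℝ) (𝓡 d) ∞ φ)
    (z : ℝ × ℝ × EuclideanSpace ℝ (Fin (d - 1))) :
    MDifferentiableAt 𝓘(ℝ, ℝ × ℝ × EuclideanSpace ℝ (Fin (d - 1))) (𝓡 d)
      (normalGeodesic φ L) z := by
  have hm := mem_extChartAt_source (I := 𝓡 d) (normalGeodesic φ L z)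
  exact (contMDiffAt_of_extChartAt (n := 1) (eventually_normalGeodesic_mem hφ hm)
    (contDiffAt_normalGeodesic hφ hm one_ne_zero)).mdifferentiableAt (by simp)

/-- The variation field of the normal geodesics in the direction `a`. -/
def jacobiField (φ : ℝ → M)
    (L : EuclideanSpace ℝ (Fin (d - 1)) →ₗᵢ[ℝ] TangentSpace (𝓡 d) (φ 0))
    (q a : ℝ × EuclideanSpace ℝ (Fin (d - 1))) (s : ℝ) :
    TangentSpace (𝓡 d) (normalGeodesic φ L (s, q)) :=
  mfderiv 𝓘(ℝ, ℝ × ℝ × EuclideanSpace ℝ (Fin (d - 1))) (𝓡 d) (normalGeodesic φ L) (s, q) (0, a)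

lemma chartVec_jacobiField (hφ : ContMDiff 𝓘(ℝ, ℝ) (𝓡 d) ∞ φ) {x : M} {s : ℝ}
    {q : ℝ × EuclideanSpace ℝ (Fin (d - 1))}
    (hs : normalGeodesic φ L (s, q) ∈ (extChartAt (𝓡 d) x).source)
    (a : ℝ × EuclideanSpace ℝ (Fin (d - 1))) :
    chartVec x (jacobiField φ L q a s)
      = fderiv ℝ (fun z ↦ extChartAt (𝓡 d) x (normalGeodesic φ L z)) (s, q) (0, a) :=
  chartVec_mfderiv (mdifferentiableAt_normalGeodesic hφ (s, q)) hs (0, a)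

lemma isGeodesic_normalGeodesic (q : ℝ × EuclideanSpace ℝ (Fin (d - 1))) :
    IsGeodesic d (fun s ↦ normalGeodesic φ L (s, q)) :=
  (isGeodesic_of_isSol (isSol_geodesicFlow (normalVec φ L q))).1

lemma isParallel_normalVelocity (q : ℝ × EuclideanSpace ℝ (Fin (d - 1))) :
    IsParallel (fun s ↦ normalGeodesic φ L (s, q)) (fun s ↦ normalVelocity φ L (s, q)) := by
  have h := isGeodesic_of_isSol (isSol_geodesicFlow (normalVec φ L q))
  have h2 : velocity (fun s ↦ normalGeodesic φ L (s, q)) = fun s ↦ normalVelocity φ L (s, q) := by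
    funext s
    have hm := mem_extChartAt_source (I := 𝓡 d) (normalGeodesic φ L (s, q))
    exact chartVec_injective hm ((hasDerivAt_extChartAt
      ((h.1.1 s).mdifferentiableAt (by simp)) hm).unique
        (hasDerivAt_normalGeodesic (z := (s, q)) hm))
  rw [← h2]
  exact h.1.2

/-- The covariant derivative of a Jacobi field, in the chart centred at `x`. -/
def jacobiDeriv (φ : ℝ → M)
    (L : EuclideanSpace ℝ (Fin (d - 1)) →ₗᵢ[ℝ] TangentSpace (𝓡 d) (φ 0)) (x : M)
    (q a : ℝ × EuclideanSpace ℝ (Fin (d - 1))) (s : ℝ) : EuclideanSpace ℝ (Fin d) :=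
  fderiv ℝ (fun z ↦ chartVec x (normalVelocity φ L z)) (s, q) (0, a)
    + christoffel x (extChartAt (𝓡 d) x (normalGeodesic φ L (s, q)))
        (chartVec x (normalVelocity φ L (s, q))) (chartVec x (jacobiField φ L q a s))

lemma eventually_normalGeodesic_mem_left (hφ : ContMDiff 𝓘(ℝ, ℝ) (𝓡 d) ∞ φ) {x : M} {s : ℝ}
    {q : ℝ × EuclideanSpace ℝ (Fin (d - 1))}
    (hs : normalGeodesic φ L (s, q) ∈ (extChartAt (𝓡 d) x).source) :
    ∀ᶠ s in 𝓝 s, normalGeodesic φ L (s, q) ∈ (extChartAt (𝓡 d) x).source :=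
  (Continuous.tendsto (by fun_prop : Continuous fun s : ℝ ↦ (s, q)) s).eventually
    (eventually_normalGeodesic_mem hφ hs)

/-- Mixed partial derivatives commute: the time derivative of the variation of position is the
variation of velocity. -/
lemma hasDerivAt_chartVec_jacobiField (hφ : ContMDiff 𝓘(ℝ, ℝ) (𝓡 d) ∞ φ) {x : M} {s : ℝ}
    {q : ℝ × EuclideanSpace ℝ (Fin (d - 1))}
    (hs : normalGeodesic φ L (s, q) ∈ (extChartAt (𝓡 d) x).source)
    (a : ℝ × EuclideanSpace ℝ (Fin (d - 1))) :
    HasDerivAt (fun s ↦ chartVec x (jacobiField φ L q a s))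
      (fderiv ℝ (fun z ↦ chartVec x (normalVelocity φ L z)) (s, q) (0, a)) s := by
  refine (hasDerivAt_fderiv_swap (p := (s, q)) (contDiffAt_normalGeodesic hφ hs two_ne_zero)
    (k := fun z ↦ chartVec x (normalVelocity φ L z)) ?_ a).congr_of_eventuallyEq ?_
  · filter_upwards [eventually_normalGeodesic_mem hφ hs] with z hz
    exact hasDerivAt_normalGeodesic hz
  · filter_upwards [eventually_normalGeodesic_mem_left hφ hs] with s hs
    exact chartVec_jacobiField hφ hs a

/-- Against a parallel field only the covariant derivative of the Jacobi field contributes to the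
product rule. -/
lemma hasDerivAt_inner_jacobiField (hφ : ContMDiff 𝓘(ℝ, ℝ) (𝓡 d) ∞ φ) {x : M} {s : ℝ}
    {q : ℝ × EuclideanSpace ℝ (Fin (d - 1))}
    (hs : normalGeodesic φ L (s, q) ∈ (extChartAt (𝓡 d) x).source)
    (a : ℝ × EuclideanSpace ℝ (Fin (d - 1)))
    {V : ∀ s, TangentSpace (𝓡 d) (normalGeodesic φ L (s, q))}
    (hV : IsParallel (fun s ↦ normalGeodesic φ L (s, q)) V) :
    HasDerivAt (fun s ↦ inner ℝ (jacobiField φ L q a s) (V s))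
      (metric x (extChartAt (𝓡 d) x (normalGeodesic φ L (s, q))) (jacobiDeriv φ L x q a s)
        (chartVec x (V s))) s := by
  have hvel : chartVec x (velocity (fun s ↦ normalGeodesic φ L (s, q)) s)
      = chartVec x (normalVelocity φ L (s, q)) :=
    (hasDerivAt_extChartAt (((isGeodesic_normalGeodesic q).1 s).mdifferentiableAt (by simp))
      hs).unique (hasDerivAt_normalGeodesic (z := (s, q)) hs)
  have hV' := hV x s hs
  rw [hvel] at hV'
  refine (hasDerivAt_inner_of_chart (eventually_normalGeodesic_mem_left hφ hs)
    (hasDerivAt_normalGeodesic (z := (s, q)) hs) (hasDerivAt_chartVec_jacobiField hφ hs a)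
    hV').congr_deriv ?_
  obtain ⟨B, hB⟩ := metric_bilinear d x (extChartAt (𝓡 d) x (normalGeodesic φ L (s, q)))
  simp only [neg_add_cancel, hB, map_zero, add_zero]
  rfl

/-- The Jacobi equation. -/
lemma hasDerivAt_deriv_inner_jacobiField (hφ : ContMDiff 𝓘(ℝ, ℝ) (𝓡 d) ∞ φ) {x : M} {s : ℝ}
    {q : ℝ × EuclideanSpace ℝ (Fin (d - 1))}
    (hs : normalGeodesic φ L (s, q) ∈ (extChartAt (𝓡 d) x).source)
    (a : ℝ × EuclideanSpace ℝ (Fin (d - 1)))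
    {V : ∀ s, TangentSpace (𝓡 d) (normalGeodesic φ L (s, q))}
    (hV : IsParallel (fun s ↦ normalGeodesic φ L (s, q)) V) :
    HasDerivAt (deriv fun s ↦ inner ℝ (jacobiField φ L q a s) (V s))
      (metric x (extChartAt (𝓡 d) x (normalGeodesic φ L (s, q)))
        (curvature x (extChartAt (𝓡 d) x (normalGeodesic φ L (s, q)))
          (chartVec x (normalVelocity φ L (s, q))) (chartVec x (jacobiField φ L q a s))
          (chartVec x (normalVelocity φ L (s, q)))) (chartVec x (V s))) s := by
  have hm := (extChartAt (𝓡 d) x).map_source hs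
  have hvel : chartVec x (velocity (fun s ↦ normalGeodesic φ L (s, q)) s)
      = chartVec x (normalVelocity φ L (s, q)) :=
    (hasDerivAt_extChartAt (((isGeodesic_normalGeodesic q).1 s).mdifferentiableAt (by simp))
      hs).unique (hasDerivAt_normalGeodesic (z := (s, q)) hs)
  have hV' := hV x s hs
  rw [hvel] at hV'
  have hc := hasDerivAt_normalGeodesic (z := (s, q)) hs
  have hvar := (isLeviCivita d x).hasDerivAt_variation
    (c := fun z ↦ extChartAt (𝓡 d) x (normalGeodesic φ L z))
    (T := fun z ↦ chartVec x (normalVelocity φ L z)) (p := (s, q))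
    ((contDiffAt_normalGeodesic hφ hs one_ne_zero).differentiableAt (by simp))
    (contDiffAt_normalVelocity hφ hs two_ne_zero) hm
    ((eventually_normalGeodesic_mem hφ hs).mono fun z hz ↦ hasDerivAt_normalVelocity hz) a
  rw [← chartVec_jacobiField hφ hs a] at hvar
  obtain ⟨Z, hZ, hZ'⟩ := (isLeviCivita d x).hasDerivAt_covariant
    (T := fun s ↦ chartVec x (normalVelocity φ L (s, q)))
    (Y' := fun s ↦ fderiv ℝ (fun z ↦ chartVec x (normalVelocity φ L z)) (s, q) (0, a)) hc
    (hasDerivAt_normalVelocity (z := (s, q)) hs) (hasDerivAt_chartVec_jacobiField hφ hs a) hvar hm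
  have h1 := (isLeviCivita d x).hasDerivAt_inner hc hZ hV' hm
  -- The first derivative is rewritten through `jacobiDeriv` in one fixed chart near s, so that it
  -- can be differentiated again.
  have h2 : (deriv fun s ↦ inner ℝ (jacobiField φ L q a s) (V s)) =ᶠ[𝓝 s] fun s ↦
      metric x (extChartAt (𝓡 d) x (normalGeodesic φ L (s, q))) (jacobiDeriv φ L x q a s)
        (chartVec x (V s)) := by
    filter_upwards [eventually_normalGeodesic_mem_left hφ hs] with s hs
    exact (hasDerivAt_inner_jacobiField hφ hs a hV).deriv
  refine (h1.congr_of_eventuallyEq h2).congr_deriv ?_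
  rw [hZ']
  obtain ⟨B, hB⟩ := metric_bilinear d x (extChartAt (𝓡 d) x (normalGeodesic φ L (s, q)))
  simp only [neg_add_cancel, hB, map_zero, add_zero]
  rfl

end

end Fermi
end

noncomputable section
namespace Fermi
open Filter Topology

/-! ### Gram determinants -/

section Gram

variable {V ι : Type*} [NormedAddCommGroup V] [InnerProductSpace ℝ V] [Fintype ι]

lemma gram_sum_smul (x : ι → V) (O : Matrix ι ι ℝ) :
    (Matrix.of fun i j ↦ (inner ℝ (∑ k, O k i • x k) (∑ k, O k j • x k) : ℝ))
      = O.transpose * (Matrix.of fun i j ↦ (inner ℝ (x i) (x j) : ℝ)) * O := by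
  ext i j
  simp only [Matrix.of_apply, Matrix.mul_apply, Matrix.transpose_apply, sum_inner, inner_sum,
    real_inner_smul_left, real_inner_smul_right, Finset.sum_mul]
  exact Finset.sum_congr rfl fun k _ ↦ Finset.sum_congr rfl fun l _ ↦ by ring

lemma det_gram_sum_smul [DecidableEq ι] (x : ι → V) (O : Matrix ι ι ℝ) :
    (Matrix.of fun i j ↦ (inner ℝ (∑ k, O k i • x k) (∑ k, O k j • x k) : ℝ)).det
      = O.det ^ 2 * (Matrix.of fun i j ↦ (inner ℝ (x i) (x j) : ℝ)).det := by
  rw [gram_sum_smul, Matrix.det_mul, Matrix.det_mul, Matrix.det_transpose]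
  ring

lemma exists_orthonormalBasis_coe_eq [FiniteDimensional ℝ V] {v : ι → V} (hv : Orthonormal ℝ v)
    (hc : Fintype.card ι = Module.finrank ℝ V) : ∃ e : OrthonormalBasis ι ℝ V, ⇑e = v :=
  ⟨OrthonormalBasis.mk hv (hv.linearIndependent.span_eq_top_of_card_eq_finrank' hc).ge,
    OrthonormalBasis.coe_mk _ _⟩

/-- By Parseval the Gram matrix is BᵀB, with B the matrix of components in the orthonormal basis. -/
lemma det_gram_eq_sq [DecidableEq ι] (e : OrthonormalBasis ι ℝ V) (y : ι → V) :
    (Matrix.of fun i j ↦ (inner ℝ (y i) (y j) : ℝ)).det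
      = (Matrix.of fun i j ↦ (inner ℝ (y j) (e i) : ℝ)).det ^ 2 := by
  have h : (Matrix.of fun i j ↦ (inner ℝ (y i) (y j) : ℝ))
      = (Matrix.of fun i j ↦ (inner ℝ (y j) (e i) : ℝ)).transpose
        * (Matrix.of fun i j ↦ (inner ℝ (y j) (e i) : ℝ)) := by
    ext i j
    simp only [Matrix.of_apply, Matrix.mul_apply, Matrix.transpose_apply]
    rw [← e.sum_inner_mul_inner]
    exact Finset.sum_congr rfl fun k _ ↦ by rw [real_inner_comm (e k) (y j)]
  rw [h, Matrix.det_mul, Matrix.det_transpose, sq]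

end Gram

/-- The orthonormal basis of `ℝ × W` induced by an orthonormal basis of `W`. -/
def normalDir {W ι : Type*} [NormedAddCommGroup W] [InnerProductSpace ℝ W] [Fintype ι]
    (b : OrthonormalBasis ι ℝ W) : Option ι → ℝ × W :=
  fun i ↦ i.elim (1, 0) fun j ↦ (0, b j)

/-- The change of basis is block diagonal with blocks 1 and an orthogonal matrix, so the square of
its determinant is 1. A basis adapted to θ may thus be exchanged for the standard one. -/
lemma det_gram_normalDir {V W ι : Type*} [NormedAddCommGroup V] [InnerProductSpace ℝ V]
    [NormedAddCommGroup W] [InnerProductSpace ℝ W] [Fintype ι] [DecidableEq ι]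
    (b b' : OrthonormalBasis ι ℝ W) (T : ℝ × W →ₗ[ℝ] V) :
    (Matrix.of fun i j ↦ (inner ℝ (T (normalDir b i)) (T (normalDir b j)) : ℝ)).det
      = (Matrix.of fun i j ↦ (inner ℝ (T (normalDir b' i)) (T (normalDir b' j)) : ℝ)).det := by
  let O : Matrix (Option ι) (Option ι) ℝ := Matrix.of fun i j ↦
    i.elim (j.elim 1 fun _ ↦ 0) fun i ↦ j.elim 0 fun j ↦ inner ℝ (b' i) (b j)
  have hO : O.transpose * O = 1 := by
    ext i j
    rw [Matrix.mul_apply, Fintype.sum_option]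
    rcases i with _ | i <;> rcases j with _ | j
    · simp [O]
    · simp [O]
    · simp [O]
    · simp only [O, Matrix.transpose_apply, Matrix.of_apply, Option.elim, mul_zero, zero_add]
      simp_rw [real_inner_comm (b i)]
      rw [b'.sum_inner_mul_inner, b.inner_eq_ite, Matrix.one_apply]
      simp
  have hdet : O.det ^ 2 = 1 := by
    have := congrArg Matrix.det hO
    rwa [Matrix.det_mul, Matrix.det_transpose, Matrix.det_one, ← sq] at this
  have hsum : ∀ i, T (normalDir b i) = ∑ k, O k i • T (normalDir b' k) := by
    intro i
    simp_rw [← map_smul, ← map_sum]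
    congr 1
    rw [Fintype.sum_option]
    rcases i with _ | i
    · simp [O, normalDir]
    · simp only [O, normalDir, Matrix.of_apply, Option.elim, zero_smul, zero_add]
      refine Prod.ext (by simp [Prod.fst_sum]) ?_
      simp only [Prod.snd_sum, Prod.smul_snd]
      exact (b'.sum_repr' (b i)).symm
  simp_rw [hsum]
  rw [det_gram_sum_smul, hdet, one_mul]

/-! ### The curvature operator -/

section Curvature

variable {d : ℕ} {M : Type*} [TopologicalSpace M] [ChartedSpace (EuclideanSpace ℝ (Fin d)) M]
  [IsManifold (𝓡 d) ∞ M] [RiemannianBundle (fun p : M ↦ TangentSpace (𝓡 d) p)]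
  [IsContMDiffRiemannianBundle (𝓡 d) ∞ (EuclideanSpace ℝ (Fin d))
      (fun p : M ↦ TangentSpace (𝓡 d) p)]

/-- The quadratic form `⟨R(X, T)T, Z⟩`. -/
def curvForm (p : M) (T X Z : TangentSpace (𝓡 d) p) : ℝ :=
  metric p (extChartAt (𝓡 d) p p)
    (curvature p (extChartAt (𝓡 d) p p) (chartVec p X) (chartVec p T) (chartVec p T)) (chartVec p Z)

/-- Pair symmetry followed by the two skew-symmetries of the curvature tensor. -/
lemma curvForm_comm (p : M) (T X Z : TangentSpace (𝓡 d) p) :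
    curvForm p T X Z = curvForm p T Z X := by
  have hy := mem_extChartAt_target (I := 𝓡 d) p
  have h := isLeviCivita d p
  obtain ⟨B, hB⟩ := metric_bilinear d p (extChartAt (𝓡 d) p p)
  have h1 := h.inner_curv_pair_symm hy (chartVec p X) (chartVec p T) (chartVec p T) (chartVec p Z)
  have h2 := h.inner_curv_skew hy (chartVec p T) (chartVec p Z) (chartVec p X) (chartVec p T)
  have h3 := curv_swap (christoffel p) (extChartAt (𝓡 d) p p) (chartVec p T) (chartVec p Z)
    (chartVec p T)
  rw [h3] at h2
  change metric p _ (curv (christoffel p) _ _ _ _) _ = metric p _ (curv (christoffel p) _ _ _ _) _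
  rw [h1, h2]
  simp only [hB, map_neg, LinearMap.neg_apply, neg_neg]

lemma curvForm_bilinear (p : M) (T : TangentSpace (𝓡 d) p) :
    ∃ C : TangentSpace (𝓡 d) p →ₗ[ℝ] TangentSpace (𝓡 d) p →ₗ[ℝ] ℝ,
      ∀ X Z, curvForm p T X Z = C X Z := by
  have hy := mem_extChartAt_target (I := 𝓡 d) p
  obtain ⟨R, hR⟩ := (isLeviCivita d p).curv_multilinear hy
  obtain ⟨B, hB⟩ := metric_bilinear d p (extChartAt (𝓡 d) p p)
  have h : ∀ X Z, curvForm p T X Z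
      = B (R (chartVec p X) (chartVec p T) (chartVec p T)) (chartVec p Z) := by
    intro X Z
    rw [← hB, ← hR]
    rfl
  exact ⟨LinearMap.mk₂ ℝ (curvForm p T)
    (fun X X' Z ↦ by simp only [h, chartVec_add, map_add, LinearMap.add_apply])
    (fun r X Z ↦ by simp only [h, chartVec_smul, map_smul, LinearMap.smul_apply])
    (fun X Z Z' ↦ by simp only [h, chartVec_add, map_add])
    (fun r X Z ↦ by simp only [h, chartVec_smul, map_smul]), fun _ _ ↦ rfl⟩

omit [IsManifold (𝓡 d) ∞ M] [IsContMDiffRiemannianBundle (𝓡 d) ∞ (EuclideanSpace ℝ (Fin d))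
      (fun p : M ↦ TangentSpace (𝓡 d) p)] in
lemma curvForm_self (p : M) (T Z : TangentSpace (𝓡 d) p) : curvForm p T T Z = 0 := by
  obtain ⟨B, hB⟩ := metric_bilinear d p (extChartAt (𝓡 d) p p)
  have h4 : curv (christoffel p) (extChartAt (𝓡 d) p p) (chartVec p T) (chartVec p T)
    (chartVec p T) = 0 := by simp [curv]
  change metric p _ (curv (christoffel p) _ _ _ _) _ = 0
  rw [h4]
  simp only [hB, map_zero, LinearMap.zero_apply]

omit [IsManifold (𝓡 d) ∞ M] [IsContMDiffRiemannianBundle (𝓡 d) ∞ (EuclideanSpace ℝ (Fin d))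
      (fun p : M ↦ TangentSpace (𝓡 d) p)] in
lemma curvForm_eq_sectionalCurvature_mul {p : M} {T X : TangentSpace (𝓡 d) p}
    (h : ‖X‖ ^ 2 * ‖T‖ ^ 2 - inner ℝ X T ^ 2 ≠ 0) :
    curvForm p T X X = sectionalCurvature p X T * (‖X‖ ^ 2 * ‖T‖ ^ 2 - inner ℝ X T ^ 2) := by
  rw [sectionalCurvature, div_mul_cancel₀ _ h]
  rfl

/-- The component of X orthogonal to T decides. If it is nonzero, the pair is independent and the
form is sectional curvature times squared area. If it vanishes, X is a multiple of T and the form is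
0. The second case is separate because curvature bounds speak only of independent pairs. -/
lemma curvForm_cases (p : M) {T : TangentSpace (𝓡 d) p} (hT : ‖T‖ = 1)
    (X : TangentSpace (𝓡 d) p) :
    (LinearIndependent ℝ ![X, T] ∧ 0 < ‖X‖ ^ 2 - inner ℝ X T ^ 2 ∧
        curvForm p T X X = sectionalCurvature p X T * (‖X‖ ^ 2 - inner ℝ X T ^ 2)) ∨
      (‖X‖ ^ 2 - inner ℝ X T ^ 2 = 0 ∧ curvForm p T X X = 0) := by
  have hD : ‖X - (inner ℝ X T : ℝ) • T‖ ^ 2 = ‖X‖ ^ 2 - inner ℝ X T ^ 2 := by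
    rw [norm_sub_sq_real, real_inner_smul_right, norm_smul, hT, mul_one, Real.norm_eq_abs, sq_abs]
    ring
  have hT0 : T ≠ 0 := by
    rintro rfl
    simp at hT
  by_cases h0 : X - (inner ℝ X T : ℝ) • T = 0
  · right
    obtain ⟨C, hC⟩ := curvForm_bilinear p T
    have h1 : ∀ Z, C T Z = 0 := fun Z ↦ by rw [← hC, curvForm_self]
    refine ⟨by rw [← hD, h0]; simp, ?_⟩
    obtain ⟨r, rfl⟩ : ∃ r : ℝ, X = r • T := ⟨_, sub_eq_zero.1 h0⟩
    simp only [hC, map_smul, LinearMap.smul_apply, h1, smul_zero]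
  · left
    have hpos : 0 < ‖X‖ ^ 2 - inner ℝ X T ^ 2 := by
      rw [← hD]
      exact pow_pos (norm_pos_iff.2 h0) 2
    refine ⟨?_, hpos, ?_⟩
    · rw [LinearIndependent.pair_iff]
      intro s t hst
      have hs : s = 0 := by
        by_contra hs
        have hX : X = (-(s⁻¹ * t)) • T := by
          have h1 : s⁻¹ • (s • X + t • T) = 0 := by rw [hst, smul_zero]
          rw [smul_add, inv_smul_smul₀ hs, smul_smul] at h1
          rw [neg_smul]
          exact eq_neg_of_add_eq_zero_left h1
        apply h0
        rw [hX, real_inner_smul_left, real_inner_self_eq_norm_sq, hT]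
        simp
      subst hs
      rw [zero_smul, zero_add] at hst
      exact ⟨rfl, (smul_eq_zero.1 hst).resolve_right hT0⟩
    · rw [curvForm_eq_sectionalCurvature_mul] <;> rw [hT, one_pow, mul_one]
      exact hpos.ne'

end Curvature

/-! ### Parallel frames along the normal geodesics -/

section Frame

variable {d : ℕ} {M : Type*} [EMetricSpace M] [CompleteSpace M]
  [ChartedSpace (EuclideanSpace ℝ (Fin d)) M]
  [IsManifold (𝓡 d) ∞ M] [RiemannianBundle (fun p : M ↦ TangentSpace (𝓡 d) p)]
  [IsContMDiffRiemannianBundle (𝓡 d) ∞ (EuclideanSpace ℝ (Fin d))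
      (fun p : M ↦ TangentSpace (𝓡 d) p)] [IsRiemannianManifold (𝓡 d) M]
  {φ : ℝ → M} {L : EuclideanSpace ℝ (Fin (d - 1)) →ₗᵢ[ℝ] TangentSpace (𝓡 d) (φ 0)}

lemma normalGeodesic_zero (q : ℝ × EuclideanSpace ℝ (Fin (d - 1))) :
    normalGeodesic φ L (0, q) = φ q.1 := by
  rw [normalGeodesic, geodesicFlow_zero]
  rfl

lemma chartVec_normalVelocity_zero (x : M) (q : ℝ × EuclideanSpace ℝ (Fin (d - 1))) :
    chartVec x (normalVelocity φ L (0, q)) = chartVec x (parallelTransport φ q.1 (L q.2)) :=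
  congrArg (fun z : TangentBundle (𝓡 d) M ↦ chartVec x z.snd) (geodesicFlow_zero (normalVec φ L q))

-- Carries tangent vectors across an equality of base points, needed because a normal geodesic
-- starts at φ(u) only up to a proved equality.
omit [EMetricSpace M] [CompleteSpace M] [IsManifold (𝓡 d) ∞ M] [IsRiemannianManifold (𝓡 d) M]
  [ChartedSpace (EuclideanSpace ℝ (Fin d)) M]
  [RiemannianBundle (fun p : M ↦ TangentSpace (𝓡 d) p)]
  [IsContMDiffRiemannianBundle (𝓡 d) ∞ (EuclideanSpace ℝ (Fin d))
      (fun p : M ↦ TangentSpace (𝓡 d) p)] in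
lemma exists_isometry_of_eq [TopologicalSpace M] [ChartedSpace (EuclideanSpace ℝ (Fin d)) M]
    [RiemannianBundle (fun p : M ↦ TangentSpace (𝓡 d) p)] {p p' : M} (h : p = p') :
    ∃ c : TangentSpace (𝓡 d) p → TangentSpace (𝓡 d) p', (∀ x v, chartVec x (c v) = chartVec x v) ∧
      ∀ v w, (inner ℝ (c v) (c w) : ℝ) = inner ℝ v w := by
  subst h
  exact ⟨id, fun _ _ ↦ rfl, fun _ _ ↦ rfl⟩

/-- The initial values of the frames along the geodesics normal to `φ`. -/
def initialFrame (φ : ℝ → M) (L : EuclideanSpace ℝ (Fin (d - 1)) →ₗᵢ[ℝ] TangentSpace (𝓡 d) (φ 0))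
    (u : ℝ) (b : OrthonormalBasis (Fin (d - 1)) ℝ (EuclideanSpace ℝ (Fin (d - 1)))) :
    Option (Fin (d - 1)) → TangentSpace (𝓡 d) (φ u) :=
  fun i ↦ i.elim (velocity φ u) fun j ↦ parallelTransport φ u (L (b j))

omit [CompleteSpace M] [IsRiemannianManifold (𝓡 d) M] in
lemma inner_velocity_parallelTransport (hφ : IsGeodesic d φ)
    (hL : ∀ w, inner ℝ (L w) (velocity (d := d) φ 0) = 0) (u : ℝ)
    (w : EuclideanSpace ℝ (Fin (d - 1))) :
    (inner ℝ (parallelTransport φ u (L w)) (velocity (d := d) φ u) : ℝ) = 0 := by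
  rw [(isParallel_parallelTransport hφ.1 (L w)).inner_eq hφ.1 hφ.2, parallelTransport_zero hφ.1, hL]

omit [CompleteSpace M] [IsRiemannianManifold (𝓡 d) M] in
lemma orthonormal_initialFrame (hφ : IsGeodesic d φ) (hunit : ∀ t, ‖velocity (d := d) φ t‖ = 1)
    (hL : ∀ w, inner ℝ (L w) (velocity (d := d) φ 0) = 0) (u : ℝ)
    (b : OrthonormalBasis (Fin (d - 1)) ℝ (EuclideanSpace ℝ (Fin (d - 1)))) :
    Orthonormal ℝ (initialFrame φ L u b) := by
  rw [orthonormal_iff_ite]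
  intro i j
  rcases i with _ | i <;> rcases j with _ | j <;> simp only [initialFrame, Option.elim]
  · rw [real_inner_self_eq_norm_sq, hunit]; simp
  · rw [real_inner_comm, inner_velocity_parallelTransport hφ hL]; simp
  · rw [inner_velocity_parallelTransport hφ hL]; simp
  · rw [inner_parallelTransport hφ.1, L.inner_map_map, b.inner_eq_ite]; simp

/-- The initial frame is moved by parallel transport along the normal geodesic, which preserves
inner products. Initial values are compared in charts because the base points agree only
propositionally. -/
lemma exists_frame (hφ : IsGeodesic d φ) (hunit : ∀ t, ‖velocity (d := d) φ t‖ = 1)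
    (hL : ∀ w, inner ℝ (L w) (velocity (d := d) φ 0) = 0)
    (q : ℝ × EuclideanSpace ℝ (Fin (d - 1)))
    (b : OrthonormalBasis (Fin (d - 1)) ℝ (EuclideanSpace ℝ (Fin (d - 1)))) :
    ∃ e : Option (Fin (d - 1)) → ∀ s, TangentSpace (𝓡 d) (normalGeodesic φ L (s, q)),
      (∀ i, IsParallel (fun s ↦ normalGeodesic φ L (s, q)) (e i)) ∧
      (∀ s, Orthonormal ℝ fun i ↦ e i s) ∧
      ∀ i x, chartVec x (e i 0) = chartVec x (initialFrame φ L q.1 b i) := by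
  obtain ⟨c, hc, hc'⟩ :=
    exists_isometry_of_eq (d := d) (normalGeodesic_zero (φ := φ) (L := L) q).symm
  have hγ := (isGeodesic_normalGeodesic (φ := φ) (L := L) q).1
  have hon := orthonormal_initialFrame hφ hunit hL q.1 b
  refine ⟨fun i s ↦ parallelTransport (fun s ↦ normalGeodesic φ L (s, q)) s
      (c (initialFrame φ L q.1 b i)), fun i ↦ isParallel_parallelTransport hγ _, fun s ↦ ?_,
    fun i x ↦ ?_⟩
  · rw [orthonormal_iff_ite] at hon ⊢
    intro i j
    rw [← hon i j, ← hc']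
    exact inner_parallelTransport hγ _ _ s
  · rw [← hc]
    exact congrArg (chartVec x) (parallelTransport_zero hγ (c (initialFrame φ L q.1 b i)))

end Frame

end Fermi
end

noncomputable section
namespace Fermi
open Filter Topology
open scoped Matrix

/-! ### Comparison of the Jacobian of the normal exponential map -/

section

variable {d : ℕ} {M : Type*} [EMetricSpace M] [CompleteSpace M]
  [ChartedSpace (EuclideanSpace ℝ (Fin d)) M]
  [IsManifold (𝓡 d) ∞ M] [RiemannianBundle (fun p : M ↦ TangentSpace (𝓡 d) p)]
  [IsContMDiffRiemannianBundle (𝓡 d) ∞ (EuclideanSpace ℝ (Fin d))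
      (fun p : M ↦ TangentSpace (𝓡 d) p)] [IsRiemannianManifold (𝓡 d) M]
  {φ : ℝ → M} {L : EuclideanSpace ℝ (Fin (d - 1)) →ₗᵢ[ℝ] TangentSpace (𝓡 d) (φ 0)}

lemma normalGeodesic_eq (hφ : ContMDiff 𝓘(ℝ, ℝ) (𝓡 d) ∞ φ) (s : ℝ)
    (q : ℝ × EuclideanSpace ℝ (Fin (d - 1))) :
    normalGeodesic φ L (s, q) = normalExp φ L (q.1, s • q.2) :=
  (normalExp_smul hφ L q.1 s q.2).symm

lemma normalExp_eq_normalGeodesic (q : ℝ × EuclideanSpace ℝ (Fin (d - 1))) :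
    normalExp φ L q = normalGeodesic φ L (1, q) :=
  normalExp_eq φ L q

lemma contMDiff_normalExp (hφ : ContMDiff 𝓘(ℝ, ℝ) (𝓡 d) ∞ φ) :
    ContMDiff 𝓘(ℝ, ℝ × EuclideanSpace ℝ (Fin (d - 1))) (𝓡 d) 1 (normalExp φ L) := by
  intro q
  have hm := mem_extChartAt_source (I := 𝓡 d) (normalGeodesic φ L (1, q))
  have hc : ContDiff ℝ 1 (fun q : ℝ × EuclideanSpace ℝ (Fin (d - 1)) ↦ ((1 : ℝ), q)) := by fun_prop
  have h := contMDiffAt_of_extChartAt (n := 1)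
    (z := fun q : ℝ × EuclideanSpace ℝ (Fin (d - 1)) ↦ normalGeodesic φ L (1, q)) (q := q)
    ((hc.continuous.tendsto q).eventually (eventually_normalGeodesic_mem hφ hm))
    (ContDiffAt.comp (f := fun q : ℝ × EuclideanSpace ℝ (Fin (d - 1)) ↦ ((1 : ℝ), q)) q
      (contDiffAt_normalGeodesic hφ hm one_ne_zero) hc.contDiffAt)
  rw [funext normalExp_eq_normalGeodesic]
  exact_mod_cast h

/-- The chain rule for (s,u,w) ↦ `normalExp` (u,sw). Each normal direction acquires a factor s, the
origin of the power s^(d-1) in the determinant. -/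
lemma chartVec_jacobiField_eq (hφ : ContMDiff 𝓘(ℝ, ℝ) (𝓡 d) ∞ φ) {x : M} {s : ℝ}
    {q : ℝ × EuclideanSpace ℝ (Fin (d - 1))}
    (hs : normalGeodesic φ L (s, q) ∈ (extChartAt (𝓡 d) x).source)
    (a : ℝ × EuclideanSpace ℝ (Fin (d - 1))) :
    chartVec x (jacobiField φ L q a s)
      = chartVec x (mfderiv 𝓘(ℝ, ℝ × EuclideanSpace ℝ (Fin (d - 1))) (𝓡 d) (normalExp φ L)
          (q.1, s • q.2) (a.1, s • a.2) : TangentSpace (𝓡 d) (normalExp φ L (q.1, s • q.2))) := by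
  have hs' : normalExp φ L (q.1, s • q.2) ∈ (extChartAt (𝓡 d) x).source := by
    rwa [← normalGeodesic_eq hφ]
  have hN := ((contMDiff_normalExp (L := L) hφ) (q.1, s • q.2)).mdifferentiableAt (by simp)
  rw [chartVec_jacobiField hφ hs, chartVec_mfderiv hN hs']
  have h1 : DifferentiableAt ℝ (fun q ↦ extChartAt (𝓡 d) x (normalExp φ L q)) (q.1, s • q.2) := by
    have h3 := ((contMDiffAt_extChartAt_of_mem hs').mdifferentiableAt (by simp)).comp _ hN
    exact h3.differentiableAt
  have h5 : HasFDerivAt (fun z : ℝ × ℝ × EuclideanSpace ℝ (Fin (d - 1)) ↦ z.1)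
    (ContinuousLinearMap.fst ℝ ℝ _) (s, q) := hasFDerivAt_fst
  have h6 : HasFDerivAt (fun z : ℝ × ℝ × EuclideanSpace ℝ (Fin (d - 1)) ↦ z.2.1)
    ((ContinuousLinearMap.fst ℝ ℝ _).comp (ContinuousLinearMap.snd ℝ ℝ _)) (s, q) :=
    hasFDerivAt_fst.comp (s, q) hasFDerivAt_snd
  have h7 : HasFDerivAt (fun z : ℝ × ℝ × EuclideanSpace ℝ (Fin (d - 1)) ↦ z.2.2)
    ((ContinuousLinearMap.snd ℝ ℝ _).comp (ContinuousLinearMap.snd ℝ ℝ _)) (s, q) :=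
    hasFDerivAt_snd.comp (s, q) hasFDerivAt_snd
  have h2 := HasFDerivAt.prodMk h6 (h5.fun_smul h7)
  have h3 := HasFDerivAt.comp (f := fun z : ℝ × ℝ × EuclideanSpace ℝ (Fin (d - 1)) ↦
    (z.2.1, z.1 • z.2.2)) (s, q) h1.hasFDerivAt h2
  have h4 : (fun z ↦ extChartAt (𝓡 d) x (normalGeodesic φ L z))
      = (fun q ↦ extChartAt (𝓡 d) x (normalExp φ L q)) ∘ fun z ↦ (z.2.1, z.1 • z.2.2) :=
    funext fun z ↦ congrArg (extChartAt (𝓡 d) x) (normalGeodesic_eq hφ z.1 z.2)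
  rw [h4, h3.fderiv]
  simp

/-- At time 0 the variation only moves the base point along φ. -/
lemma chartVec_jacobiField_zero (hφ : ContMDiff 𝓘(ℝ, ℝ) (𝓡 d) ∞ φ) {x : M}
    {q : ℝ × EuclideanSpace ℝ (Fin (d - 1))} (hx : φ q.1 ∈ (extChartAt (𝓡 d) x).source)
    (a : ℝ × EuclideanSpace ℝ (Fin (d - 1))) :
    chartVec x (jacobiField φ L q a 0) = a.1 • chartVec x (velocity φ q.1) := by
  have hx' : normalGeodesic φ L (0, q) ∈ (extChartAt (𝓡 d) x).source := by
    rwa [normalGeodesic_zero]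
  rw [chartVec_jacobiField hφ hx']
  have h1 := ((contDiffAt_normalGeodesic hφ hx' one_ne_zero).differentiableAt
    (by simp)).hasFDerivAt
  have h2 : HasDerivAt (fun ε : ℝ ↦ ((0 : ℝ), q + ε • a)) ((0 : ℝ), a) 0 := by
    refine (hasDerivAt_const _ _).prodMk ?_
    simpa using ((hasDerivAt_id (0 : ℝ)).smul_const a).const_add q
  have h1' : HasFDerivAt (fun z ↦ extChartAt (𝓡 d) x (normalGeodesic φ L z))
      (fderiv ℝ (fun z ↦ extChartAt (𝓡 d) x (normalGeodesic φ L z)) (0, q))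
      ((0 : ℝ), q + (0 : ℝ) • a) := by rwa [zero_smul, add_zero]
  have h3 := HasFDerivAt.comp_hasDerivAt (f := fun ε : ℝ ↦ ((0 : ℝ), q + ε • a)) 0 h1' h2
  have h4 : HasDerivAt (fun ε : ℝ ↦ q.1 + ε * a.1) a.1 0 := by
    simpa using ((hasDerivAt_id (0 : ℝ)).mul_const a.1).const_add q.1
  have h5 := hasDerivAt_extChartAt ((hφ q.1).mdifferentiableAt (by simp)) hx
  have h5' : HasDerivAt (fun s ↦ extChartAt (𝓡 d) x (φ s)) (chartVec x (velocity φ q.1))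
    (q.1 + 0 * a.1) := by rwa [zero_mul, add_zero]
  have h6 := h5'.scomp (0 : ℝ) h4
  refine h3.unique (h6.congr_of_eventuallyEq (Eventually.of_forall fun ε ↦ ?_))
  simp only [Function.comp_apply, normalGeodesic_zero]
  simp

/-- The initial vectors along the variation are transports of L(w + εa₂). Moving the base point
contributes a parallel field, whose Christoffel term cancels the one in `jacobiDeriv`, so only a₂
remains. -/
lemma jacobiDeriv_zero (hφ : ContMDiff 𝓘(ℝ, ℝ) (𝓡 d) ∞ φ) {x : M}
    {q : ℝ × EuclideanSpace ℝ (Fin (d - 1))} (hx : φ q.1 ∈ (extChartAt (𝓡 d) x).source)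
    (a : ℝ × EuclideanSpace ℝ (Fin (d - 1))) :
    jacobiDeriv φ L x q a 0 = chartVec x (parallelTransport φ q.1 (L a.2)) := by
  have hx' : normalGeodesic φ L (0, q) ∈ (extChartAt (𝓡 d) x).source := by
    rwa [normalGeodesic_zero]
  have h1 := ((contDiffAt_normalVelocity hφ hx' one_ne_zero).differentiableAt
    (by simp)).hasFDerivAt
  have h2 : HasDerivAt (fun ε : ℝ ↦ ((0 : ℝ), q + ε • a)) ((0 : ℝ), a) 0 := by
    refine (hasDerivAt_const _ _).prodMk ?_
    simpa using ((hasDerivAt_id (0 : ℝ)).smul_const a).const_add q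
  have h1' : HasFDerivAt (fun z ↦ chartVec x (normalVelocity φ L z))
      (fderiv ℝ (fun z ↦ chartVec x (normalVelocity φ L z)) (0, q))
      ((0 : ℝ), q + (0 : ℝ) • a) := by rwa [zero_smul, add_zero]
  have h3 := HasFDerivAt.comp_hasDerivAt (f := fun ε : ℝ ↦ ((0 : ℝ), q + ε • a)) 0 h1' h2
  have h4 : HasDerivAt (fun ε : ℝ ↦ q.1 + ε * a.1) a.1 0 := by
    simpa using ((hasDerivAt_id (0 : ℝ)).mul_const a.1).const_add q.1
  have h5 : ∀ w, HasDerivAt (fun ε : ℝ ↦ chartVec x (parallelTransport φ (q.1 + ε * a.1) (L w)))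
      (a.1 • -christoffel x (extChartAt (𝓡 d) x (φ q.1)) (chartVec x (velocity φ q.1))
        (chartVec x (parallelTransport φ q.1 (L w)))) 0 := by
    intro w
    have h5 := isParallel_parallelTransport hφ (L w) x q.1 hx
    have h5' : HasDerivAt (fun s ↦ chartVec x (parallelTransport φ s (L w)))
      (-christoffel x (extChartAt (𝓡 d) x (φ q.1)) (chartVec x (velocity φ q.1))
        (chartVec x (parallelTransport φ q.1 (L w)))) (q.1 + 0 * a.1) := by
      rwa [zero_mul, add_zero]
    exact h5'.scomp (0 : ℝ) h4
  have h6 := (h5 q.2).fun_add ((hasDerivAt_id' (0 : ℝ)).smul (h5 a.2))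
  have h7 := h3.unique (h6.congr_of_eventuallyEq (Eventually.of_forall fun ε ↦ by
    simp only [Function.comp_apply, chartVec_normalVelocity_zero, Pi.smul_apply']
    rw [← chartVec_smul, ← chartVec_add, ← parallelTransport_add_smul hφ, ← map_smul, ← map_add]
    simp))
  obtain ⟨B, hB⟩ := christoffel_bilinear ((extChartAt (𝓡 d) x).map_source hx)
  have hv : chartVec x (parallelTransport φ (q.1 + 0 * a.1) (L a.2))
      = chartVec x (parallelTransport φ q.1 (L a.2)) := by
    change (fun s ↦ chartVec x (parallelTransport φ s (L a.2))) (q.1 + 0 * a.1) = _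
    rw [zero_mul, add_zero]
  rw [hv] at h7
  rw [jacobiDeriv, h7, chartVec_jacobiField_zero hφ hx, chartVec_normalVelocity_zero,
    normalGeodesic_zero, christoffel_comm x _ (chartVec x (parallelTransport φ q.1 (L q.2)))]
  simp only [hB, map_smul, LinearMap.smul_apply, zero_smul, one_smul, zero_add]
  module

/-- The diagonal solution of the comparison equation. -/
def modelField {n : ℕ} (c : ℝ) (j₀ : Fin n) (i : Option (Fin n)) (s : ℝ) : ℝ :=
  i.elim (Real.cosh (√c * s)) fun j ↦ if j = j₀ then s else Real.sinh (√c * s) / √c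

/-- The derivative of `modelField`. -/
def modelFieldDeriv {n : ℕ} (c : ℝ) (j₀ : Fin n) (i : Option (Fin n)) (s : ℝ) : ℝ :=
  i.elim (√c * Real.sinh (√c * s)) fun j ↦ if j = j₀ then 1 else Real.cosh (√c * s)

lemma hasDerivAt_modelField {n : ℕ} {c : ℝ} (hc : 0 < c) (j₀ : Fin n) (i : Option (Fin n)) (s : ℝ) :
    HasDerivAt (modelField c j₀ i) (modelFieldDeriv c j₀ i s) s := by
  have h : HasDerivAt (fun s ↦ √c * s) √c s := by simpa using (hasDerivAt_id s).const_mul √c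
  have hc' : √c ≠ 0 := (Real.sqrt_pos.2 hc).ne'
  rcases i with _ | j
  · exact (h.cosh).congr_deriv (mul_comm _ _)
  · by_cases hj : j = j₀
    · have h1 : modelField c j₀ (some j) = fun s ↦ s := funext fun s ↦ by simp [modelField, hj]
      rw [h1]
      simpa [modelFieldDeriv, hj] using hasDerivAt_id' s
    · have h1 : modelField c j₀ (some j) = fun s ↦ Real.sinh (√c * s) / √c :=
        funext fun s ↦ by simp [modelField, hj]
      rw [h1]
      simp only [modelFieldDeriv, Option.elim, hj, if_false]
      refine (h.sinh.div_const √c).congr_deriv ?_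
      field_simp

lemma hasDerivAt_modelFieldDeriv {n : ℕ} {c : ℝ} (hc : 0 < c) (j₀ : Fin n) (i : Option (Fin n))
    (s : ℝ) : HasDerivAt (modelFieldDeriv c j₀ i)
      ((if i = some j₀ then 0 else c) * modelField c j₀ i s) s := by
  have h : HasDerivAt (fun s ↦ √c * s) √c s := by simpa using (hasDerivAt_id s).const_mul √c
  have hc' : √c ≠ 0 := (Real.sqrt_pos.2 hc).ne'
  have hsq : √c * √c = c := Real.mul_self_sqrt hc.le
  rcases i with _ | j
  · refine (h.sinh.const_mul √c).congr_deriv ?_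
    simp only [modelField, Option.elim, reduceCtorEq, if_false]
    linear_combination Real.cosh (√c * s) * hsq
  · by_cases hj : j = j₀
    · have h1 : modelFieldDeriv c j₀ (some j) = fun s ↦ (1 : ℝ) :=
        funext fun s ↦ by simp [modelFieldDeriv, hj]
      rw [h1]
      simpa [hj] using hasDerivAt_const s (1 : ℝ)
    · have h1 : modelFieldDeriv c j₀ (some j) = fun s ↦ Real.cosh (√c * s) :=
        funext fun s ↦ by simp [modelFieldDeriv, hj]
      rw [h1]
      simp only [modelField, Option.elim, hj, if_false, Option.some_inj]
      refine h.cosh.congr_deriv ?_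
      field_simp
      linear_combination Real.sinh (√c * s) * hsq

/-- The matrix Jacobi equation along a geodesic normal to `φ`. -/
lemma jacobiComparison (hd : 2 ≤ d) (hφ : IsGeodesic d φ)
    (hunit : ∀ t, ‖velocity (d := d) φ t‖ = 1)
    (hL : ∀ w, inner ℝ (L w) (velocity (d := d) φ 0) = 0) {c : ℝ} (hc : 0 < c)
    (hcurv : ∀ (p : M) (v w : TangentSpace (𝓡 d) p), LinearIndependent ℝ ![v, w] →
      -c ≤ sectionalCurvature p v w)
    (q : ℝ × EuclideanSpace ℝ (Fin (d - 1)))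
    (b : OrthonormalBasis (Fin (d - 1)) ℝ (EuclideanSpace ℝ (Fin (d - 1)))) {j₀ : Fin (d - 1)}
    (hb : b j₀ = q.2) :
    ∃ (e : ∀ s, OrthonormalBasis (Option (Fin (d - 1))) ℝ
        (TangentSpace (𝓡 d) (normalGeodesic φ L (s, q))))
      (A A' R : ℝ → Matrix (Option (Fin (d - 1))) (Option (Fin (d - 1))) ℝ),
      JacobiComparison A A' R (modelField c j₀) (modelFieldDeriv c j₀)
        (fun i ↦ if i = some j₀ then 0 else c) ∧
      (∀ s, A s = Matrix.of fun i j ↦ inner ℝ (jacobiField φ L q (normalDir b j) s) (e s i)) ∧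
      ((∀ (p : M) (v w : TangentSpace (𝓡 d) p), LinearIndependent ℝ ![v, w] →
        sectionalCurvature p v w ≤ 0) → ∀ s x, x ⬝ᵥ (R s *ᵥ x) ≤ 0) := by
  obtain ⟨e, he, hon, he0⟩ := exists_frame hφ hunit hL q b
  have hcard : ∀ p : M, Fintype.card (Option (Fin (d - 1)))
      = Module.finrank ℝ (TangentSpace (𝓡 d) p) := by
    intro p
    have : Module.finrank ℝ (TangentSpace (𝓡 d) p) = d := finrank_euclideanSpace_fin
    rw [this, Fintype.card_option, Fintype.card_fin]
    omega
  have hfin : ∀ p : M, FiniteDimensional ℝ (TangentSpace (𝓡 d) p) := fun p ↦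
    inferInstanceAs (FiniteDimensional ℝ (EuclideanSpace ℝ (Fin d)))
  have hbasis := fun s ↦ exists_orthonormalBasis_coe_eq (hon s) (hcard _)
  choose E hE using hbasis
  have hE' : ∀ s i, E s i = e i s := fun s i ↦ congrFun (hE s) i
  set γ : ℝ → M := fun s ↦ normalGeodesic φ L (s, q) with hγ
  set T : ∀ s, TangentSpace (𝓡 d) (γ s) := fun s ↦ normalVelocity φ L (s, q) with hT
  -- The frame vector of index j₀ is the velocity of the geodesic: both are parallel with the same
  -- initial value. This direction has curvature 0 and model function s.
  have hT0 : e (some j₀) = T := by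
    funext s
    refine IsParallel.ext (isGeodesic_normalGeodesic q).1 (he (some j₀))
      (isParallel_normalVelocity q) ?_ s
    refine chartVec_injective (mem_extChartAt_source (I := 𝓡 d) (γ 0)) ?_
    rw [he0, chartVec_normalVelocity_zero, ← hb]
    rfl
  have hTn : ∀ s, ‖T s‖ = 1 := fun s ↦ by rw [← hT0]; exact (hon s).1 (some j₀)
  let A : ℝ → Matrix (Option (Fin (d - 1))) (Option (Fin (d - 1))) ℝ := fun s ↦
    Matrix.of fun i j ↦ inner ℝ (jacobiField φ L q (normalDir b j) s) (e i s)
  let A' : ℝ → Matrix (Option (Fin (d - 1))) (Option (Fin (d - 1))) ℝ := fun s ↦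
    Matrix.of fun i j ↦ deriv (fun s ↦ inner ℝ (jacobiField φ L q (normalDir b j) s) (e i s)) s
  let R : ℝ → Matrix (Option (Fin (d - 1))) (Option (Fin (d - 1))) ℝ := fun s ↦
    Matrix.of fun i k ↦ curvForm (γ s) (T s) (e k s) (e i s)
  have hquad : ∀ s x, x ⬝ᵥ (R s *ᵥ x)
      = curvForm (γ s) (T s) (∑ i, x i • e i s) (∑ i, x i • e i s) := by
    intro s x
    obtain ⟨C, hC⟩ := curvForm_bilinear (γ s) (T s)
    simp only [R, hC, dotProduct, Matrix.mulVec, Matrix.of_apply, map_sum, map_smul,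
      LinearMap.sum_apply, LinearMap.smul_apply, smul_eq_mul, Finset.mul_sum]
    exact Finset.sum_congr rfl fun i _ ↦ Finset.sum_congr rfl fun k _ ↦ by ring
  -- Removing the tangential component drops exactly the coordinate j₀, which explains the zero of κ
  -- at that index.
  have hnorm : ∀ s (x : Option (Fin (d - 1)) → ℝ), ‖∑ i, x i • e i s‖ ^ 2
      - inner ℝ (∑ i, x i • e i s) (T s) ^ 2 = ∑ i, (if i = some j₀ then 0 else 1) * x i ^ 2 := by
    intro s x
    have h1 : ‖∑ i, x i • e i s‖ ^ 2 = ∑ i, x i ^ 2 := by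
      rw [← real_inner_self_eq_norm_sq, (hon s).inner_sum]
      exact Finset.sum_congr rfl fun i _ ↦ by simp [sq]
    have h2 : (inner ℝ (∑ i, x i • e i s) (T s) : ℝ) = x (some j₀) := by
      rw [← hT0]
      have := (hon s).inner_left_sum x (Finset.mem_univ (some j₀))
      simpa using this
    rw [h1, h2, sub_eq_iff_eq_add, ← Finset.add_sum_erase _ _ (Finset.mem_univ (some j₀)),
      ← Finset.add_sum_erase (a := some j₀) _
        (fun i ↦ (if i = some j₀ then 0 else 1) * x i ^ 2) (Finset.mem_univ (some j₀))]
    simp only [if_true, zero_mul, zero_add]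
    rw [add_comm]
    congr 1
    refine Finset.sum_congr rfl fun i hi ↦ ?_
    rw [if_neg (Finset.ne_of_mem_erase hi), one_mul]
  refine ⟨E, A, A', R, ?_, fun s ↦ by simp only [hE']; rfl, fun hneg s x ↦ ?_⟩
  · refine
      { hA := fun s i j ↦ ?_
        hA' := fun s i j ↦ ?_
        hR := fun s ↦ ?_
        hRκ := fun s x ↦ ?_
        hf := fun s i ↦ hasDerivAt_modelField hc j₀ i s
        hf' := fun s i ↦ hasDerivAt_modelFieldDeriv hc j₀ i s
        hA0 := ?_
        hA'0 := ?_
        hff' := fun i ↦ ?_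
        hne := fun i ↦ ?_ }
    · exact (hasDerivAt_inner_jacobiField hφ.1 (mem_extChartAt_source (I := 𝓡 d) (γ s)) _
        (he i)).differentiableAt.hasDerivAt
    · refine (hasDerivAt_deriv_inner_jacobiField hφ.1 (mem_extChartAt_source (I := 𝓡 d) (γ s)) _
        (he i)).congr_deriv ?_
      obtain ⟨C, hC⟩ := curvForm_bilinear (γ s) (T s)
      -- Expanding the Jacobi field in the frame turns the curvature term into an entry of the
      -- product RA.
      have hexp : jacobiField φ L q (normalDir b j) s = ∑ k, A s k j • e k s := by
        have := (E s).sum_repr' (jacobiField φ L q (normalDir b j) s)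
        simp only [hE'] at this
        rw [← this]
        exact Finset.sum_congr rfl fun k _ ↦ by rw [real_inner_comm]; rfl
      have h1 : -((R s * A s) i j)
          = -curvForm (γ s) (T s) (jacobiField φ L q (normalDir b j) s) (e i s) := by
        rw [hexp, Matrix.mul_apply]
        simp only [R, hC, Matrix.of_apply, map_sum, map_smul, LinearMap.sum_apply,
          LinearMap.smul_apply, smul_eq_mul]
        congr 1
        exact Finset.sum_congr rfl fun k _ ↦ by ring
      rw [h1]
      obtain ⟨B, hB⟩ := metric_bilinear d (γ s) (extChartAt (𝓡 d) (γ s) (γ s))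
      have h2 := curv_swap (christoffel (γ s)) (extChartAt (𝓡 d) (γ s) (γ s))
        (chartVec (γ s) (T s)) (chartVec (γ s) (jacobiField φ L q (normalDir b j) s))
        (chartVec (γ s) (T s))
      change metric (γ s) _ (curv (christoffel (γ s)) _ _ _ _) _
        = -metric (γ s) _ (curv (christoffel (γ s)) _ _ _ _) _
      rw [h2, hB, hB, map_neg, LinearMap.neg_apply]
    · ext i j
      exact curvForm_comm _ _ _ _
    · rw [hquad]
      have h1 : -∑ i, (if i = some j₀ then 0 else c) * x i ^ 2 = -c * (‖∑ i, x i • e i s‖ ^ 2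
          - inner ℝ (∑ i, x i • e i s) (T s) ^ 2) := by
        rw [hnorm, Finset.mul_sum, ← Finset.sum_neg_distrib]
        exact Finset.sum_congr rfl fun i _ ↦ by split_ifs <;> ring
      rw [h1]
      rcases curvForm_cases (γ s) (hTn s) (∑ i, x i • e i s) with ⟨h2, h3, h4⟩ | ⟨h2, h3⟩
      · rw [h4]
        exact mul_le_mul_of_nonneg_right (hcurv _ _ _ h2) h3.le
      · rw [h2, h3, mul_zero]
    · have hm : φ q.1 ∈ (extChartAt (𝓡 d) (φ q.1)).source := mem_extChartAt_source (I := 𝓡 d) _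
      have hm' : γ 0 ∈ (extChartAt (𝓡 d) (φ q.1)).source := by
        rw [hγ]; simp only [normalGeodesic_zero]; exact hm
      have h0 : extChartAt (𝓡 d) (φ q.1) (γ 0) = extChartAt (𝓡 d) (φ q.1) (φ q.1) := by
        rw [hγ]; simp only [normalGeodesic_zero]
      have hoi := orthonormal_iff_ite.1 (orthonormal_initialFrame hφ hunit hL q.1 b)
      ext i j
      simp only [A, Matrix.of_apply]
      rw [← metric_chartVec hm', he0, chartVec_jacobiField_zero hφ.1 hm, ← chartVec_smul, h0,
        metric_chartVec hm, real_inner_smul_left]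
      have h1 : (inner ℝ (velocity φ q.1) (initialFrame φ L q.1 b i) : ℝ)
          = if none = i then 1 else 0 := hoi none i
      rw [h1]
      rcases i with _ | i <;> rcases j with _ | j <;>
        simp [normalDir, modelField, Matrix.diagonal_apply]
    · have hm : φ q.1 ∈ (extChartAt (𝓡 d) (φ q.1)).source := mem_extChartAt_source (I := 𝓡 d) _
      have hm' : γ 0 ∈ (extChartAt (𝓡 d) (φ q.1)).source := by
        rw [hγ]; simp only [normalGeodesic_zero]; exact hm
      have h0 : extChartAt (𝓡 d) (φ q.1) (γ 0) = extChartAt (𝓡 d) (φ q.1) (φ q.1) := by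
        rw [hγ]; simp only [normalGeodesic_zero]
      have hoi := orthonormal_iff_ite.1 (orthonormal_initialFrame hφ hunit hL q.1 b)
      ext i j
      simp only [A', Matrix.of_apply]
      rw [(hasDerivAt_inner_jacobiField hφ.1 hm' _ (he i)).deriv, he0, jacobiDeriv_zero hφ.1 hm]
      change metric _ (extChartAt (𝓡 d) (φ q.1) (γ 0)) _ _ = _
      rw [h0, metric_chartVec hm]
      rcases j with _ | j
      · have h1 : parallelTransport φ q.1 (L (normalDir b none).2) = 0 := by
          simp only [normalDir, Option.elim, map_zero]
          exact map_zero (parallelTransportₗ d hφ.1 q.1)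
        rw [h1, inner_zero_left]
        rcases i with _ | i <;> simp [modelFieldDeriv]
      · have h1 := hoi (some j) i
        have h2 : (inner ℝ (parallelTransport φ q.1 (L (normalDir b (some j)).2))
          (initialFrame φ L q.1 b i) : ℝ) = if some j = i then 1 else 0 := h1
        rw [h2]
        rcases i with _ | i
        · simp
        · by_cases hij : j = i
          · subst hij; simp [modelFieldDeriv]
          · simp [hij, Ne.symm hij]
    · rcases i with _ | i <;> simp [modelField, modelFieldDeriv]
    · rcases i with _ | i
      · left; simp [modelField]
      · right; simp [modelFieldDeriv]
  · rw [hquad]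
    rcases curvForm_cases (γ s) (hTn s) (∑ i, x i • e i s) with ⟨h2, h3, h4⟩ | ⟨h2, h3⟩
    · rw [h4]
      exact mul_nonpos_of_nonpos_of_nonneg (hneg _ _ _ h2) h3.le
    · rw [h3]

end

end Fermi
end

noncomputable section
namespace Fermi
open Filter Topology
open scoped Matrix

/-! ### The Jacobian of the normal exponential map -/

lemma linearIndependent_normalDir {W ι : Type*} [NormedAddCommGroup W] [InnerProductSpace ℝ W]
    [Fintype ι] (b : OrthonormalBasis ι ℝ W) : LinearIndependent ℝ (normalDir b) := by
  rw [Fintype.linearIndependent_iff]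
  intro g hg
  rw [Fintype.sum_option] at hg
  have h1 : g none = 0 := by
    have := congrArg Prod.fst hg
    simpa [normalDir, Prod.fst_sum] using this
  have h2 : ∑ j, g (some j) • b j = 0 := by
    have := congrArg Prod.snd hg
    simpa [normalDir, Prod.snd_sum] using this
  have h3 := Fintype.linearIndependent_iff.1 b.orthonormal.linearIndependent _ h2
  rintro (_ | i)
  exacts [h1, h3 i]

lemma exists_orthonormalBasis_apply_eq {n : ℕ} {θ : EuclideanSpace ℝ (Fin n)} (hθ : ‖θ‖ = 1)
    (j₀ : Fin n) : ∃ b : OrthonormalBasis (Fin n) ℝ (EuclideanSpace ℝ (Fin n)), b j₀ = θ := by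
  have h : Orthonormal ℝ (({j₀} : Set (Fin n)).domRestrict fun _ ↦ θ) :=
    ⟨fun _ ↦ hθ, fun i j hij ↦ (hij (Subsingleton.elim i j)).elim⟩
  obtain ⟨b, hb⟩ := h.exists_orthonormalBasis_extension_of_card_eq (by simp)
  exact ⟨b, hb j₀ rfl⟩

section

variable {d : ℕ} {M : Type*} [EMetricSpace M]
  [ChartedSpace (EuclideanSpace ℝ (Fin d)) M]
  [IsManifold (𝓡 d) ∞ M] [RiemannianBundle (fun p : M ↦ TangentSpace (𝓡 d) p)]
  [IsContMDiffRiemannianBundle (𝓡 d) ∞ (EuclideanSpace ℝ (Fin d))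
      (fun p : M ↦ TangentSpace (𝓡 d) p)]
  {φ : ℝ → M} {L : EuclideanSpace ℝ (Fin (d - 1)) →ₗᵢ[ℝ] TangentSpace (𝓡 d) (φ 0)}

/-- The differential of the normal exponential map as a linear map. -/
def normalDiff (φ : ℝ → M) (L : EuclideanSpace ℝ (Fin (d - 1)) →ₗᵢ[ℝ] TangentSpace (𝓡 d) (φ 0))
    (q : ℝ × EuclideanSpace ℝ (Fin (d - 1))) :
    ℝ × EuclideanSpace ℝ (Fin (d - 1)) →ₗ[ℝ] TangentSpace (𝓡 d) (normalExp φ L q) where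
  toFun := mfderiv 𝓘(ℝ, ℝ × EuclideanSpace ℝ (Fin (d - 1))) (𝓡 d) (normalExp φ L) q
  map_add' v w := map_add (mfderiv 𝓘(ℝ, ℝ × EuclideanSpace ℝ (Fin (d - 1))) (𝓡 d)
    (normalExp φ L) q) v w
  map_smul' r v := map_smul (mfderiv 𝓘(ℝ, ℝ × EuclideanSpace ℝ (Fin (d - 1))) (𝓡 d)
    (normalExp φ L) q) r v

/-- The absolute value of the Jacobian determinant of the normal exponential map. -/
def normalJacobian (φ : ℝ → M)
    (L : EuclideanSpace ℝ (Fin (d - 1)) →ₗᵢ[ℝ] TangentSpace (𝓡 d) (φ 0))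
    (q : ℝ × EuclideanSpace ℝ (Fin (d - 1))) : ℝ :=
  √(Matrix.of fun i j ↦ (inner ℝ
    (normalDiff φ L q (normalDir (EuclideanSpace.basisFun (Fin (d - 1)) ℝ) i))
    (normalDiff φ L q (normalDir (EuclideanSpace.basisFun (Fin (d - 1)) ℝ) j)) : ℝ)).det

omit [IsManifold (𝓡 d) ∞ M] [IsContMDiffRiemannianBundle (𝓡 d) ∞ (EuclideanSpace ℝ (Fin d))
      (fun p : M ↦ TangentSpace (𝓡 d) p)] in
lemma normalJacobian_ne_zero {q : ℝ × EuclideanSpace ℝ (Fin (d - 1))}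
    (h : Function.Injective (mfderiv 𝓘(ℝ, ℝ × EuclideanSpace ℝ (Fin (d - 1))) (𝓡 d)
      (normalExp φ L) q)) : normalJacobian φ L q ≠ 0 := by
  have h1 : LinearIndependent ℝ fun i ↦ normalDiff φ L q
      (normalDir (EuclideanSpace.basisFun (Fin (d - 1)) ℝ) i) :=
    (linearIndependent_normalDir (EuclideanSpace.basisFun (Fin (d - 1)) ℝ)).map'
      (normalDiff φ L q) (LinearMap.ker_eq_bot.2 h)
  exact (Real.sqrt_pos.2 (Matrix.posDef_gram_of_linearIndependent h1).det_pos).ne'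

variable [CompleteSpace M] [IsRiemannianManifold (𝓡 d) M]

lemma inner_jacobiField (hφ : ContMDiff 𝓘(ℝ, ℝ) (𝓡 d) ∞ φ) (s : ℝ)
    (q a a' : ℝ × EuclideanSpace ℝ (Fin (d - 1))) :
    (inner ℝ (jacobiField φ L q a s) (jacobiField φ L q a' s) : ℝ)
      = inner ℝ (normalDiff φ L (q.1, s • q.2) (a.1, s • a.2))
          (normalDiff φ L (q.1, s • q.2) (a'.1, s • a'.2)) := by
  have hm := mem_extChartAt_source (I := 𝓡 d) (normalGeodesic φ L (s, q))
  have hm' : normalExp φ L (q.1, s • q.2)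
      ∈ (extChartAt (𝓡 d) (normalGeodesic φ L (s, q))).source := by
    rwa [← normalGeodesic_eq hφ]
  rw [← metric_chartVec hm, ← metric_chartVec hm', chartVec_jacobiField_eq hφ hm,
    chartVec_jacobiField_eq hφ hm, ← normalGeodesic_eq hφ]
  rfl

/-- The squared determinant is the Gram determinant of the Jacobi fields. These are images under the
differential of the basis vectors scaled by 1 in the direction u and by s in the d-1 normal
directions. -/
lemma abs_det_inner_jacobiField (hφ : ContMDiff 𝓘(ℝ, ℝ) (𝓡 d) ∞ φ) {s : ℝ} (hs : 0 < s)
    (q : ℝ × EuclideanSpace ℝ (Fin (d - 1)))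
    (b : OrthonormalBasis (Fin (d - 1)) ℝ (EuclideanSpace ℝ (Fin (d - 1))))
    (e : OrthonormalBasis (Option (Fin (d - 1))) ℝ
        (TangentSpace (𝓡 d) (normalGeodesic φ L (s, q)))) :
    |(Matrix.of fun i j ↦ (inner ℝ (jacobiField φ L q (normalDir b j) s) (e i) : ℝ)).det|
      = s ^ (d - 1) * normalJacobian φ L (q.1, s • q.2) := by
  have h1 := det_gram_eq_sq e fun j ↦ jacobiField φ L q (normalDir b j) s
  let σ : Option (Fin (d - 1)) → ℝ := fun i ↦ i.elim 1 fun _ ↦ s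
  have hσ : ∀ i, ((normalDir b i).1, s • (normalDir b i).2) = σ i • normalDir b i := by
    rintro (_ | i) <;> simp [normalDir, σ]
  have hσ' : ∀ i, normalDiff φ L (q.1, s • q.2) (σ i • normalDir b i)
      = ∑ k, Matrix.diagonal σ k i • normalDiff φ L (q.1, s • q.2) (normalDir b k) := by
    intro i
    rw [Finset.sum_eq_single i (fun k _ hk ↦ by rw [Matrix.diagonal_apply_ne _ hk, zero_smul])
      (fun hi ↦ (hi (Finset.mem_univ i)).elim), Matrix.diagonal_apply_eq, map_smul]
  have hdet : (Matrix.diagonal σ).det = s ^ (d - 1) := by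
    rw [Matrix.det_diagonal, Fintype.prod_option]
    simp [σ]
  simp_rw [inner_jacobiField hφ, hσ, hσ'] at h1
  rw [det_gram_sum_smul, hdet, det_gram_normalDir b (EuclideanSpace.basisFun (Fin (d - 1)) ℝ)] at h1
  rw [← Real.sqrt_sq_eq_abs, ← h1, Real.sqrt_mul (by positivity), Real.sqrt_sq (by positivity)]
  rfl

omit [EMetricSpace M] [ChartedSpace (EuclideanSpace ℝ (Fin d)) M]
  [IsManifold (𝓡 d) ∞ M] [RiemannianBundle (fun p : M ↦ TangentSpace (𝓡 d) p)]
  [IsContMDiffRiemannianBundle (𝓡 d) ∞ (EuclideanSpace ℝ (Fin d))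
      (fun p : M ↦ TangentSpace (𝓡 d) p)] [CompleteSpace M] [IsRiemannianManifold (𝓡 d) M] in
lemma modelField_pos {n : ℕ} {c : ℝ} (hc : 0 < c) (j₀ : Fin n) {s : ℝ} (hs : 0 < s)
    (i : Option (Fin n)) : 0 < modelField c j₀ i s := by
  have hc' := Real.sqrt_pos.2 hc
  rcases i with _ | i
  · exact Real.cosh_pos _
  · simp only [modelField, Option.elim]
    split_ifs
    · exact hs
    · exact div_pos (Real.sinh_pos_iff.2 (by positivity)) hc'

lemma prod_modelField {n : ℕ} (c : ℝ) (j₀ : Fin n) (s : ℝ) :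
    ∏ i, modelField c j₀ i s
      = Real.cosh (√c * s) * (s * (Real.sinh (√c * s) / √c) ^ (n - 1)) := by
  rw [Fintype.prod_option, ← Finset.mul_prod_erase _ _ (Finset.mem_univ j₀)]
  have h : ∀ j ∈ Finset.univ.erase j₀,
      modelField c j₀ (some j) s = Real.sinh (√c * s) / √c := fun j hj ↦ by
    simp [modelField, Finset.ne_of_mem_erase hj]
  rw [Finset.prod_congr rfl h, Finset.prod_const, Finset.card_erase_of_mem (Finset.mem_univ _)]
  simp [modelField]

/-- The density of the model volume. -/
def modelDensity (d : ℕ) (c h : ℝ) : ℝ :=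
  c ^ (-((d : ℝ) - 2) / 2) * Real.sinh (√c * h) ^ (d - 2) * Real.cosh (√c * h)

/-- Comparison of determinants gives H^(d-1) times the Jacobian ≤ cosh · H · (sinh/√c)^(d-2). The
radial factor H cancels. Either alternative of `h` supplies the nonvanishing determinants before H.
-/
lemma normalJacobian_le (hd : 2 ≤ d) (hφ : IsGeodesic d φ)
    (hunit : ∀ t, ‖velocity (d := d) φ t‖ = 1)
    (hL : ∀ w, inner ℝ (L w) (velocity (d := d) φ 0) = 0) {c : ℝ} (hc : 0 < c)
    (hcurv : ∀ (p : M) (v w : TangentSpace (𝓡 d) p), LinearIndependent ℝ ![v, w] →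
      -c ≤ sectionalCurvature p v w)
    {u H : ℝ} (hH : 0 < H) {θ : EuclideanSpace ℝ (Fin (d - 1))} (hθ : ‖θ‖ = 1)
    (h : (∀ s ∈ Ioo 0 H, Function.Injective
        (mfderiv 𝓘(ℝ, ℝ × EuclideanSpace ℝ (Fin (d - 1))) (𝓡 d) (normalExp φ L) (u, s • θ))) ∨
      ∀ (p : M) (v w : TangentSpace (𝓡 d) p), LinearIndependent ℝ ![v, w] →
        sectionalCurvature p v w ≤ 0) :
    H ^ (d - 2) * normalJacobian φ L (u, H • θ) ≤ modelDensity d c H := by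
  -- A basis containing θ isolates the radial direction at index 0, which exists because d ≥ 2.
  obtain ⟨b, hb⟩ := exists_orthonormalBasis_apply_eq hθ (⟨0, by omega⟩ : Fin (d - 1))
  obtain ⟨e, A, A', R, hA, hAe, hR⟩ := jacobiComparison hd hφ hunit hL hc hcurv (u, θ) b hb
  have hdet : ∀ s, 0 < s → |(A s).det| = s ^ (d - 1) * normalJacobian φ L (u, s • θ) := by
    intro s hs
    rw [hAe s]
    exact abs_det_inner_jacobiField hφ.1 hs (u, θ) b (e s)
  have h1 := hA.abs_det_le hH (fun s hs i ↦ modelField_pos hc _ hs.1 i) fun s hs ↦ by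
    rcases h with h | h
    · rw [← abs_ne_zero, hdet s hs.1]
      exact mul_ne_zero (pow_pos hs.1 _).ne' (normalJacobian_ne_zero (h s hs))
    · exact hA.det_ne_zero_of_nonpos (hR h) hs.1
  rw [hdet H hH, prod_modelField] at h1
  have hd' : H ^ (d - 1) = H ^ (d - 2) * H := by
    rw [← pow_succ]
    congr 1
    omega
  have hd'' : d - 1 - 1 = d - 2 := by omega
  rw [hd', hd''] at h1
  have hsq := Real.sqrt_pos.2 hc
  have hpow : c ^ (-((d : ℝ) - 2) / 2) = ((√c) ^ (d - 2))⁻¹ := by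
    rw [Real.sqrt_eq_rpow, ← Real.rpow_natCast, ← Real.rpow_mul hc.le, ← Real.rpow_neg hc.le,
      Nat.cast_sub hd]
    congr 1
    push_cast
    ring
  refine le_of_mul_le_mul_right ?_ hH
  calc H ^ (d - 2) * normalJacobian φ L (u, H • θ) * H
      = H ^ (d - 2) * H * normalJacobian φ L (u, H • θ) := by ring
    _ ≤ _ := h1
    _ = modelDensity d c H * H := by
      rw [modelDensity, hpow, div_pow]
      ring

end

end Fermi
end

noncomputable section
namespace Fermi
open Filter Topology

/-! ### Volumes of images -/

lemma measurableSet_inter_preimage_of_continuousOn {X Y : Type*} [TopologicalSpace X]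
    [MeasurableSpace X] [BorelSpace X] [TopologicalSpace Y] [MeasurableSpace Y] [BorelSpace Y]
    {f : X → Y} {S : Set X} {B : Set Y} (hf : ContinuousOn f S) (hS : MeasurableSet S)
    (hB : MeasurableSet B) : MeasurableSet (S ∩ f ⁻¹' B) := by
  have h1 := hS.subtype_image (hf.domRestrict.measurable hB)
  have h2 : S.domRestrict f ⁻¹' B = Subtype.val ⁻¹' (f ⁻¹' B) := rfl
  rwa [h2, Subtype.image_preimage_coe] at h1

/-- The image measure inequality needs no injectivity. It is lifted to measures, restriction to the
image ≤ pushforward of the Jacobian measure, so that ρ need not be measurable. -/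
lemma withDensity_image_le {F : Type*} [NormedAddCommGroup F] [NormedSpace ℝ F]
    [FiniteDimensional ℝ F] [MeasurableSpace F] [BorelSpace F] (μ : Measure F)
    [μ.IsAddHaarMeasure] {f : F → F} {S : Set F} (hS : MeasurableSet S)
    (hf : ∀ y ∈ S, DifferentiableAt ℝ f y) (ρ : F → ℝ≥0∞) :
    μ.withDensity ρ (f '' S)
      ≤ ∫⁻ y in S, ENNReal.ofReal |(fderiv ℝ f y).det| * ρ (f y) ∂μ := by
  set D : F → ℝ≥0∞ := fun y ↦ ENNReal.ofReal |(fderiv ℝ f y).det| with hD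
  have hDm : Measurable D :=
    (continuous_abs.measurable.comp (ContinuousLinearMap.continuous_det.measurable.comp
      (measurable_fderiv ℝ f))).ennreal_ofReal
  have hc : ContinuousOn f S := fun y hy ↦ (hf y hy).continuousAt.continuousWithinAt
  have hle : μ.restrict (f '' S) ≤ ((μ.restrict S).withDensity D).map f := by
    refine Measure.le_iff.2 fun B hB ↦ ?_
    have hSB : MeasurableSet (S ∩ f ⁻¹' B) :=
      measurableSet_inter_preimage_of_continuousOn hc hS hB
    have hfm : AEMeasurable f ((μ.restrict S).withDensity D) :=
      (hc.aemeasurable hS).mono_ac (withDensity_absolutelyContinuous _ _)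
    rw [Measure.restrict_apply hB, Measure.map_apply_of_aemeasurable hfm hB, inter_comm,
      ← image_inter_preimage]
    calc μ (f '' (S ∩ f ⁻¹' B)) ≤ ∫⁻ y in S ∩ f ⁻¹' B, D y ∂μ :=
          addHaar_image_le_lintegral_abs_det_fderiv μ hSB fun y hy ↦
            (hf y hy.1).hasFDerivAt.hasFDerivWithinAt
      _ = (μ.restrict S).withDensity D (S ∩ f ⁻¹' B) := by
          rw [withDensity_apply _ hSB, Measure.restrict_restrict hSB, inter_right_comm, inter_self]
      _ ≤ _ := measure_mono inter_subset_right
  calc μ.withDensity ρ (f '' S) = ∫⁻ y in f '' S, ρ y ∂μ := withDensity_apply' _ _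
    _ ≤ ∫⁻ y, ρ y ∂((μ.restrict S).withDensity D).map f := lintegral_mono' hle le_rfl
    _ ≤ ∫⁻ y, ρ (f y) ∂(μ.restrict S).withDensity D := lintegral_map_le _ _
    _ ≤ _ := lintegral_withDensity_le_lintegral_mul _ hDm _

section

variable {d : ℕ} {M : Type*} [TopologicalSpace M] [ChartedSpace (EuclideanSpace ℝ (Fin d)) M]
  [IsManifold (𝓡 d) ∞ M] [RiemannianBundle (fun p : M ↦ TangentSpace (𝓡 d) p)]

/-- The Jacobian determinant of a map from Euclidean space to a Riemannian manifold. -/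
def jacobian (G : EuclideanSpace ℝ (Fin d) → M) (y : EuclideanSpace ℝ (Fin d)) : ℝ :=
  √(Matrix.of fun i j ↦ (inner ℝ
    (mfderiv 𝓘(ℝ, EuclideanSpace ℝ (Fin d)) (𝓡 d) G y (EuclideanSpace.single i 1) :
      TangentSpace (𝓡 d) (G y))
    (mfderiv 𝓘(ℝ, EuclideanSpace ℝ (Fin d)) (𝓡 d) G y (EuclideanSpace.single j 1) :
      TangentSpace (𝓡 d) (G y)) : ℝ)).det

omit [IsManifold (𝓡 d) ∞ M] [RiemannianBundle (fun p : M ↦ TangentSpace (𝓡 d) p)] in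
lemma coordVec_eq_sum (x : M) (y v : EuclideanSpace ℝ (Fin d)) :
    coordVec x y v = ∑ k, v k • coordVec x y (EuclideanSpace.single k (1 : ℝ)) := by
  let T : EuclideanSpace ℝ (Fin d) →ₗ[ℝ] TangentSpace (𝓡 d) ((extChartAt (𝓡 d) x).symm y) :=
    { toFun := coordVec x y
      map_add' := coordVec_add x y
      map_smul' := coordVec_smul x y }
  have h := congrArg T ((EuclideanSpace.basisFun (Fin d) ℝ).sum_repr v)
  simp only [map_sum, map_smul, EuclideanSpace.basisFun_apply, EuclideanSpace.basisFun_repr] at h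
  exact h.symm

omit [TopologicalSpace M] [ChartedSpace (EuclideanSpace ℝ (Fin d)) M] [IsManifold (𝓡 d) ∞ M]
  [RiemannianBundle (fun p : M ↦ TangentSpace (𝓡 d) p)] in
lemma det_of_apply_single (f : EuclideanSpace ℝ (Fin d) →L[ℝ] EuclideanSpace ℝ (Fin d)) :
    (Matrix.of fun k i ↦ f (EuclideanSpace.single i 1) k).det = f.det := by
  have h : (Matrix.of fun k i ↦ f (EuclideanSpace.single i 1) k)
      = LinearMap.toMatrix (EuclideanSpace.basisFun (Fin d) ℝ).toBasis
        (EuclideanSpace.basisFun (Fin d) ℝ).toBasis (f : _ →ₗ[ℝ] _) := by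
    ext k i
    simp [LinearMap.toMatrix_apply]
  rw [h]
  exact LinearMap.det_toMatrix _ _

omit [IsManifold (𝓡 d) ∞ M] in
lemma det_metric_apply_single (x : M) (y : EuclideanSpace ℝ (Fin d))
    (f : EuclideanSpace ℝ (Fin d) →L[ℝ] EuclideanSpace ℝ (Fin d)) :
    (Matrix.of fun i j ↦ metric x y (f (EuclideanSpace.single i 1))
      (f (EuclideanSpace.single j 1))).det = f.det ^ 2 * (gram x y).det := by
  have h := det_gram_sum_smul (fun k ↦ coordVec x y (EuclideanSpace.single k (1 : ℝ)))
    (Matrix.of fun k i ↦ f (EuclideanSpace.single i 1) k)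
  simp only [Matrix.of_apply, ← coordVec_eq_sum, det_of_apply_single] at h
  exact h

lemma jacobian_eq {G : EuclideanSpace ℝ (Fin d) → M} {x : M} {y : EuclideanSpace ℝ (Fin d)}
    (hG : MDifferentiableAt 𝓘(ℝ, EuclideanSpace ℝ (Fin d)) (𝓡 d) G y)
    (hy : G y ∈ (extChartAt (𝓡 d) x).source) :
    jacobian G y = |(fderiv ℝ (fun y ↦ extChartAt (𝓡 d) x (G y)) y).det|
      * √(gram x (extChartAt (𝓡 d) x (G y))).det := by
  rw [← Real.sqrt_sq_eq_abs, ← Real.sqrt_mul (sq_nonneg _), ← det_metric_apply_single, jacobian]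
  simp only [← chartVec_mfderiv hG hy, metric_chartVec hy]

variable [MeasurableSpace M] [BorelSpace M]

variable (d) in
omit [IsManifold (𝓡 d) ∞ M] [RiemannianBundle (fun p : M ↦ TangentSpace (𝓡 d) p)] in
lemma aemeasurable_extChartAt_symm (x : M) (ρ : EuclideanSpace ℝ (Fin d) → ℝ≥0∞) :
    AEMeasurable (extChartAt (𝓡 d) x).symm
      ((volume.restrict (extChartAt (𝓡 d) x).target).withDensity ρ) :=
  ((continuousOn_extChartAt_symm x).aemeasurable
    (isOpen_extChartAt_target x).measurableSet).mono_ac (withDensity_absolutelyContinuous _ _)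

-- The set A need not be measurable: it is enlarged to the preimage of a measurable hull of its
-- coordinate image.
omit [IsManifold (𝓡 d) ∞ M] in
lemma chartVolume_le {x : M} {A : Set M} (hA : A ⊆ (extChartAt (𝓡 d) x).source) :
    chartVolume d x A
      ≤ (volume.withDensity fun y : EuclideanSpace ℝ (Fin d) ↦ ENNReal.ofReal (√(gram x y).det))
      (extChartAt (𝓡 d) x '' A) := by
  set μ := volume.withDensity fun y : EuclideanSpace ℝ (Fin d) ↦
    ENNReal.ofReal (√(gram x y).det) with hμ
  set Z := toMeasurable μ (extChartAt (𝓡 d) x '' A) with hZ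
  have hZm : MeasurableSet Z := measurableSet_toMeasurable _ _
  have htm : MeasurableSet (extChartAt (𝓡 d) x).target := (isOpen_extChartAt_target x).measurableSet
  have hsm : MeasurableSet (extChartAt (𝓡 d) x).source := (isOpen_extChartAt_source x).measurableSet
  have hB : MeasurableSet ((extChartAt (𝓡 d) x).source ∩ extChartAt (𝓡 d) x ⁻¹' Z) :=
    measurableSet_inter_preimage_of_continuousOn (continuousOn_extChartAt x) hsm hZm
  rw [← measure_toMeasurable (μ := μ), ← hZ]
  calc chartVolume d x A
      ≤ chartVolume d x ((extChartAt (𝓡 d) x).source ∩ extChartAt (𝓡 d) x ⁻¹' Z) :=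
        measure_mono fun p hp ↦ ⟨hA hp, subset_toMeasurable _ _ ⟨p, hp, rfl⟩⟩
    _ = (μ.restrict (extChartAt (𝓡 d) x).target) ((extChartAt (𝓡 d) x).symm ⁻¹'
          ((extChartAt (𝓡 d) x).source ∩ extChartAt (𝓡 d) x ⁻¹' Z)) := by
        rw [chartVolume, Measure.map_apply_of_aemeasurable (aemeasurable_extChartAt_symm d x _) hB,
          restrict_withDensity htm]
    _ ≤ μ Z := by
        rw [Measure.restrict_apply' htm]
        refine measure_mono ?_
        rintro y ⟨⟨-, hy⟩, hy'⟩
        rwa [mem_preimage, (extChartAt (𝓡 d) x).right_inv hy'] at hy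

lemma chartVolume_image_le {G : EuclideanSpace ℝ (Fin d) → M} {x : M}
    {S : Set (EuclideanSpace ℝ (Fin d))} (hS : MeasurableSet S)
    (hG : ∀ y ∈ S, MDifferentiableAt 𝓘(ℝ, EuclideanSpace ℝ (Fin d)) (𝓡 d) G y)
    (hGS : ∀ y ∈ S, G y ∈ (extChartAt (𝓡 d) x).source) :
    chartVolume d x (G '' S) ≤ ∫⁻ y in S, ENNReal.ofReal (jacobian G y) := by
  refine (chartVolume_le (image_subset_iff.2 hGS)).trans ?_
  rw [← image_comp]
  refine (withDensity_image_le volume hS (fun y hy ↦ ?_) _).trans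
    (setLIntegral_mono' hS fun y hy ↦ ?_)
  · exact (((contMDiffAt_extChartAt_of_mem (hGS y hy)).mdifferentiableAt (by simp)).comp y
      (hG y hy)).differentiableAt
  · rw [jacobian_eq (hG y hy) (hGS y hy), ENNReal.ofReal_mul (abs_nonneg _)]
    rfl

/-- The image estimate is applied to the inverse of the chart at x', whose Jacobian is √det g by
definition. Exchanging the two charts gives equality on overlaps. -/
lemma chartVolume_le_chartVolume {x x' : M} {B : Set M} (hB : MeasurableSet B)
    (hBx : B ⊆ (extChartAt (𝓡 d) x').source) : chartVolume d x B ≤ chartVolume d x' B := by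
  have htm : ∀ x : M, MeasurableSet (extChartAt (𝓡 d) x).target := fun x ↦
    (isOpen_extChartAt_target x).measurableSet
  have hm : ∀ (x : M) {B : Set M}, MeasurableSet B →
      MeasurableSet ((extChartAt (𝓡 d) x).target ∩ (extChartAt (𝓡 d) x).symm ⁻¹' B) := fun x _ hB ↦
    measurableSet_inter_preimage_of_continuousOn (continuousOn_extChartAt_symm x) (htm x) hB
  have hdiff : ∀ y ∈ (extChartAt (𝓡 d) x').target, MDifferentiableAt
      𝓘(ℝ, EuclideanSpace ℝ (Fin d)) (𝓡 d) (extChartAt (𝓡 d) x').symm y := fun y hy ↦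
    (contMDiffAt_extChartAt_symm hy).mdifferentiableAt (by simp)
  have hsm : MeasurableSet (extChartAt (𝓡 d) x).source := (isOpen_extChartAt_source x).measurableSet
  have hval : ∀ {x : M} {B : Set M}, MeasurableSet B → chartVolume d x B
      = ∫⁻ y in (extChartAt (𝓡 d) x).target ∩ (extChartAt (𝓡 d) x).symm ⁻¹' B,
        ENNReal.ofReal (√(gram x y).det) := by
    intro x B hB
    rw [chartVolume, Measure.map_apply_of_aemeasurable (aemeasurable_extChartAt_symm d x _) hB,
      withDensity_apply', Measure.restrict_restrict' (htm x), inter_comm]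
  -- The measure `chartVolume d x` is carried by the domain of its own chart.
  have hzero : chartVolume d x (B \ (extChartAt (𝓡 d) x).source) = 0 := by
    rw [hval (hB.diff hsm)]
    convert! setLIntegral_empty _
    refine eq_empty_of_forall_notMem fun y hy ↦ hy.2.2 ((extChartAt (𝓡 d) x).map_target hy.1)
  have hB' := hB.inter hsm
  calc chartVolume d x B
      ≤ chartVolume d x (B ∩ (extChartAt (𝓡 d) x).source)
        + chartVolume d x (B \ (extChartAt (𝓡 d) x).source) := measure_le_inter_add_sdiff _ _ _
    _ = chartVolume d x (B ∩ (extChartAt (𝓡 d) x).source) := by rw [hzero, add_zero]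
    _ ≤ chartVolume d x ((extChartAt (𝓡 d) x').symm '' ((extChartAt (𝓡 d) x').target
          ∩ (extChartAt (𝓡 d) x').symm ⁻¹' (B ∩ (extChartAt (𝓡 d) x).source))) := by
        refine measure_mono fun p hp ↦ ⟨extChartAt (𝓡 d) x' p, ⟨(extChartAt (𝓡 d) x').map_source
          (hBx hp.1), ?_⟩, (extChartAt (𝓡 d) x').left_inv (hBx hp.1)⟩
        rwa [mem_preimage, (extChartAt (𝓡 d) x').left_inv (hBx hp.1)]
    _ ≤ _ := chartVolume_image_le (hm x' hB') (fun y hy ↦ hdiff y hy.1) fun y hy ↦ hy.2.2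
    _ = chartVolume d x' (B ∩ (extChartAt (𝓡 d) x).source) := (hval hB').symm
    _ ≤ _ := measure_mono inter_subset_left

/-- Every measure in the supremum is bounded, piece by piece, by the volumes of the charts
containing the pieces. -/
lemma riemannianVolume_le_sum {ι : Type*} [Countable ι] {x : ι → M} {A : ι → Set M}
    (hA : ∀ n, MeasurableSet (A n)) (hcov : ⋃ n, A n = univ)
    (hAx : ∀ n, A n ⊆ (extChartAt (𝓡 d) (x n)).source) :
    riemannianVolume d M ≤ Measure.sum fun n ↦ (chartVolume d (x n)).restrict (A n) := by
  refine iSup_le fun x' ↦ Measure.le_iff.2 fun B hB ↦ ?_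
  rw [Measure.sum_apply _ hB]
  calc chartVolume d x' B = chartVolume d x' (⋃ n, B ∩ A n) := by
        rw [← inter_iUnion, hcov, inter_univ]
    _ ≤ ∑' n, chartVolume d x' (B ∩ A n) := measure_iUnion_le _
    _ ≤ _ := ENNReal.tsum_le_tsum fun n ↦ by
        rw [Measure.restrict_apply hB]
        exact chartVolume_le_chartVolume (hB.inter (hA n)) (inter_subset_right.trans (hAx n))

-- Second countability gives a countable cover by chart domains, which is then made disjoint.
omit [IsManifold (𝓡 d) ∞ M] [RiemannianBundle (fun p : M ↦ TangentSpace (𝓡 d) p)] in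
lemma exists_disjoint_chart_cover [SecondCountableTopology M] [Nonempty M] :
    ∃ (x : ℕ → M) (A : ℕ → Set M), (∀ n, MeasurableSet (A n)) ∧
      Pairwise (Function.onFun Disjoint A) ∧ ⋃ n, A n = univ ∧
      ∀ n, A n ⊆ (extChartAt (𝓡 d) (x n)).source := by
  obtain ⟨s, hs, hsu⟩ := TopologicalSpace.countable_cover_nhds
    fun x : M ↦ extChartAt_source_mem_nhds (I := 𝓡 d) x
  have hne : s.Nonempty := by
    by_contra h
    rw [not_nonempty_iff_eq_empty.1 h] at hsu
    simp only [mem_empty_iff_false, iUnion_of_empty, iUnion_empty] at hsu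
    exact empty_ne_univ hsu
  obtain ⟨x, rfl⟩ := hs.exists_eq_range hne
  refine ⟨x, disjointed fun n ↦ (extChartAt (𝓡 d) (x n)).source, fun n ↦
    MeasurableSet.disjointed (fun n ↦ (isOpen_extChartAt_source (x n)).measurableSet) n,
    disjoint_disjointed _, ?_, fun n ↦ disjointed_subset _ n⟩
  rw [iUnion_disjointed, ← hsu, biUnion_range]

/-- The source is cut along the preimages of a disjoint chart cover, so the chart estimates add up
to a single integral without overcounting. -/
lemma riemannianVolume_image_le [SecondCountableTopology M]
    {G : EuclideanSpace ℝ (Fin d) → M} (hG : MDifferentiable 𝓘(ℝ, EuclideanSpace ℝ (Fin d)) (𝓡 d) G)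
    {S : Set (EuclideanSpace ℝ (Fin d))} (hS : MeasurableSet S) :
    riemannianVolume d M (G '' S) ≤ ∫⁻ y in S, ENNReal.ofReal (jacobian G y) := by
  have : Nonempty M := ⟨G 0⟩
  obtain ⟨x, A, hA, hdisj, hcov, hAx⟩ := exists_disjoint_chart_cover (d := d) (M := M)
  have hm : ∀ n, MeasurableSet (S ∩ G ⁻¹' A n) := fun n ↦
    hS.inter (hG.continuous.measurable (hA n))
  calc riemannianVolume d M (G '' S)
      ≤ ∑' n, (chartVolume d (x n)).restrict (A n) (G '' S) := by
        rw [← Measure.sum_apply_of_countable]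
        exact riemannianVolume_le_sum hA hcov hAx _
    _ ≤ ∑' n, ∫⁻ y in S ∩ G ⁻¹' A n, ENNReal.ofReal (jacobian G y) :=
        ENNReal.tsum_le_tsum fun n ↦ by
          rw [Measure.restrict_apply' (hA n), ← image_inter_preimage]
          exact chartVolume_image_le (hm n) (fun y _ ↦ hG y) fun y hy ↦ hAx n hy.2
    _ = _ := by
        rw [← lintegral_iUnion hm (fun i j hij ↦ ((hdisj hij).preimage G).mono inter_subset_right
          inter_subset_right), ← inter_iUnion, ← preimage_iUnion, hcov, preimage_univ, inter_univ]

end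

end Fermi
end

noncomputable section
namespace Fermi
open Filter Topology

/-! ### Volumes in Fermi coordinates -/

/-- The splitting of the first coordinate of `ℝ^(n+1)`. -/
def splitCoord (n : ℕ) :
    EuclideanSpace ℝ (Fin (n + 1)) ≃L[ℝ] ℝ × EuclideanSpace ℝ (Fin n) :=
  LinearEquiv.toContinuousLinearEquiv
    { toFun := fun y ↦ (y 0, WithLp.toLp 2 fun j ↦ y j.succ)
      map_add' := fun _ _ ↦ rfl
      map_smul' := fun _ _ ↦ rfl
      invFun := fun z ↦ WithLp.toLp 2 (Fin.cons z.1 z.2)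
      left_inv := fun y ↦ by
        ext i
        refine Fin.cases ?_ (fun j ↦ ?_) i <;> rfl
      right_inv := fun _ ↦ rfl }

lemma splitCoord_apply {n : ℕ} (y : EuclideanSpace ℝ (Fin (n + 1))) :
    splitCoord n y = (y 0, WithLp.toLp 2 fun j ↦ y j.succ) := rfl

lemma splitCoord_single (n : ℕ) (i : Fin (n + 1)) :
    splitCoord n (EuclideanSpace.single i 1)
      = normalDir (EuclideanSpace.basisFun (Fin n) ℝ) (finSuccEquiv n i) := by
  rw [splitCoord_apply]
  refine Fin.cases ?_ (fun j ↦ ?_) i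
  · refine Prod.ext ?_ ?_
    · simp [normalDir]
    · ext j
      simp [normalDir]
  · refine Prod.ext ?_ ?_
    · simp [normalDir]
    · ext k
      simp [normalDir]

lemma measurePreserving_splitCoord (n : ℕ) : MeasurePreserving (splitCoord n) := by
  have h1 := PiLp.volume_preserving_ofLp (Fin (n + 1))
  have h2 := volume_preserving_piFinSuccAbove (fun _ : Fin (n + 1) ↦ ℝ) 0
  have h3 := (MeasurePreserving.id (volume : Measure ℝ)).prod (PiLp.volume_preserving_toLp (Fin n))
  exact (h3.comp h2).comp h1

/-- The volume estimate is stated on Euclidean space, while ℝ × ℝ^(d-1) has the product norm; a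
linear measure-preserving splitting passes between them. -/
lemma exists_measurePreserving_splitting {d : ℕ} (hd : 1 ≤ d) :
    ∃ (Ψ : EuclideanSpace ℝ (Fin d) ≃L[ℝ] ℝ × EuclideanSpace ℝ (Fin (d - 1)))
      (σ : Fin d ≃ Option (Fin (d - 1))),
      (∀ i, Ψ (EuclideanSpace.single i 1)
        = normalDir (EuclideanSpace.basisFun (Fin (d - 1)) ℝ) (σ i)) ∧ MeasurePreserving Ψ := by
  obtain ⟨n, rfl⟩ : ∃ n, d = n + 1 := ⟨d - 1, by omega⟩
  exact ⟨splitCoord n, finSuccEquiv n, splitCoord_single n, measurePreserving_splitCoord n⟩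

section

variable {d : ℕ} {M : Type*} [EMetricSpace M] [CompleteSpace M] [SecondCountableTopology M]
  [ChartedSpace (EuclideanSpace ℝ (Fin d)) M]
  [IsManifold (𝓡 d) ∞ M] [RiemannianBundle (fun p : M ↦ TangentSpace (𝓡 d) p)]
  [IsContMDiffRiemannianBundle (𝓡 d) ∞ (EuclideanSpace ℝ (Fin d))
      (fun p : M ↦ TangentSpace (𝓡 d) p)] [IsRiemannianManifold (𝓡 d) M]
  [MeasurableSpace M] [BorelSpace M]
  {φ : ℝ → M} {L : EuclideanSpace ℝ (Fin (d - 1)) →ₗᵢ[ℝ] TangentSpace (𝓡 d) (φ 0)}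

omit [MeasurableSpace M] [BorelSpace M] [SecondCountableTopology M] in
lemma jacobian_normalExp_comp (hφ : ContMDiff 𝓘(ℝ, ℝ) (𝓡 d) ∞ φ)
    (Ψ : EuclideanSpace ℝ (Fin d) ≃L[ℝ] ℝ × EuclideanSpace ℝ (Fin (d - 1)))
    (σ : Fin d ≃ Option (Fin (d - 1)))
    (hΨ : ∀ i, Ψ (EuclideanSpace.single i 1)
      = normalDir (EuclideanSpace.basisFun (Fin (d - 1)) ℝ) (σ i)) (y : EuclideanSpace ℝ (Fin d)) :
    jacobian (normalExp φ L ∘ Ψ) y = normalJacobian φ L (Ψ y) := by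
  have h1 : mfderiv 𝓘(ℝ, EuclideanSpace ℝ (Fin d)) (𝓡 d) (normalExp φ L ∘ Ψ) y
      = (mfderiv 𝓘(ℝ, ℝ × EuclideanSpace ℝ (Fin (d - 1))) (𝓡 d) (normalExp φ L) (Ψ y)).comp
        (mfderiv 𝓘(ℝ, EuclideanSpace ℝ (Fin d)) 𝓘(ℝ, ℝ × EuclideanSpace ℝ (Fin (d - 1))) Ψ y) :=
    mfderiv_comp y ((contMDiff_normalExp hφ (Ψ y)).mdifferentiableAt (by simp))
      Ψ.differentiableAt.mdifferentiableAt
  have h2 : ∀ i, (mfderiv 𝓘(ℝ, EuclideanSpace ℝ (Fin d)) (𝓡 d) (normalExp φ L ∘ Ψ) y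
      (EuclideanSpace.single i 1) : TangentSpace (𝓡 d) (normalExp φ L (Ψ y)))
      = normalDiff φ L (Ψ y) (normalDir (EuclideanSpace.basisFun (Fin (d - 1)) ℝ) (σ i)) := by
    intro i
    rw [h1, mfderiv_eq_fderiv, Ψ.fderiv, ← hΨ]
    rfl
  rw [jacobian, normalJacobian, ← Matrix.det_submatrix_equiv_self σ]
  congr 2
  ext i j
  simp only [Matrix.submatrix_apply, Matrix.of_apply, ← h2]

lemma riemannianVolume_normalExp_image_le (hd : 1 ≤ d) (hφ : ContMDiff 𝓘(ℝ, ℝ) (𝓡 d) ∞ φ)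
    {T : Set (ℝ × EuclideanSpace ℝ (Fin (d - 1)))} (hT : MeasurableSet T) :
    riemannianVolume d M (normalExp φ L '' T)
      ≤ ∫⁻ q in T, ENNReal.ofReal (normalJacobian φ L q) := by
  obtain ⟨Ψ, σ, hΨ, hΨm⟩ := exists_measurePreserving_splitting hd
  have hG : MDifferentiable 𝓘(ℝ, EuclideanSpace ℝ (Fin d)) (𝓡 d) (normalExp φ L ∘ Ψ) := fun y ↦
    ((contMDiff_normalExp hφ (Ψ y)).mdifferentiableAt (by simp)).comp y
      Ψ.differentiableAt.mdifferentiableAt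
  have h := riemannianVolume_image_le hG (Ψ.continuous.measurable hT)
  rw [image_comp, image_preimage_eq _ Ψ.surjective] at h
  refine h.trans_eq ?_
  simp_rw [jacobian_normalExp_comp hφ Ψ σ hΨ]
  exact hΨm.setLIntegral_comp_preimage_emb Ψ.toHomeomorph.measurableEmbedding
    (fun q ↦ ENNReal.ofReal (normalJacobian φ L q)) T

end

/-- The origin is removed as a null set, and the homeomorphism of its complement with sphere × (0,∞)
carries the measure to a product with radial density h^(n-1). -/
lemma lintegral_polar {E : Type*} [NormedAddCommGroup E] [NormedSpace ℝ E]
    [FiniteDimensional ℝ E] [Nontrivial E] [MeasurableSpace E] [BorelSpace E] (μ : Measure E)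
    [μ.IsAddHaarMeasure] {g : E → ℝ≥0∞} (hg : Measurable g) :
    ∫⁻ w, g w ∂μ = ∫⁻ h in Ioi (0 : ℝ), ∫⁻ θ : Metric.sphere (0 : E) 1,
      ENNReal.ofReal (h ^ (Module.finrank ℝ E - 1)) * g (h • (θ : E)) ∂μ.toSphere := by
  let k : Metric.sphere (0 : E) 1 × Ioi (0 : ℝ) → ℝ≥0∞ := fun z ↦ g ((z.2 : ℝ) • (z.1 : E))
  have hk : Measurable k := by
    refine hg.comp (Continuous.measurable ?_)
    fun_prop
  have hmp := μ.measurePreserving_homeomorphUnitSphereProd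
  calc ∫⁻ w, g w ∂μ = ∫⁻ w : ({(0)}ᶜ : Set E), g w ∂(μ.comap (↑)) := by
        rw [lintegral_subtype_comap (measurableSet_singleton _).compl g, restrict_compl_singleton]
    _ = ∫⁻ w : ({(0)}ᶜ : Set E), k (homeomorphUnitSphereProd E w) ∂(μ.comap (↑)) := by
        refine lintegral_congr fun w ↦ ?_
        change _ = g _
        congr 1
        exact (congrArg Subtype.val ((homeomorphUnitSphereProd E).symm_apply_apply w)).symm
    _ = ∫⁻ z, k z ∂(μ.toSphere.prod (Measure.volumeIoiPow (Module.finrank ℝ E - 1))) := by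
        exact hmp.lintegral_comp hk
    _ = ∫⁻ h, ∫⁻ θ, k (θ, h) ∂μ.toSphere ∂(Measure.volumeIoiPow (Module.finrank ℝ E - 1)) :=
        lintegral_prod_symm' _ hk
    _ = ∫⁻ h : Ioi (0 : ℝ), ENNReal.ofReal ((h : ℝ) ^ (Module.finrank ℝ E - 1))
          * ∫⁻ θ, k (θ, h) ∂μ.toSphere ∂(volume.comap (Subtype.val : Ioi (0 : ℝ) → ℝ)) :=
        lintegral_withDensity_eq_lintegral_mul (volume.comap (Subtype.val : Ioi (0 : ℝ) → ℝ))
          (f := fun h ↦ ENNReal.ofReal ((h : ℝ) ^ (Module.finrank ℝ E - 1)))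
          (by fun_prop) hk.lintegral_prod_left'
    _ = ∫⁻ h : Ioi (0 : ℝ), (fun h : ℝ ↦ ∫⁻ θ,
          ENNReal.ofReal (h ^ (Module.finrank ℝ E - 1)) * g (h • (θ : E))
          ∂μ.toSphere) h ∂(volume.comap (Subtype.val : Ioi (0 : ℝ) → ℝ)) := by
        refine lintegral_congr fun h ↦ ?_
        change _ = ∫⁻ θ, _ ∂_
        rw [lintegral_const_mul]
        exact hg.comp (Continuous.measurable (by fun_prop))
    _ = _ := lintegral_subtype_comap measurableSet_Ioi fun h : ℝ ↦
        ∫⁻ θ : Metric.sphere (0 : E) 1, ENNReal.ofReal (h ^ (Module.finrank ℝ E - 1))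
          * g (h • (θ : E)) ∂μ.toSphere

end Fermi
end

/-! ### Polar coordinates in the normal spaces and the volume bound -/

noncomputable section
namespace Fermi
open Filter Topology

/-- The set of vectors in polar position with respect to `S`. -/
def polarImage {E : Type*} [NormedAddCommGroup E] [NormedSpace ℝ E]
    (S : Set (ℝ × ℝ × Metric.sphere (0 : E) 1)) : Set (ℝ × E) :=
  (fun z : ℝ × ({0}ᶜ : Set E) ↦ (z.1, (z.2 : E))) ''
    ((fun z : ℝ × ({0}ᶜ : Set E) ↦ (z.1, ‖(z.2 : E)‖, (homeomorphUnitSphereProd E z.2).1)) ⁻¹' S)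

lemma smul_mem_polarImage_iff {E : Type*} [NormedAddCommGroup E] [NormedSpace ℝ E]
    {S : Set (ℝ × ℝ × Metric.sphere (0 : E) 1)} {u h : ℝ} (hh : 0 < h)
    {θ : Metric.sphere (0 : E) 1} : (u, h • (θ : E)) ∈ polarImage S ↔ (u, h, θ) ∈ S := by
  set w := (homeomorphUnitSphereProd E).symm (θ, ⟨h, hh⟩) with hw
  have hw1 : (w : E) = h • (θ : E) := by simp [hw]
  have hw2 : homeomorphUnitSphereProd E w = (θ, ⟨h, hh⟩) :=
    (homeomorphUnitSphereProd E).apply_symm_apply _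
  have hw3 : ‖(w : E)‖ = h := by rw [hw1, norm_smul]; simp [abs_of_pos hh]
  constructor
  · rintro ⟨⟨u', w'⟩, hz, heq⟩
    obtain ⟨rfl, h1⟩ := Prod.mk.inj heq
    obtain rfl : w' = w := Subtype.ext (h1.trans hw1.symm)
    simpa only [mem_preimage, hw2, hw3] using hz
  · intro hS
    refine ⟨(u, w), ?_, Prod.ext rfl hw1⟩
    simpa only [mem_preimage, hw2, hw3] using hS

lemma exists_of_mem_polarImage {E : Type*} [NormedAddCommGroup E] [NormedSpace ℝ E]
    {S : Set (ℝ × ℝ × Metric.sphere (0 : E) 1)} {q : ℝ × E} (hq : q ∈ polarImage S) :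
    ∃ θ : Metric.sphere (0 : E) 1, 0 < ‖q.2‖ ∧ q.2 = ‖q.2‖ • (θ : E) ∧ (q.1, ‖q.2‖, θ) ∈ S := by
  obtain ⟨⟨u, w⟩, hz, rfl⟩ := hq
  have hpos : 0 < ‖(w : E)‖ := norm_pos_iff.2 w.2
  exact ⟨(homeomorphUnitSphereProd E w).1, hpos, by simp [smul_smul, hpos.ne'], hz⟩

lemma measurableSet_polarImage {E : Type*} [NormedAddCommGroup E] [NormedSpace ℝ E]
    [FiniteDimensional ℝ E] [MeasurableSpace E] [BorelSpace E]
    {S : Set (ℝ × ℝ × Metric.sphere (0 : E) 1)} (hS : MeasurableSet S) :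
    MeasurableSet (polarImage S) := by
  have : ProperSpace E := FiniteDimensional.proper_real E
  refine (MeasurableEmbedding.id.prodMap (MeasurableEmbedding.subtype_coe
    (measurableSet_singleton (0 : E)).compl)).measurableSet_image.2
    (Measurable.comp (f := fun z : ℝ × ({0}ᶜ : Set E) ↦
      (z.1, ‖(z.2 : E)‖, (homeomorphUnitSphereProd E z.2).1)) measurable_id ?_ hS)
  have := (homeomorphUnitSphereProd E).continuous
  exact Continuous.measurable (by fun_prop)

/-- Fubini in u and polar coordinates in the normal variable: the radial density cancels the inverse
power. It is only an inequality because points of S with h ≤ 0 do not contribute on the left. -/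
lemma setLIntegral_polarImage_le {E : Type*} [NormedAddCommGroup E] [NormedSpace ℝ E]
    [FiniteDimensional ℝ E] [Nontrivial E] [MeasurableSpace E] [BorelSpace E] (μ : Measure E)
    [μ.IsAddHaarMeasure] {S : Set (ℝ × ℝ × Metric.sphere (0 : E) 1)} (hS : MeasurableSet S)
    {ρ : ℝ → ℝ} (hρ : Measurable ρ) :
    ∫⁻ q in polarImage S, ENNReal.ofReal ((‖q.2‖ ^ (Module.finrank ℝ E - 1))⁻¹ * ρ ‖q.2‖)
        ∂(volume : Measure ℝ).prod μ
      ≤ ((volume : Measure ℝ).prod ((volume : Measure ℝ).prod μ.toSphere)).withDensity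
        (fun q ↦ ENNReal.ofReal (ρ q.2.1)) S := by
  have : ProperSpace E := FiniteDimensional.proper_real E
  have hT := measurableSet_polarImage hS
  have hg : Measurable fun q : ℝ × E ↦
      ENNReal.ofReal ((‖q.2‖ ^ (Module.finrank ℝ E - 1))⁻¹ * ρ ‖q.2‖) := by
    fun_prop
  have hρ' : Measurable fun q : ℝ × ℝ × Metric.sphere (0 : E) 1 ↦ ENNReal.ofReal (ρ q.2.1) := by
    fun_prop
  have hgT := hg.indicator hT
  have hρS := hρ'.indicator hS
  rw [withDensity_apply _ hS, ← lintegral_indicator hT, ← lintegral_indicator hS,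
    lintegral_prod _ hgT.aemeasurable, lintegral_prod _ hρS.aemeasurable]
  refine lintegral_mono fun u ↦ ?_
  have h1 : Measurable fun w ↦ (polarImage S).indicator
      (fun q ↦ ENNReal.ofReal ((‖q.2‖ ^ (Module.finrank ℝ E - 1))⁻¹ * ρ ‖q.2‖)) (u, w) :=
    hgT.comp measurable_prodMk_left
  have h2 : Measurable fun z ↦ S.indicator (fun q ↦ ENNReal.ofReal (ρ q.2.1)) (u, z) :=
    hρS.comp measurable_prodMk_left
  rw [lintegral_polar μ h1, lintegral_prod _ h2.aemeasurable]
  refine le_trans (le_of_eq ?_) (setLIntegral_le_lintegral (Ioi 0) _)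
  refine setLIntegral_congr_fun measurableSet_Ioi fun h (hh : 0 < h) ↦ lintegral_congr fun θ ↦ ?_
  by_cases hmem : (u, h, θ) ∈ S
  · rw [indicator_of_mem hmem, indicator_of_mem ((smul_mem_polarImage_iff hh).2 hmem),
      ← ENNReal.ofReal_mul (by positivity)]
    have hn : ‖h • (θ : E)‖ = h := by rw [norm_smul]; simp [abs_of_pos hh]
    simp only [hn]
    rw [mul_inv_cancel_left₀ (by positivity)]
  · rw [indicator_of_notMem hmem, indicator_of_notMem (mt (smul_mem_polarImage_iff hh).1 hmem),
      mul_zero]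

section

variable {d : ℕ} {M : Type*} [EMetricSpace M] [CompleteSpace M] [SecondCountableTopology M]
  [ChartedSpace (EuclideanSpace ℝ (Fin d)) M]
  [IsManifold (𝓡 d) ∞ M] [RiemannianBundle (fun p : M ↦ TangentSpace (𝓡 d) p)]
  [IsContMDiffRiemannianBundle (𝓡 d) ∞ (EuclideanSpace ℝ (Fin d))
      (fun p : M ↦ TangentSpace (𝓡 d) p)] [IsRiemannianManifold (𝓡 d) M]
  [MeasurableSpace M] [BorelSpace M]
  {φ : ℝ → M} {L : EuclideanSpace ℝ (Fin (d - 1)) →ₗᵢ[ℝ] TangentSpace (𝓡 d) (φ 0)}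

/-- A pointwise bound for the Jacobian in Fermi coordinates bounds the volume. -/
lemma riemannianVolume_fermiMap_image_le (hd : 2 ≤ d) (hφ : ContMDiff 𝓘(ℝ, ℝ) (𝓡 d) ∞ φ)
    {ρ : ℝ → ℝ} (hρ : Measurable ρ)
    {S : Set (ℝ × ℝ × Metric.sphere (0 : EuclideanSpace ℝ (Fin (d - 1))) 1)}
    (hS : MeasurableSet S) (hS0 : ∀ q ∈ S, 0 ≤ q.2.1)
    (hle : ∀ u h θ, (u, h, θ) ∈ S → 0 < h → h ^ (d - 2)
      * normalJacobian φ L (u, h • (θ : EuclideanSpace ℝ (Fin (d - 1)))) ≤ ρ h) :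
    riemannianVolume d M (fermiMap φ L '' S)
      ≤ ((volume : Measure ℝ).prod ((volume : Measure ℝ).prod
        (volume : Measure (EuclideanSpace ℝ (Fin (d - 1)))).toSphere)).withDensity
          (fun q ↦ ENNReal.ofReal (ρ q.2.1)) S := by
  have : Nonempty (Fin (d - 1)) := ⟨⟨0, by omega⟩⟩
  have hfr : Module.finrank ℝ (EuclideanSpace ℝ (Fin (d - 1))) - 1 = d - 2 := by
    rw [finrank_euclideanSpace_fin]
    omega
  have hT := measurableSet_polarImage hS
  -- Points with h = 0 are mapped into φ, the image of the axis ℝ × {0}. The axis is null because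
  -- the normal space has positive dimension.
  have hsub : fermiMap φ L '' S ⊆ normalExp φ L '' polarImage S
      ∪ normalExp φ L '' (univ ×ˢ {0}) := by
    rintro _ ⟨⟨u, h, θ⟩, hq, rfl⟩
    rcases (hS0 _ hq).eq_or_lt with h0 | h0
    · right
      refine ⟨(u, 0), ⟨trivial, rfl⟩, ?_⟩
      have h1 : h = 0 := h0.symm
      simp [fermiMap, h1]
    · exact Or.inl ⟨(u, h • (θ : EuclideanSpace ℝ (Fin (d - 1)))),
        (smul_mem_polarImage_iff h0).2 hq, rfl⟩
  have hnull : riemannianVolume d M (normalExp φ L '' (univ ×ˢ {0})) = 0 := by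
    refine le_antisymm ((riemannianVolume_normalExp_image_le (by omega) hφ
      (MeasurableSet.univ.prod (measurableSet_singleton 0))).trans_eq ?_) bot_le
    refine setLIntegral_measure_zero _ _ ?_
    rw [Measure.volume_eq_prod, Measure.prod_prod, measure_singleton, mul_zero]
  calc riemannianVolume d M (fermiMap φ L '' S)
      ≤ riemannianVolume d M (normalExp φ L '' polarImage S)
        + riemannianVolume d M (normalExp φ L '' (univ ×ˢ {0})) :=
        (measure_mono hsub).trans (measure_union_le _ _)
    _ ≤ ∫⁻ q in polarImage S, ENNReal.ofReal (normalJacobian φ L q) := by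
        rw [hnull, add_zero]
        exact riemannianVolume_normalExp_image_le (by omega) hφ hT
    _ ≤ ∫⁻ q in polarImage S, ENNReal.ofReal
          ((‖q.2‖ ^ (Module.finrank ℝ (EuclideanSpace ℝ (Fin (d - 1))) - 1))⁻¹ * ρ ‖q.2‖) := by
        refine setLIntegral_mono' hT fun q hq ↦ ENNReal.ofReal_le_ofReal ?_
        obtain ⟨θ, hpos, hθ, hqS⟩ := exists_of_mem_polarImage hq
        have h := hle _ _ _ hqS hpos
        rw [← hθ] at h
        rw [hfr, ← div_eq_inv_mul, le_div_iff₀' (pow_pos hpos _)]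
        exact h
    _ ≤ _ := setLIntegral_polarImage_le volume hS hρ

end

end Fermi
end

theorem lemma3p2 {d : ℕ} (hd : 2 ≤ d)
    {M : Type*} [EMetricSpace M] [SecondCountableTopology M] [CompleteSpace M]
    [ChartedSpace (EuclideanSpace ℝ (Fin d)) M] [IsManifold (𝓡 d) ∞ M]
    [RiemannianBundle (fun p : M ↦ TangentSpace (𝓡 d) p)]
    [IsContMDiffRiemannianBundle (𝓡 d) ∞ (EuclideanSpace ℝ (Fin d))
      (fun p : M ↦ TangentSpace (𝓡 d) p)]
    [IsRiemannianManifold (𝓡 d) M] [MeasurableSpace M] [BorelSpace M]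
    {c₂ : ℝ} (hc₂ : 0 < c₂)
    (hcurv : ∀ (p : M) (v w : TangentSpace (𝓡 d) p), LinearIndependent ℝ ![v, w] →
      -c₂ ≤ Fermi.sectionalCurvature p v w)
    (φ : ℝ → M) (hφ : Fermi.IsGeodesic d φ)
    (hunit : ∀ t, ‖Fermi.velocity (d := d) φ t‖ = 1)
    (L : EuclideanSpace ℝ (Fin (d - 1)) →ₗᵢ[ℝ] TangentSpace (𝓡 d) (φ 0))
    (hL : ∀ w, inner ℝ (L w) (Fermi.velocity (d := d) φ 0) = 0) :
    (∀ S : Set (ℝ × ℝ × Metric.sphere (0 : EuclideanSpace ℝ (Fin (d - 1))) 1),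
      MeasurableSet S → (∀ q ∈ S, 0 ≤ q.2.1 ∧ Fermi.NoFocalPointBefore φ L q) →
        Fermi.riemannianVolume d M (Fermi.fermiMap φ L '' S) ≤ Fermi.modelVolume d c₂ S) ∧
    ((∀ (p : M) (v w : TangentSpace (𝓡 d) p), LinearIndependent ℝ ![v, w] →
        Fermi.sectionalCurvature p v w ≤ 0) →
      ∀ S : Set (ℝ × ℝ × Metric.sphere (0 : EuclideanSpace ℝ (Fin (d - 1))) 1),
        MeasurableSet S → (∀ q ∈ S, 0 ≤ q.2.1) →
          Fermi.riemannianVolume d M (Fermi.fermiMap φ L '' S) ≤ Fermi.modelVolume d c₂ S) := by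
  -- Both situations are treated together, since `normalJacobian_le` accepts absence of focal points
  -- or nonpositive curvature.
  have key : ∀ S : Set (ℝ × ℝ × Metric.sphere (0 : EuclideanSpace ℝ (Fin (d - 1))) 1),
      MeasurableSet S → (∀ q ∈ S, 0 ≤ q.2.1) → (∀ q ∈ S, Fermi.NoFocalPointBefore φ L q ∨
        ∀ (p : M) (v w : TangentSpace (𝓡 d) p), LinearIndependent ℝ ![v, w] →
          Fermi.sectionalCurvature p v w ≤ 0) →
      Fermi.riemannianVolume d M (Fermi.fermiMap φ L '' S) ≤ Fermi.modelVolume d c₂ S := by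
    intro S hS hS0 h
    refine Fermi.riemannianVolume_fermiMap_image_le hd hφ.1 (ρ := Fermi.modelDensity d c₂)
      (Continuous.measurable ?_) hS hS0 fun u H θ hq hH ↦
        Fermi.normalJacobian_le hd hφ hunit hL hc₂ hcurv hH (by simp) (h _ hq)
    unfold Fermi.modelDensity
    fun_prop
  exact ⟨fun S hS h ↦ key S hS (fun q hq ↦ (h q hq).1) fun q hq ↦ Or.inl (h q hq).2,
    fun hneg S hS h ↦ key S hS h fun _ _ ↦ Or.inr hneg⟩
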